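/- Let $d\ge 3$ and let $V:\mathbb{R}^d\to\mathbb{R}$ satisfy one of the following conditions: (i) $d=3$ and $V\in L^{3/2}(\mathbb{R}^3)$; (ii) $d=4$ and $V\in L^2(\mathbb{R}^4)\cap L^{2+\mu}(\mathbb{R}^4)$ for some $\mu>0$; (iii) $d\ge 5$ and $V\in L^{d/2}(\mathbb{R}^d)$. Let $h=-\Delta+V$ be the self-adjoint operator in $L^2(\mathbb{R}^d)$ associated with the quadratic form $\Vert\nabla u\Vert^2+\int_{\mathbb{R}^d} V|u|^2\,dx$ on $H^1(\mathbb{R}^d)$, and for $\varepsilon\in(0,1)$ let $h_\varepsilon=h+\varepsilon\Delta$ be the one associated with $(1-\varepsilon)\Vert\nabla u\Vert^2+\int_{\mathbb{R}^d} V|u|^2\,dx$. Assume that $h$ has a virtual level at zero, i.e. $h\ge 0$ and, for all sufficiently small $\varepsilon>0$, $$\inf \mathcal{S}_{\mathrm{ess}}(h_\varepsilon)=0\qquad\text{and}\qquad \inf\mathcal{S}(h_\varepsilon)<0,$$ where $\mathcal{S}$ and $\mathcal{S}_{\mathrm{ess}}$ denote the spectrum and the essential spectrum. Then there exists a function $\varphi_0\in\dot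 H^1(\mathbb{R}^d)$, not almost everywhere zero, where $\dot H^1(\mathbb{R}^d)$ is the closure of $C_c^\infty(\mathbb{R}^d)$ in the norm $\Vert\nabla\,\cdot\,\Vert_{L^2}$ (realized as a space of functions), such that $V|\varphi_0|^2$ is integrable, $$\Vert\nabla\varphi_0\Vert^2+\int_{\mathbb{R}^d} V|\varphi_0|^2\,dx=0,$$ and for every $\alpha$ with $0\le\alpha<\frac{d-2}{2}$ $$\nabla\bigl(|x|^{\alpha}\varphi_0\bigr)\in L^2(\mathbb{R}^d)\qquad\text{and}\qquad (1+|x|)^{\alpha-1}\varphi_0\in L^2(\mathbb{R}^d).$$ In particular, if $d\ge 5$, then zero is an eigenvalue of $h$, with eigenfunction $\varphi_0$. -/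

import Mathlib

open MeasureTheory Filter Topology
open scoped ENNReal ContDiff ComplexConjugate

/-- Euclidean space `ℝ^d`. -/
abbrev RSpace (d : ℕ) : Type := EuclideanSpace ℝ (Fin d)

/-- The complex Hilbert space `L²(ℝ^d)`. -/
abbrev L2Space (d : ℕ) : Type := Lp ℂ 2 (volume : Measure (RSpace d))

/-- The coordinate direction `e_i`. -/
noncomputable abbrev coordVec {d : ℕ} (i : Fin d) : RSpace d := EuclideanSpace.single i (1 : ℝ)

/-- The classical gradient `(∂₁η, …, ∂_dη)` of a complex-valued function. -/
noncomputable def classicalGrad {d : ℕ} (η : RSpace d → ℂ) (x : RSpace d) :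
    EuclideanSpace ℂ (Fin d) :=
  WithLp.toLp 2 fun i => fderiv ℝ η x (coordVec i)

/-- `g` is the weak gradient of `u` on `ℝ^d`: both are locally integrable and
`∫ u ∂_i η = - ∫ g_i η` for every test function `η` and every `i`. -/
def HasWeakGrad {d : ℕ} (u : RSpace d → ℂ) (g : RSpace d → EuclideanSpace ℂ (Fin d)) : Prop :=
  LocallyIntegrable u ∧ LocallyIntegrable g ∧
    ∀ η : RSpace d → ℝ, ContDiff ℝ ∞ η → HasCompactSupport η → ∀ i : Fin d,
      ∫ x, fderiv ℝ η x (coordVec i) • u x = - ∫ x, η x • g x i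

/-- `u ∈ H¹(ℝ^d)`, with weak gradient `g`. -/
def MemH1 {d : ℕ} (u : RSpace d → ℂ) (g : RSpace d → EuclideanSpace ℂ (Fin d)) : Prop :=
  MemLp u 2 ∧ HasWeakGrad u g ∧ MemLp g 2

/-- `u ∈ Ḣ¹(ℝ^d)`, with weak gradient `g`. The space `Ḣ¹` is the closure of `C_c^∞` in the
gradient norm; an element of the closure is identified with the function to which an approximating
sequence converges in `L¹_loc` (for `d ≥ 3` that limit exists and is unique). -/
def MemHDot1 {d : ℕ} (u : RSpace d → ℂ) (g : RSpace d → EuclideanSpace ℂ (Fin d)) : Prop :=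
  HasWeakGrad u g ∧ MemLp g 2 ∧
    ∃ η : ℕ → RSpace d → ℂ,
      (∀ n, ContDiff ℝ ∞ (η n) ∧ HasCompactSupport (η n)) ∧
      Tendsto (fun n => eLpNorm (fun x => classicalGrad (η n) x - g x) 2 volume) atTop (𝓝 0) ∧
      ∀ R : ℝ, Tendsto (fun n => ∫ x in Metric.closedBall 0 R, ‖η n x - u x‖) atTop (𝓝 0)

/-- `u` belongs to the form domain of `-Δ + V`, with weak gradient `g`: it is an `H¹` function
with `∫ |V| |u|² < ∞` (which is automatic if `V` is form-bounded relative to `-Δ`). -/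
def MemFormDomain {d : ℕ} (V : RSpace d → ℝ) (u : RSpace d → ℂ)
    (g : RSpace d → EuclideanSpace ℂ (Fin d)) : Prop :=
  MemH1 u g ∧ Integrable fun x => V x * ‖u x‖ ^ 2

/-- `-Δ + V ≥ 0`: the quadratic form `‖∇u‖² + ⟨Vu, u⟩` is nonnegative on the form domain. -/
def SchrodingerNonneg {d : ℕ} (V : RSpace d → ℝ) : Prop :=
  ∀ (u : RSpace d → ℂ) (g : RSpace d → EuclideanSpace ℂ (Fin d)), MemFormDomain V u g →
    0 ≤ (∫ x, ‖g x‖ ^ 2) + ∫ x, V x * ‖u x‖ ^ 2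

section WeakGradFacts

variable {d : ℕ}

theorem HasWeakGrad.add {u v : RSpace d → ℂ} {g k : RSpace d → EuclideanSpace ℂ (Fin d)}
    (hu : HasWeakGrad u g) (hv : HasWeakGrad v k) : HasWeakGrad (u + v) (g + k) := by
  refine ⟨hu.1.add hv.1, hu.2.1.add hv.2.1, fun η hη hc i => ?_⟩
  have cη : Continuous fun x => fderiv ℝ η x (coordVec i) :=
    (hη.continuous_fderiv (by simp)).clm_apply continuous_const
  have sη : HasCompactSupport fun x => fderiv ℝ η x (coordVec i) :=
    hc.fderiv_apply (𝕜 := ℝ) (coordVec i)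
  have hgi : LocallyIntegrable fun x => g x i := fun x => by
    obtain ⟨s, hs, h⟩ := hu.2.1 x
    exact ⟨s, hs, (EuclideanSpace.proj (𝕜 := ℂ) i).integrable_comp h⟩
  have hki : LocallyIntegrable fun x => k x i := fun x => by
    obtain ⟨s, hs, h⟩ := hv.2.1 x
    exact ⟨s, hs, (EuclideanSpace.proj (𝕜 := ℂ) i).integrable_comp h⟩
  have e1 := hu.2.2 η hη hc i
  have e2 := hv.2.2 η hη hc i
  simp only [Pi.add_apply, PiLp.add_apply, smul_add]
  rw [integral_add (hu.1.integrable_smul_left_of_hasCompactSupport cη sη)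
      (hv.1.integrable_smul_left_of_hasCompactSupport cη sη),
    integral_add (hgi.integrable_smul_left_of_hasCompactSupport hη.continuous hc)
      (hki.integrable_smul_left_of_hasCompactSupport hη.continuous hc), e1, e2]
  ring

theorem HasWeakGrad.const_smul {u : RSpace d → ℂ} {g : RSpace d → EuclideanSpace ℂ (Fin d)}
    (hu : HasWeakGrad u g) (c : ℂ) : HasWeakGrad (c • u) (c • g) := by
  refine ⟨hu.1.smul c, hu.2.1.smul c, fun η hη hc i => ?_⟩
  simp only [Pi.smul_apply, PiLp.smul_apply]
  simp_rw [smul_comm _ c]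
  rw [integral_smul, integral_smul, hu.2.2 η hη hc i, smul_neg]

theorem HasWeakGrad.congr {u v : RSpace d → ℂ} {g : RSpace d → EuclideanSpace ℂ (Fin d)}
    (hu : HasWeakGrad u g) (h : u =ᵐ[volume] v) : HasWeakGrad v g := by
  refine ⟨hu.1.congr h, hu.2.1, fun η hη hc i => ?_⟩
  rw [← hu.2.2 η hη hc i]
  refine integral_congr_ae ?_
  filter_upwards [h] with x hx
  rw [hx]

theorem MemFormDomain.integrable_mul {V : RSpace d → ℝ} {u v : RSpace d → ℂ}
    {g k : RSpace d → EuclideanSpace ℂ (Fin d)}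
    (hu : MemFormDomain V u g) (hv : MemFormDomain V v k) :
    Integrable fun x => (V x : ℂ) * (conj (v x) * u x) := by
  have hm : AEStronglyMeasurable (fun x => (V x : ℂ) * (conj (v x) * u x)) volume := by
    have h1 : AEStronglyMeasurable
        (fun x => (((V x * ‖u x‖ ^ 2 : ℝ) : ℂ)) * (((‖u x‖ ^ 2 : ℝ) : ℂ)⁻¹ * (conj (v x) * u x)))
        volume := by
      have a := hu.2.aestronglyMeasurable.aemeasurable
      have b := hu.1.1.aestronglyMeasurable.aemeasurable
      have c := hv.1.1.aestronglyMeasurable.aemeasurable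
      have c' : AEMeasurable (fun x => conj (v x)) volume :=
        Complex.continuous_conj.measurable.comp_aemeasurable c
      have e : AEMeasurable (fun x => ((‖u x‖ ^ 2 : ℝ) : ℂ)) volume :=
        Complex.measurable_ofReal.comp_aemeasurable (b.norm.pow_const 2)
      exact ((Complex.measurable_ofReal.comp_aemeasurable a).mul
        (e.inv.mul (c'.mul b))).aestronglyMeasurable
    refine h1.congr (Eventually.of_forall fun x => ?_)
    by_cases h : u x = 0
    · simp [h]
    · have h2 : ((‖u x‖ ^ 2 : ℝ) : ℂ) ≠ 0 := by
        simpa using h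
      simp only [Complex.ofReal_mul]
      rw [mul_assoc, mul_inv_cancel_left₀ h2]
  refine (hu.2.norm.add hv.2.norm).mono' hm (Eventually.of_forall fun x => ?_)
  simp only [norm_mul, Complex.norm_real, Pi.add_apply, norm_pow, norm_norm, RCLike.norm_conj]
  nlinarith [mul_nonneg (norm_nonneg (V x)) (sq_nonneg (‖u x‖ - ‖v x‖)),
    mul_nonneg (norm_nonneg (V x)) (sq_nonneg (‖u x‖)),
    mul_nonneg (norm_nonneg (V x)) (sq_nonneg (‖v x‖))]

theorem MemFormDomain.congr {V : RSpace d → ℝ} {u v : RSpace d → ℂ}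
    {g : RSpace d → EuclideanSpace ℂ (Fin d)}
    (hu : MemFormDomain V u g) (h : u =ᵐ[volume] v) : MemFormDomain V v g := by
  refine ⟨⟨hu.1.1.ae_eq h, hu.1.2.1.congr h, hu.1.2.2⟩, hu.2.congr ?_⟩
  filter_upwards [h] with x hx
  rw [hx]

theorem MemFormDomain.const_smul {V : RSpace d → ℝ} {u : RSpace d → ℂ}
    {g : RSpace d → EuclideanSpace ℂ (Fin d)}
    (hu : MemFormDomain V u g) (c : ℂ) : MemFormDomain V (c • u) (c • g) := by
  refine ⟨⟨hu.1.1.const_smul c, hu.1.2.1.const_smul c, hu.1.2.2.const_smul c⟩,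
    (hu.2.const_mul (‖c‖ ^ 2)).congr (Eventually.of_forall fun x => ?_)⟩
  simp only [Pi.smul_apply, norm_smul]
  ring

theorem MemFormDomain.add {V : RSpace d → ℝ} {u v : RSpace d → ℂ}
    {g k : RSpace d → EuclideanSpace ℂ (Fin d)}
    (hu : MemFormDomain V u g) (hv : MemFormDomain V v k) : MemFormDomain V (u + v) (g + k) := by
  refine ⟨⟨hu.1.1.add hv.1.1, hu.1.2.1.add hv.1.2.1, hu.1.2.2.add hv.1.2.2⟩, ?_⟩
  refine ((hu.2.add hv.2).add ((hu.integrable_mul hv).re.const_mul 2)).congr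
    (Eventually.of_forall fun x => ?_)
  simp only [Pi.add_apply]
  have h1 : ‖u x + v x‖ ^ 2 = ‖u x‖ ^ 2 + ‖v x‖ ^ 2 + 2 * (conj (v x) * u x).re := by
    simp only [← Complex.normSq_eq_norm_sq, Complex.normSq_apply, Complex.add_re, Complex.add_im,
      Complex.mul_re, Complex.conj_re, Complex.conj_im]
    ring
  rw [h1]
  simp only [RCLike.re_to_complex, Complex.re_ofReal_mul]
  ring

theorem MemFormDomain.zero (V : RSpace d → ℝ) :
    MemFormDomain V (0 : RSpace d → ℂ) (0 : RSpace d → EuclideanSpace ℂ (Fin d)) := by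
  refine ⟨⟨MemLp.zero, ⟨locallyIntegrable_zero, locallyIntegrable_zero, fun η _ _ i => by simp⟩,
    MemLp.zero⟩, by simp⟩

end WeakGradFacts

/-- The graph of the operator associated with the quadratic form `c‖∇u‖² + ⟨Vu, u⟩`:
all pairs `(u, f)` such that `u` is in the form domain and
`c⟨∇v, ∇u⟩ + ⟨v, Vu⟩ = ⟨v, f⟩` for every `v` in the form domain. -/
noncomputable def schrodingerGraph {d : ℕ} (c : ℝ) (V : RSpace d → ℝ) :
    Submodule ℂ (L2Space d × L2Space d) where
  carrier := {p | ∃ g, MemFormDomain V p.1 g ∧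
    ∀ (v : L2Space d) (k : RSpace d → EuclideanSpace ℂ (Fin d)), MemFormDomain V v k →
      (c : ℂ) * (∫ x, inner ℂ (k x) (g x)) + ∫ x, (V x : ℂ) * (conj (v x) * p.1 x)
        = inner ℂ v p.2}
  zero_mem' := by
    have h0 : ((0 : L2Space d) : RSpace d → ℂ) =ᵐ[volume] 0 := Lp.coeFn_zero ℂ 2 volume
    refine ⟨0, (MemFormDomain.zero V).congr h0.symm, fun v k _ => ?_⟩
    have : ∫ x, (V x : ℂ) * (conj (v x) * (0 : L2Space d) x) = ∫ _ : RSpace d, (0 : ℂ) := by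
      refine integral_congr_ae ?_
      filter_upwards [h0] with x hx
      rw [hx]
      simp
    simp only [Prod.fst_zero, Prod.snd_zero, Pi.zero_apply, inner_zero_right]
    rw [this]
    simp
  add_mem' := by
    rintro ⟨u₁, f₁⟩ ⟨u₂, f₂⟩ ⟨g₁, h₁, e₁⟩ ⟨g₂, h₂, e₂⟩
    have hadd : ((u₁ + u₂ : L2Space d) : RSpace d → ℂ) =ᵐ[volume] u₁ + u₂ := Lp.coeFn_add u₁ u₂
    refine ⟨g₁ + g₂, (h₁.add h₂).congr hadd.symm, fun v k hv => ?_⟩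
    have hi : ∀ {g : RSpace d → EuclideanSpace ℂ (Fin d)}, MemLp g 2 →
        Integrable fun x => inner ℂ (k x) (g x) := fun hg => by
      refine (L2.integrable_inner (𝕜 := ℂ) (hv.1.2.2.toLp k) (hg.toLp _)).congr ?_
      filter_upwards [hv.1.2.2.coeFn_toLp, hg.coeFn_toLp] with x hx hy
      rw [hx, hy]
    have k1 : ∫ x, (V x : ℂ) * (conj (v x) * (u₁ + u₂ : L2Space d) x) =
        (∫ x, (V x : ℂ) * (conj (v x) * u₁ x)) + ∫ x, (V x : ℂ) * (conj (v x) * u₂ x) := by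
      rw [← integral_add (h₁.integrable_mul hv) (h₂.integrable_mul hv)]
      refine integral_congr_ae ?_
      filter_upwards [hadd] with x hx
      rw [hx, Pi.add_apply]
      ring
    have k2 : ∫ x, inner ℂ (k x) ((g₁ + g₂) x) =
        (∫ x, inner ℂ (k x) (g₁ x)) + ∫ x, inner ℂ (k x) (g₂ x) := by
      rw [← integral_add (hi h₁.1.2.2) (hi h₂.1.2.2)]
      simp only [Pi.add_apply, inner_add_right]
    have a₁ := e₁ v k hv
    have a₂ := e₂ v k hv
    simp only [Prod.mk_add_mk] at *
    rw [k1, k2, inner_add_right, ← a₁, ← a₂]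
    ring
  smul_mem' := by
    rintro a ⟨u, f⟩ ⟨g, h, e⟩
    have hs : ((a • u : L2Space d) : RSpace d → ℂ) =ᵐ[volume] a • u := Lp.coeFn_smul a u
    refine ⟨a • g, (h.const_smul a).congr hs.symm, fun v k hv => ?_⟩
    have k1 : ∫ x, (V x : ℂ) * (conj (v x) * (a • u : L2Space d) x) =
        a * ∫ x, (V x : ℂ) * (conj (v x) * u x) := by
      rw [← integral_const_mul]
      refine integral_congr_ae ?_
      filter_upwards [hs] with x hx
      rw [hx, Pi.smul_apply, smul_eq_mul]
      ring
    have k2 : ∫ x, inner ℂ (k x) ((a • g) x) = a * ∫ x, inner ℂ (k x) (g x) := by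
      rw [← integral_const_mul]
      simp only [Pi.smul_apply, inner_smul_right]
    have a₁ := e v k hv
    simp only [Prod.smul_mk] at *
    rw [k1, k2, inner_smul_right, ← a₁]
    ring

theorem HasWeakGrad.of_contDiff {d : ℕ} {η : RSpace d → ℂ} (hη : ContDiff ℝ ∞ η) :
    HasWeakGrad η (classicalGrad η) := by
  have cd : ∀ i : Fin d, Continuous fun x => fderiv ℝ η x (coordVec i) := fun i =>
    (hη.continuous_fderiv (by simp)).clm_apply continuous_const
  have cg : Continuous (classicalGrad η) :=
    (PiLp.continuous_toLp 2 _).comp (continuous_pi cd)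
  refine ⟨hη.continuous.locallyIntegrable, cg.locallyIntegrable, fun ζ hζ hc i => ?_⟩
  have cz : Continuous fun x => fderiv ℝ ζ x (coordVec i) :=
    (hζ.continuous_fderiv (by simp)).clm_apply continuous_const
  have sz : HasCompactSupport fun x => fderiv ℝ ζ x (coordVec i) :=
    hc.fderiv_apply (𝕜 := ℝ) (coordVec i)
  have := integral_smul_fderiv_eq_neg_fderiv_smul_of_integrable (μ := volume) (f := ζ) (g := η)
    (v := coordVec i)
    ((cz.smul hη.continuous).integrable_of_hasCompactSupport sz.smul_right)
    ((hζ.continuous.smul (cd i)).integrable_of_hasCompactSupport hc.smul_right)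
    ((hζ.continuous.smul hη.continuous).integrable_of_hasCompactSupport hc.smul_right)
    (fun x _ => (hζ.differentiable (by simp)).differentiableAt)
    (fun x _ => (hη.differentiable (by simp)).differentiableAt)
  change _ = -∫ x, ζ x • fderiv ℝ η x (coordVec i)
  rw [this, neg_neg]

theorem HasWeakGrad.eq_zero {d : ℕ} {u : RSpace d → ℂ}
    {g : RSpace d → EuclideanSpace ℂ (Fin d)} (h : HasWeakGrad u g) (hu : u =ᵐ[volume] 0) :
    g =ᵐ[volume] 0 := by
  have hi : ∀ i : Fin d, ∀ᵐ x, g x i = 0 := fun i => by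
    refine ae_eq_zero_of_integral_contDiff_smul_eq_zero (fun x => ?_) fun η hη hc => ?_
    · obtain ⟨s, hs, hg⟩ := h.2.1 x
      exact ⟨s, hs, (EuclideanSpace.proj (𝕜 := ℂ) i).integrable_comp hg⟩
    · have e := h.2.2 η hη hc i
      rw [← neg_eq_zero, ← e]
      refine integral_eq_zero_of_ae ?_
      filter_upwards [hu] with x hx
      simp [hx]
  filter_upwards [ae_all_iff.2 hi] with x hx
  ext i
  simpa using hx i

theorem MemFormDomain.of_contDiff {d : ℕ} {V : RSpace d → ℝ} (hV : LocallyIntegrable V)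
    {η : RSpace d → ℂ} (hη : ContDiff ℝ ∞ η) (hc : HasCompactSupport η) :
    MemFormDomain V η (classicalGrad η) := by
  have cg : Continuous (classicalGrad η) :=
    (PiLp.continuous_toLp 2 _).comp (continuous_pi fun i =>
      (hη.continuous_fderiv (by simp)).clm_apply continuous_const)
  have sg : HasCompactSupport (classicalGrad η) := by
    refine (hc.fderiv (𝕜 := ℝ)).mono fun x hx => ?_
    rw [Function.mem_support] at hx ⊢
    intro h0
    refine hx ?_
    ext i
    simp [classicalGrad, h0]
  refine ⟨⟨hη.continuous.memLp_of_hasCompactSupport hc, HasWeakGrad.of_contDiff hη,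
    cg.memLp_of_hasCompactSupport sg⟩, ?_⟩
  have := hV.integrable_smul_left_of_hasCompactSupport (g := fun x => ‖η x‖ ^ 2)
    (hη.continuous.norm.pow 2) (hc.comp_left (g := fun z : ℂ => ‖z‖ ^ 2) (by simp))
  refine this.congr (Eventually.of_forall fun x => ?_)
  simp only [smul_eq_mul]
  ring

/-- For a locally integrable potential the graph is the graph of an operator. -/
theorem schrodingerGraph_eq_zero {d : ℕ} (c : ℝ) {V : RSpace d → ℝ} (hV : LocallyIntegrable V) :
    ∀ p ∈ schrodingerGraph c V, p.1 = 0 → p.2 = 0 := by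
  rintro ⟨u, f⟩ ⟨g, hg, he⟩ hu
  simp only at hu hg he ⊢
  subst hu
  have h0 : ((0 : L2Space d) : RSpace d → ℂ) =ᵐ[volume] 0 := Lp.coeFn_zero ℂ 2 volume
  have hg0 := hg.1.2.1.eq_zero h0
  have hz : ∀ᵐ x, f x = 0 := by
    refine ae_eq_zero_of_integral_contDiff_smul_eq_zero
      ((Lp.memLp f).locallyIntegrable (by norm_num)) fun η hη hc => ?_
    have hη' : ContDiff ℝ ∞ fun x => (η x : ℂ) := Complex.ofRealCLM.contDiff.comp hη
    have hc' : HasCompactSupport fun x => (η x : ℂ) :=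
      hc.comp_left (g := fun t : ℝ => (t : ℂ)) (by simp)
    have hm := MemFormDomain.of_contDiff hV hη' hc'
    have hv := hm.1.1.coeFn_toLp
    have e := he (hm.1.1.toLp _) _ (hm.congr hv.symm)
    have z1 : ∫ x, inner ℂ (classicalGrad (fun x => (η x : ℂ)) x) (g x) = 0 := by
      refine integral_eq_zero_of_ae ?_
      filter_upwards [hg0] with x hx
      simp [hx]
    have z2 : ∫ x, (V x : ℂ) * (conj ((hm.1.1.toLp _ : L2Space d) x) * (0 : L2Space d) x) = 0 := by
      refine integral_eq_zero_of_ae ?_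
      filter_upwards with x
      simp
    rw [z1, z2, mul_zero, zero_add, L2.inner_def] at e
    rw [e]
    refine integral_congr_ae ?_
    filter_upwards [hv] with x hx
    rw [hx]
    simp [mul_comm]
  exact Lp.ext (by filter_upwards [hz, h0] with x hx hy; rw [hx, hy]; rfl)

/-- The operator `-cΔ + V` in `L²(ℝ^d)`, defined by its quadratic form. -/
noncomputable def schrodingerOp {d : ℕ} (c : ℝ) (V : RSpace d → ℝ) :
    L2Space d →ₗ.[ℂ] L2Space d :=
  (schrodingerGraph c V).toLinearPMap

section Spectrum

variable {H : Type*} [NormedAddCommGroup H] [InnerProductSpace ℂ H]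

/-- The map `A - z` from the domain of the unbounded operator `A`. -/
noncomputable def shiftedOp (A : H →ₗ.[ℂ] H) (z : ℂ) : A.domain →ₗ[ℂ] H :=
  A.toFun - z • A.domain.subtype

/-- The eigenspace `ker (A - z)`. -/
noncomputable def opEigenspace (A : H →ₗ.[ℂ] H) (z : ℂ) : Submodule ℂ A.domain :=
  LinearMap.ker (shiftedOp A z)

/-- The resolvent set: `A - z` is a bijection from the domain of `A` onto the whole space with a
bounded inverse. -/
def opResolventSet (A : H →ₗ.[ℂ] H) : Set ℂ :=
  {z | Function.Bijective (shiftedOp A z) ∧ ∃ C : ℝ, ∀ u : A.domain, ‖u‖ ≤ C * ‖shiftedOp A z u‖}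

/-- The spectrum of a self-adjoint operator, as a set of real numbers. -/
def opSpectrum (A : H →ₗ.[ℂ] H) : Set ℝ :=
  {t | (t : ℂ) ∉ opResolventSet A}

/-- The discrete spectrum: isolated points of the spectrum that are eigenvalues of finite
multiplicity. -/
def opDiscSpectrum (A : H →ₗ.[ℂ] H) : Set ℝ :=
  {t | t ∈ opSpectrum A ∧ (∃ δ > 0, ∀ s ∈ opSpectrum A, |s - t| < δ → s = t) ∧
    opEigenspace A t ≠ ⊥ ∧ FiniteDimensional ℂ (opEigenspace A t)}

/-- The essential spectrum: the complement of the discrete spectrum in the spectrum. -/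
def opEssSpectrum (A : H →ₗ.[ℂ] H) : Set ℝ :=
  opSpectrum A \ opDiscSpectrum A

/-- The infimum of a set of real numbers as an extended real number (`+∞` for the empty set,
`-∞` for a set that is not bounded below). -/
noncomputable def extInf (S : Set ℝ) : EReal := ⨅ t ∈ S, (t : EReal)

end Spectrum

/-- `h = -Δ + V` has a virtual level at zero: `h ≥ 0` and, for all sufficiently small `ε > 0`, the
operator `h_ε = h + εΔ` satisfies `inf S_ess(h_ε) = 0` and `inf S(h_ε) < 0`. -/
def HasVirtualLevelAtZero {d : ℕ} (V : RSpace d → ℝ) : Prop :=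
  SchrodingerNonneg V ∧
    ∀ᶠ ε : ℝ in 𝓝[>] 0,
      extInf (opEssSpectrum (schrodingerOp (1 - ε) V)) = 0 ∧
        extInf (opSpectrum (schrodingerOp (1 - ε) V)) < 0

/-- The integrability condition on the potential. -/
def ShortRange {d : ℕ} (V : RSpace d → ℝ) : Prop :=
  (d = 3 ∧ MemLp V (3 / 2)) ∨
  (d = 4 ∧ MemLp V 2 ∧ ∃ μ : ℝ, 0 < μ ∧ MemLp V (ENNReal.ofReal (2 + μ))) ∨
  (5 ≤ d ∧ MemLp V ((d : ℝ≥0∞) / 2))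

/-!
By the Sobolev embedding `Ḣ¹ ⊆ L^{2d/(d-2)}`, Hölder's inequality and Rellich's theorem, the form
`∫ V|u|²` is bounded and weakly sequentially continuous on `Ḣ¹` for `V ∈ L^{d/2}`. Negative spectrum
of `h_ε` yields `u_ε ∈ H¹` with `‖∇u_ε‖ = 1` and `∫ V|u_ε|² ≤ 2ε - 1`; along a sequence `ε → 0`
these converge weakly in `Ḣ¹` to some `φ` with `∫ V|φ|² ≤ -1`, so `φ ≠ 0`. As `‖∇φ‖ ≤ 1` and
`h ≥ 0`, the form of `h` vanishes at `φ`; hence `φ` minimizes it, and it solves `-Δφ + Vφ = 0`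
weakly.

For the decay, test this equation with `w²φ`, where `w` is a bounded truncation of
`(1 + |x|²) ^ (α / 2)`. Then `‖∇(wφ)‖² + ∫ V|wφ|² = ‖|∇w| φ‖²`, and as `|∇w| ≤ α w / |x|`, Hardy's
inequality bounds the right-hand side by `(2α / (d - 2))² ‖∇(wφ)‖²`, where `2α / (d - 2) < 1`. Up to
a bounded potential supported in a ball, `V` is small in `L^{d/2}`, so the left-hand side absorbs
this term, uniformly in the truncation, which Fatou's lemma removes. For `d ≥ 5` the choice `α = 1`
is admissible and gives `φ ∈ L²`.
-/

section Mollification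

theorem eLpNorm_le_of_enorm_le_lintegral {α β F G : Type*} [MeasurableSpace α] [MeasurableSpace β]
    [NormedAddCommGroup F] [NormedAddCommGroup G] {μ : Measure α} {ν : Measure β} [SFinite μ]
    [IsProbabilityMeasure ν] {p M : ℝ≥0∞} (hp : 1 ≤ p) (hp' : p ≠ ⊤) {f : α → F} {K : α → β → G}
    (hK : AEStronglyMeasurable (Function.uncurry K) (μ.prod ν))
    (hf : ∀ᵐ x ∂μ, ‖f x‖ₑ ≤ ∫⁻ y, ‖K x y‖ₑ ∂ν) (hM : ∀ᵐ y ∂ν, eLpNorm (fun x => K x y) p μ ≤ M) :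
    eLpNorm f p μ ≤ M := by
  have hp0 : p ≠ 0 := (one_pos.trans_le hp).ne'
  have hq : 0 < p.toReal := ENNReal.toReal_pos hp0 hp'
  have jensen : ∀ᵐ x ∂μ, ‖f x‖ₑ ^ p.toReal ≤ ∫⁻ y, ‖K x y‖ₑ ^ p.toReal ∂ν := by
    filter_upwards [hf, hK.prodMk_left] with x hx hKx
    rw [lintegral_rpow_enorm_eq_rpow_eLpNorm' hq, ← eLpNorm_eq_eLpNorm' hp0 hp']
    gcongr
    rw [← eLpNorm_one_eq_lintegral_enorm] at hx
    exact hx.trans (eLpNorm_le_eLpNorm_of_exponent_le hp hKx)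
  rw [eLpNorm_eq_eLpNorm' hp0 hp', ← ENNReal.rpow_le_rpow_iff hq,
    ← lintegral_rpow_enorm_eq_rpow_eLpNorm' hq]
  calc ∫⁻ x, ‖f x‖ₑ ^ p.toReal ∂μ
      ≤ ∫⁻ x, ∫⁻ y, ‖K x y‖ₑ ^ p.toReal ∂ν ∂μ := lintegral_mono_ae jensen
    _ = ∫⁻ y, ∫⁻ x, ‖K x y‖ₑ ^ p.toReal ∂μ ∂ν :=
        lintegral_lintegral_swap (hK.enorm.pow_const _)
    _ ≤ ∫⁻ _, M ^ p.toReal ∂ν := by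
        refine lintegral_mono_ae (hM.mono fun y hy => ?_)
        rw [lintegral_rpow_enorm_eq_rpow_eLpNorm' hq, ← eLpNorm_eq_eLpNorm' hp0 hp']
        gcongr
    _ = M ^ p.toReal := by simp

variable {E F : Type*} [NormedAddCommGroup E] [NormedSpace ℝ E] [NormedAddCommGroup F]

theorem enorm_sub_translate_le_lintegral_fderiv [NormedSpace ℝ F] [CompleteSpace F] {f : E → F}
    (hf : ContDiff ℝ 1 f) (x y : E) :
    ‖f (x - y) - f x‖ₑ ≤ ∫⁻ t in Set.Ioc (0 : ℝ) 1, ‖‖y‖ • fderiv ℝ f (x - t • y)‖ₑ := by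
  have deriv_line (t : ℝ) :
      HasDerivAt (fun t : ℝ => f (x - t • y)) (fderiv ℝ f (x - t • y) (-y)) t :=
    ((hf.differentiable one_ne_zero).differentiableAt.hasFDerivAt).comp_hasDerivAt t
      (by simpa using ((hasDerivAt_id t).smul_const y).const_sub x)
  have cont_deriv : Continuous fun t : ℝ => fderiv ℝ f (x - t • y) (-y) :=
    ((hf.continuous_fderiv one_ne_zero).comp (by fun_prop)).clm_apply continuous_const
  have ftc := intervalIntegral.integral_eq_sub_of_hasDerivAt (a := 0) (b := 1)
    (fun t _ => deriv_line t) (cont_deriv.intervalIntegrable 0 1)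
  simp only [one_smul, zero_smul, sub_zero] at ftc
  rw [← ftc, intervalIntegral.integral_of_le zero_le_one]
  refine (enorm_integral_le_lintegral_enorm _).trans (lintegral_mono fun t => ?_)
  simpa only [enorm_smul, enorm_norm, enorm_neg, mul_comm] using
    (fderiv ℝ f (x - t • y)).le_opENorm (-y)

variable [FiniteDimensional ℝ E] [MeasurableSpace E] [BorelSpace E] {μ : Measure E}
  [μ.IsAddHaarMeasure]

theorem eLpNorm_sub_translate_le [NormedSpace ℝ F] [CompleteSpace F] {f : E → F}
    (hf : ContDiff ℝ 1 f) {p : ℝ≥0∞} (hp : 1 ≤ p) (hp' : p ≠ ⊤) (y : E) :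
    eLpNorm (fun x => f (x - y) - f x) p μ ≤ ‖y‖ₑ * eLpNorm (fderiv ℝ f) p μ := by
  have : IsProbabilityMeasure (volume.restrict (Set.Ioc (0 : ℝ) 1)) := ⟨by simp⟩
  have hf' := hf.continuous_fderiv one_ne_zero
  refine eLpNorm_le_of_enorm_le_lintegral hp hp' (ν := volume.restrict (Set.Ioc (0 : ℝ) 1))
    (K := fun x t => ‖y‖ • fderiv ℝ f (x - t • y)) ?_
    (Eventually.of_forall fun x => enorm_sub_translate_le_lintegral_fderiv hf x y)
    (Eventually.of_forall fun t => ?_)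
  · have hline : Continuous fun q : E × ℝ => q.1 - q.2 • y := by fun_prop
    exact ((hf'.comp hline).const_smul ‖y‖).aestronglyMeasurable
  · refine (eLpNorm_const_smul ‖y‖ (fun x => fderiv ℝ f (x - t • y)) p μ).trans_le ?_
    rw [enorm_norm]
    gcongr
    exact (eLpNorm_comp_measurePreserving hf'.aestronglyMeasurable
      (measurePreserving_sub_right μ (t • y))).le

theorem tendsto_eLpNorm_sub_translate {p : ℝ≥0∞} [Fact (1 ≤ p)] (hp : p ≠ ⊤) {f : E → F}
    (hf : MemLp f p μ) :
    Tendsto (fun y => eLpNorm (fun x => f (x - y) - f x) p μ) (𝓝 0) (𝓝 0) := by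
  have hmp (y : E) : MeasurePreserving (fun x : E => x - y) μ μ := measurePreserving_sub_right μ y
  let τ : C(E, C(E, E)) := (ContinuousMap.mk (fun q : E × E => q.2 - q.1) (by fun_prop)).curry
  let T (y : E) : Lp F p μ := Lp.compMeasurePreserving (τ y) (hmp y) (hf.toLp f)
  have hT (y : E) : T y = (hf.comp_measurePreserving (hmp y)).toLp _ :=
    Lp.toLp_compMeasurePreserving hf (hmp y)
  have hT0 : T 0 = hf.toLp f := by
    rw [hT, MemLp.toLp_eq_toLp_iff]
    exact Eventually.of_forall fun x => by simp
  have hc : Continuous fun y => ‖T y - T 0‖ₑ :=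
    (((continuous_const (y := hf.toLp f)).compMeasurePreservingLp τ.continuous hmp hp).sub
      continuous_const).enorm
  have hlim := hc.tendsto 0
  rw [sub_self, enorm_zero] at hlim
  refine hlim.congr fun y => ?_
  rw [hT0, hT, ← MemLp.toLp_sub, Lp.enorm_toLp]
  rfl

variable [NormedSpace ℝ F]

/-- The average `x ↦ ∫ φ(x - y) f(y) dμ(y)` of `f` against the bump function `φ`, normalised to
have integral one: a smooth approximation of `f` as the radius of `φ` tends to zero. -/
noncomputable abbrev mollify (μ : Measure E) (φ : ContDiffBump (0 : E)) (f : E → F) : E → F :=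
  convolution (φ.normed μ) f (ContinuousLinearMap.lsmul ℝ ℝ) μ

theorem mollify_apply_swap (φ : ContDiffBump (0 : E)) (f : E → F) (x : E) :
    mollify μ φ f x = ∫ y, φ.normed μ (x - y) • f y ∂μ := by
  rw [mollify, convolution_eq_swap]
  rfl

variable [CompleteSpace F]

theorem enorm_mollify_sub_le (φ : ContDiffBump (0 : E)) {f : E → F} (hf : LocallyIntegrable f μ)
    (x : E) :
    ‖mollify μ φ f x - f x‖ₑ ≤
      ∫⁻ y, ‖f (x - y) - f x‖ₑ ∂μ.withDensity fun y => ENNReal.ofReal (φ.normed μ y) := by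
  have hφ : Continuous (φ.normed μ) := φ.continuous_normed
  have hconv : Integrable (fun y => φ.normed μ y • f (x - y)) μ :=
    φ.hasCompactSupport_normed.convolutionExists_left (ContinuousLinearMap.lsmul ℝ ℝ) hφ hf x
  have hsub : mollify μ φ f x - f x = ∫ y, φ.normed μ y • (f (x - y) - f x) ∂μ := by
    simp only [smul_sub]
    rw [integral_sub hconv (φ.integrable_normed.smul_const _), integral_smul_const,
      φ.integral_normed, one_smul]
    rfl
  have hm : AEStronglyMeasurable (fun y => f (x - y) - f x) μ :=
    (hf.aestronglyMeasurable.comp_quasiMeasurePreserving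
      (quasiMeasurePreserving_sub_left_of_right_invariant μ x)).sub aestronglyMeasurable_const
  rw [hsub, lintegral_withDensity_eq_lintegral_mul₀ hφ.measurable.ennreal_ofReal.aemeasurable
    hm.enorm]
  refine (enorm_integral_le_lintegral_enorm _).trans_eq (lintegral_congr fun y => ?_)
  rw [enorm_smul, Real.enorm_of_nonneg (φ.nonneg_normed y), Pi.mul_apply]

theorem eLpNorm_mollify_sub_le (φ : ContDiffBump (0 : E)) {f : E → F}
    (hf : LocallyIntegrable f μ) {p M : ℝ≥0∞} (hp : 1 ≤ p) (hp' : p ≠ ⊤)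
    (hM : ∀ y, ‖y‖ < φ.rOut → eLpNorm (fun x => f (x - y) - f x) p μ ≤ M) :
    eLpNorm (fun x => mollify μ φ f x - f x) p μ ≤ M := by
  have hφm : Measurable fun y => ENNReal.ofReal (φ.normed μ y) :=
    φ.continuous_normed.measurable.ennreal_ofReal
  let ν : Measure E := μ.withDensity fun y => ENNReal.ofReal (φ.normed μ y)
  have hν : IsProbabilityMeasure ν := ⟨by
    rw [withDensity_apply _ .univ, Measure.restrict_univ, ← ofReal_integral_eq_lintegral_ofReal
      φ.integrable_normed (Eventually.of_forall φ.nonneg_normed), φ.integral_normed,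
      ENNReal.ofReal_one]⟩
  have hfm : AEStronglyMeasurable f μ := hf.aestronglyMeasurable
  refine eLpNorm_le_of_enorm_le_lintegral hp hp' (ν := ν) (K := fun x y => f (x - y) - f x) ?_
    (Eventually.of_forall fun x => enorm_mollify_sub_le φ hf x) ?_
  · have : AEStronglyMeasurable (fun q : E × E => f (q.1 - q.2) - f q.1) (μ.prod μ) :=
      (hfm.comp_quasiMeasurePreserving
        (quasiMeasurePreserving_sub_of_right_invariant μ μ)).sub
        (hfm.comp_quasiMeasurePreserving Measure.quasiMeasurePreserving_fst)
    exact this.mono_ac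
      (Measure.AbsolutelyContinuous.rfl.prod (withDensity_absolutelyContinuous _ _))
  · refine (ae_withDensity_iff hφm).2 (Eventually.of_forall fun y hy => hM y ?_)
    have : y ∈ Function.support (φ.normed μ) := fun h0 => hy (by simp [h0])
    simpa [φ.support_normed_eq] using this

theorem tendsto_eLpNorm_mollify_sub {ι : Type*} {l : Filter ι} {φ : ι → ContDiffBump (0 : E)}
    (hφ : Tendsto (fun i => (φ i).rOut) l (𝓝 0)) {p : ℝ≥0∞} [Fact (1 ≤ p)] (hp : p ≠ ⊤) {f : E → F}
    (hf : MemLp f p μ) :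
    Tendsto (fun i => eLpNorm (fun x => mollify μ (φ i) f x - f x) p μ) l (𝓝 0) := by
  refine ENNReal.tendsto_nhds_zero.2 fun ε hε => ?_
  obtain ⟨δ, hδ, hsmall⟩ := Metric.eventually_nhds_iff.1
    (ENNReal.tendsto_nhds_zero.1 (tendsto_eLpNorm_sub_translate hp hf) ε hε)
  filter_upwards [hφ.eventually_lt_const hδ] with i hi
  exact eLpNorm_mollify_sub_le (φ i) (hf.locallyIntegrable Fact.out) Fact.out hp
    fun y hy => hsmall (by simpa using hy.trans hi)

end Mollification

section Lebesgue

variable {α F : Type*} [MeasurableSpace α] {μ : Measure α} [NormedAddCommGroup F]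

theorem tendsto_integral_smul_of_tendsto_eLpNorm [NormedSpace ℝ F] {ι : Type*} {l : Filter ι}
    {p q : ℝ≥0∞} [q.HolderTriple p 1] {f : ι → α → F} {f₀ : α → F} (hf : ∀ n, MemLp (f n) p μ)
    (hf₀ : MemLp f₀ p μ) (hlim : Tendsto (fun n => eLpNorm (f n - f₀) p μ) l (𝓝 0)) {ζ : α → ℝ}
    (hζ : MemLp ζ q μ) :
    Tendsto (fun n => ∫ x, ζ x • f n x ∂μ) l (𝓝 (∫ x, ζ x • f₀ x ∂μ)) := by
  have hint {h : α → F} (hh : MemLp h p μ) : Integrable (ζ • h) μ :=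
    memLp_one_iff_integrable.1 (hh.smul hζ)
  refine tendsto_integral_of_L1' _ (hint hf₀).1 (Eventually.of_forall fun n => hint (hf n)) ?_
  have hbound := ENNReal.Tendsto.const_mul hlim (Or.inr hζ.eLpNorm_ne_top)
  rw [mul_zero] at hbound
  refine tendsto_of_tendsto_of_tendsto_of_le_of_le tendsto_const_nhds hbound (fun _ => zero_le)
    fun n => ?_
  change eLpNorm (ζ • f n - ζ • f₀) 1 μ ≤ _
  rw [← smul_sub]
  exact eLpNorm_smul_le_mul_eLpNorm ((hf n).sub hf₀).1 hζ.1

theorem tendsto_setIntegral_norm_of_tendsto_eLpNorm {ι : Type*} {l : Filter ι} {p : ℝ≥0∞}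
    (hp : 1 ≤ p) {f : ι → α → F} (hf : ∀ n, AEStronglyMeasurable (f n) μ)
    (hlim : Tendsto (fun n => eLpNorm (f n) p μ) l (𝓝 0)) {s : Set α} (hs : μ s ≠ ⊤) :
    Tendsto (fun n => ∫ x in s, ‖f n x‖ ∂μ) l (𝓝 0) := by
  have hpr : 0 ≤ 1 / (1 : ℝ≥0∞).toReal - 1 / p.toReal := by
    rcases eq_or_ne p ⊤ with rfl | hp'
    · simp
    · have : 1 ≤ p.toReal := by simpa using ENNReal.toReal_mono hp' hp
      simpa using inv_le_one_of_one_le₀ this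
  have hbound := ENNReal.Tendsto.mul_const hlim (Or.inr (ENNReal.rpow_ne_top_of_nonneg hpr hs))
  rw [zero_mul] at hbound
  have hL1 : Tendsto (fun n => eLpNorm (f n) 1 (μ.restrict s)) l (𝓝 0) := by
    refine tendsto_of_tendsto_of_tendsto_of_le_of_le tendsto_const_nhds hbound
      (fun _ => zero_le) fun n => ?_
    refine (eLpNorm_le_eLpNorm_mul_rpow_measure_univ hp (hf n).restrict).trans ?_
    rw [Measure.restrict_apply_univ]
    gcongr
    exact Measure.restrict_le_self
  refine ((ENNReal.tendsto_toReal ENNReal.zero_ne_top).comp hL1).congr fun n => ?_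
  rw [Function.comp_apply, eLpNorm_one_eq_lintegral_enorm,
    integral_norm_eq_lintegral_enorm (hf n).restrict]

variable {ι : Type*} [Fintype ι] {f : α → EuclideanSpace ℂ ι} {p : ℝ≥0∞}

theorem eLpNorm_coord_le (f : α → EuclideanSpace ℂ ι) (i : ι) (p : ℝ≥0∞) :
    eLpNorm (fun x => f x i) p μ ≤ eLpNorm f p μ :=
  eLpNorm_mono fun x => PiLp.norm_apply_le (f x) i

theorem memLp_coord (hf : MemLp f p μ) (i : ι) : MemLp (fun x => f x i) p μ :=
  hf.continuousLinearMap_comp (EuclideanSpace.proj (𝕜 := ℂ) i)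

end Lebesgue

section TestFunctions

variable {d : ℕ} {η ζ : RSpace d → ℂ}

theorem map_eq_sum_smul_coordVec {F : Type*} [NormedAddCommGroup F] [NormedSpace ℝ F]
    (L : RSpace d →L[ℝ] F) (x : RSpace d) : L x = ∑ i, x i • L (coordVec i) := by
  conv_lhs => rw [← (EuclideanSpace.basisFun (Fin d) ℝ).sum_repr x, map_sum]
  simp only [map_smul, EuclideanSpace.basisFun_repr, EuclideanSpace.basisFun_apply]

theorem norm_fderiv_le_norm_classicalGrad (η : RSpace d → ℂ) (x : RSpace d) :
    ‖fderiv ℝ η x‖ ≤ ‖classicalGrad η x‖ := by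
  refine ContinuousLinearMap.opNorm_le_bound _ (norm_nonneg _) fun y => ?_
  rw [map_eq_sum_smul_coordVec, EuclideanSpace.norm_eq, EuclideanSpace.norm_eq]
  refine (norm_sum_le _ _).trans ?_
  simp only [norm_smul, mul_comm ‖y _‖]
  exact Real.sum_mul_le_sqrt_mul_sqrt _ _ _

theorem continuous_classicalGrad (hη : ContDiff ℝ 1 η) : Continuous (classicalGrad η) :=
  (PiLp.continuous_toLp 2 _).comp (continuous_pi fun _ =>
    (hη.continuous_fderiv one_ne_zero).clm_apply continuous_const)

theorem classicalGrad_eq_zero_of_fderiv {x : RSpace d} (h : fderiv ℝ η x = 0) :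
    classicalGrad η x = 0 := by
  ext i
  simp [classicalGrad, h]

theorem hasCompactSupport_classicalGrad (hc : HasCompactSupport η) :
    HasCompactSupport (classicalGrad η) :=
  (hc.fderiv (𝕜 := ℝ)).mono fun _ hx h0 => hx (classicalGrad_eq_zero_of_fderiv h0)

theorem classicalGrad_add (hη : Differentiable ℝ η) (hζ : Differentiable ℝ ζ) :
    classicalGrad (η + ζ) = classicalGrad η + classicalGrad ζ := by
  ext x i
  simp [classicalGrad, fderiv_add (hη x) (hζ x)]

theorem classicalGrad_const_smul (hη : Differentiable ℝ η) (c : ℂ) :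
    classicalGrad (c • η) = c • classicalGrad η := by
  ext x i
  simp [classicalGrad, fderiv_const_smul (hη x) c]

/-- Smooth compactly supported functions, the space `C_c^∞(ℝ^d)`. -/
def IsTestFun (η : RSpace d → ℂ) : Prop := ContDiff ℝ ∞ η ∧ HasCompactSupport η

theorem isTestFun_zero : IsTestFun (0 : RSpace d → ℂ) :=
  ⟨contDiff_const, HasCompactSupport.zero⟩

namespace IsTestFun

theorem contDiff_one (hη : IsTestFun η) : ContDiff ℝ 1 η := hη.1.of_le (by simp)

theorem differentiable (hη : IsTestFun η) : Differentiable ℝ η :=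
  hη.contDiff_one.differentiable one_ne_zero

theorem add (hη : IsTestFun η) (hζ : IsTestFun ζ) : IsTestFun (η + ζ) :=
  ⟨hη.1.add hζ.1, hη.2.add hζ.2⟩

theorem const_smul (hη : IsTestFun η) (c : ℂ) : IsTestFun (c • η) :=
  ⟨hη.1.const_smul c, hη.2.smul_left⟩

theorem memLp (hη : IsTestFun η) (p : ℝ≥0∞) : MemLp η p :=
  hη.1.continuous.memLp_of_hasCompactSupport hη.2

theorem memLp_grad (hη : IsTestFun η) (p : ℝ≥0∞) : MemLp (classicalGrad η) p :=
  (continuous_classicalGrad hη.contDiff_one).memLp_of_hasCompactSupport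
    (hasCompactSupport_classicalGrad hη.2)

end IsTestFun

end TestFunctions

section HomogeneousSobolev

variable {d : ℕ}

/-- The critical Sobolev exponent `2d/(d-2)`. -/
noncomputable def sobExp (d : ℕ) : ℝ≥0∞ := ENNReal.ofReal (2 * d / (d - 2))

theorem sobExp_ne_top : sobExp d ≠ ⊤ := ENNReal.ofReal_ne_top

/-- The constant of the Sobolev inequality `‖η‖_{2d/(d-2)} ≤ C ‖∇η‖₂` on `ℝ^d`. -/
noncomputable def sobConst (d : ℕ) : NNReal :=
  eLpNormLESNormFDerivOfEqInnerConst (volume : Measure (RSpace d)) ((2 : NNReal) : ℝ)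

/-- Square integrable vector fields. -/
abbrev GradSpace (d : ℕ) : Type := Lp (EuclideanSpace ℂ (Fin d)) 2 (volume : Measure (RSpace d))

/-- Functions with the critical Sobolev integrability. -/
abbrev CritSpace (d : ℕ) : Type := Lp ℂ (sobExp d) (volume : Measure (RSpace d))

/-- The pairs `(η, ∇η)` with `η` a test function. -/
noncomputable def testGraph (d : ℕ) : Submodule ℂ (CritSpace d × GradSpace d) where
  carrier := {z | ∃ η, IsTestFun η ∧ z.1 =ᵐ[volume] η ∧ z.2 =ᵐ[volume] classicalGrad η}
  zero_mem' := by
    refine ⟨0, isTestFun_zero, Lp.coeFn_zero _ _ _, (Lp.coeFn_zero _ _ _).trans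
      (Eventually.of_forall fun x => ?_)⟩
    exact (classicalGrad_eq_zero_of_fderiv (by simp)).symm
  add_mem' := by
    rintro a b ⟨η, hη, ha, ha'⟩ ⟨ζ, hζ, hb, hb'⟩
    refine ⟨η + ζ, hη.add hζ, (Lp.coeFn_add _ _).trans (ha.add hb), ?_⟩
    rw [classicalGrad_add hη.differentiable hζ.differentiable]
    exact (Lp.coeFn_add _ _).trans (ha'.add hb')
  smul_mem' := by
    rintro c a ⟨η, hη, ha, ha'⟩
    refine ⟨c • η, hη.const_smul c, (Lp.coeFn_smul _ _).trans (ha.const_smul c), ?_⟩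
    rw [classicalGrad_const_smul hη.differentiable]
    exact (Lp.coeFn_smul _ _).trans (ha'.const_smul c)

variable [hd : Fact (3 ≤ d)]

theorem three_le_cast : (3 : ℝ) ≤ d := by exact_mod_cast hd.out

theorem two_le_sobExp : 2 ≤ sobExp d := by
  have hd3 := three_le_cast (d := d)
  rw [sobExp, ← ENNReal.ofReal_ofNat]
  refine ENNReal.ofReal_le_ofReal ?_
  rw [le_div_iff₀ (by linarith)]
  linarith

instance sobExp_fact : Fact (1 ≤ sobExp d) :=
  ⟨one_le_two.trans two_le_sobExp⟩

theorem sobExp_ne_zero : sobExp d ≠ 0 :=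
  fun h => by simpa [h] using two_le_sobExp (d := d)

theorem IsTestFun.eLpNorm_le {η : RSpace d → ℂ} (hη : IsTestFun η) :
    eLpNorm η (sobExp d) volume ≤ sobConst d * eLpNorm (classicalGrad η) 2 volume := by
  have hd3 := three_le_cast (d := d)
  have hd2 : (d : ℝ) - 2 ≠ 0 := by linarith
  have exponent : ((Real.toNNReal (2 * d / (d - 2)) : ℝ))⁻¹ =
      (2 : ℝ)⁻¹ - (Module.finrank ℝ (RSpace d) : ℝ)⁻¹ := by
    rw [Real.coe_toNNReal _ (div_nonneg (by linarith) (by linarith)), finrank_euclideanSpace,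
      Fintype.card_fin]
    field_simp
  refine (eLpNorm_le_eLpNorm_fderiv_of_eq_inner (volume : Measure (RSpace d)) (p := 2)
    hη.contDiff_one hη.2 one_le_two (by simpa using (by norm_num : 0 < 3).trans_le hd.out)
    (by simpa using exponent)).trans ?_
  exact mul_le_mul_right (eLpNorm_mono (norm_fderiv_le_norm_classicalGrad η)) _

/-- The closure of the graph of the gradient on test functions: the pairs `(u, ∇u)`, `u ∈ Ḣ¹`. -/
noncomputable def hdotGraph (d : ℕ) [Fact (3 ≤ d)] :
    Submodule ℂ (CritSpace d × GradSpace d) :=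
  (testGraph d).topologicalClosure

theorem norm_fst_le_of_mem_testGraph {z : CritSpace d × GradSpace d} (hz : z ∈ testGraph d) :
    ‖z.1‖ ≤ sobConst d * ‖z.2‖ := by
  obtain ⟨η, hη, h, h'⟩ := hz
  rw [Lp.norm_def, Lp.norm_def, eLpNorm_congr_ae h, eLpNorm_congr_ae h']
  simpa only [ENNReal.toReal_mul, ENNReal.coe_toReal] using ENNReal.toReal_mono
    (ENNReal.mul_ne_top ENNReal.coe_ne_top (hη.memLp_grad 2).eLpNorm_ne_top) hη.eLpNorm_le

theorem norm_fst_le_of_mem_hdotGraph {z : CritSpace d × GradSpace d} (hz : z ∈ hdotGraph d) :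
    ‖z.1‖ ≤ sobConst d * ‖z.2‖ :=
  closure_minimal (t := {z : CritSpace d × GradSpace d | ‖z.1‖ ≤ sobConst d * ‖z.2‖})
    (fun _ hw => norm_fst_le_of_mem_testGraph hw) (isClosed_le (by fun_prop) (by fun_prop)) hz

instance hdotGraph_complete : CompleteSpace (hdotGraph d) :=
  (Submodule.isClosed_topologicalClosure _).completeSpace_coe

/-- The gradient as a bounded operator on the closed graph. -/
noncomputable def hdotGrad (d : ℕ) [Fact (3 ≤ d)] : hdotGraph d →L[ℂ] GradSpace d :=
  (ContinuousLinearMap.snd ℂ _ _).comp (hdotGraph d).subtypeL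

theorem hdotGrad_antilipschitz : AntilipschitzWith (max (sobConst d) 1) (hdotGrad d) := by
  refine ContinuousLinearMap.antilipschitz_of_bound _ fun z => max_le ?_ ?_
  · refine (norm_fst_le_of_mem_hdotGraph z.2).trans ?_
    gcongr
    exacts [le_max_left _ _, le_rfl]
  · exact le_mul_of_one_le_left (norm_nonneg _) (le_max_right _ _)

theorem hdotGrad_isClosed_range : IsClosed (Set.range (hdotGrad d)) :=
  hdotGrad_antilipschitz.isClosed_range (hdotGrad d).uniformContinuous

/-- The space of gradients of elements of `Ḣ¹`, a closed subspace of `L²`. As the gradient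
determines the function, it serves as the Hilbert space `Ḣ¹` itself. -/
noncomputable def hdotSpace (d : ℕ) [Fact (3 ≤ d)] : Submodule ℂ (GradSpace d) :=
  (hdotGrad d).range

theorem isClosed_hdotSpace : IsClosed (hdotSpace d : Set (GradSpace d)) := by
  rw [hdotSpace, LinearMap.coe_range]
  exact hdotGrad_isClosed_range

instance hdotSpace_complete : CompleteSpace (hdotSpace d) := isClosed_hdotSpace.completeSpace_coe

/-- The gradient as an isomorphism from the closed graph onto its range. -/
noncomputable def hdotEquiv (d : ℕ) [Fact (3 ≤ d)] : hdotGraph d ≃L[ℂ] hdotSpace d :=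
  (hdotGrad d).equivRange hdotGrad_antilipschitz.injective hdotGrad_isClosed_range

/-- The Sobolev embedding `Ḣ¹ → L^{2d/(d-2)}`, taking a gradient to its potential. -/
noncomputable def hdotFun (d : ℕ) [Fact (3 ≤ d)] : hdotSpace d →L[ℂ] CritSpace d :=
  ((ContinuousLinearMap.fst ℂ _ _).comp (hdotGraph d).subtypeL).comp
    (hdotEquiv d).symm.toContinuousLinearMap

theorem hdotFun_hdotEquiv (z : hdotGraph d) : hdotFun d (hdotEquiv d z) = z.1.1 :=
  congr_arg (fun w : hdotGraph d => w.1.1) ((hdotEquiv d).symm_apply_apply z)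

theorem hdotFun_mem (g : hdotSpace d) : (hdotFun d g, (g : GradSpace d)) ∈ hdotGraph d := by
  obtain ⟨z, rfl⟩ := (hdotEquiv d).surjective g
  rw [hdotFun_hdotEquiv]
  exact z.2

/-- `u ∈ Ḣ¹` with gradient `g`. Both are functions, determined up to null sets. -/
def InHDot (u : RSpace d → ℂ) (g : RSpace d → EuclideanSpace ℂ (Fin d)) : Prop :=
  ∃ z ∈ hdotGraph d, z.1 =ᵐ[volume] u ∧ z.2 =ᵐ[volume] g

variable {u v : RSpace d → ℂ} {g k : RSpace d → EuclideanSpace ℂ (Fin d)}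

theorem IsTestFun.inHDot {η : RSpace d → ℂ} (hη : IsTestFun η) : InHDot η (classicalGrad η) :=
  ⟨((hη.memLp _).toLp η, (hη.memLp_grad 2).toLp _), Submodule.le_topologicalClosure _
    ⟨η, hη, (hη.memLp _).coeFn_toLp, (hη.memLp_grad 2).coeFn_toLp⟩,
    (hη.memLp _).coeFn_toLp, (hη.memLp_grad 2).coeFn_toLp⟩

theorem inHDot_hdotFun (g : hdotSpace d) : InHDot (hdotFun d g) (g : GradSpace d) :=
  ⟨_, hdotFun_mem g, EventuallyEq.rfl, EventuallyEq.rfl⟩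

namespace InHDot

theorem memLp (h : InHDot u g) : MemLp u (sobExp d) := by
  obtain ⟨z, -, hu, -⟩ := h
  exact (Lp.memLp z.1).ae_eq hu

theorem memLp_grad (h : InHDot u g) : MemLp g 2 := by
  obtain ⟨z, -, -, hg⟩ := h
  exact (Lp.memLp z.2).ae_eq hg

theorem toLp_mem (h : InHDot u g) : (h.memLp.toLp u, h.memLp_grad.toLp g) ∈ hdotGraph d := by
  obtain ⟨z, hz, hu, hg⟩ := id h
  have : (h.memLp.toLp u, h.memLp_grad.toLp g) = z :=
    Prod.ext (Lp.ext (h.memLp.coeFn_toLp.trans hu.symm))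
      (Lp.ext (h.memLp_grad.coeFn_toLp.trans hg.symm))
  rwa [this]

theorem congr (h : InHDot u g) (hu : u =ᵐ[volume] v) (hg : g =ᵐ[volume] k) : InHDot v k := by
  obtain ⟨z, hz, hzu, hzg⟩ := h
  exact ⟨z, hz, hzu.trans hu, hzg.trans hg⟩

theorem add (h : InHDot u g) (h' : InHDot v k) : InHDot (u + v) (g + k) := by
  obtain ⟨z, hz, hzu, hzg⟩ := h
  obtain ⟨w, hw, hwv, hwk⟩ := h'
  exact ⟨z + w, (hdotGraph d).add_mem hz hw, (Lp.coeFn_add _ _).trans (hzu.add hwv),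
    (Lp.coeFn_add _ _).trans (hzg.add hwk)⟩

theorem const_smul (h : InHDot u g) (c : ℂ) : InHDot (c • u) (c • g) := by
  obtain ⟨z, hz, hzu, hzg⟩ := h
  exact ⟨c • z, (hdotGraph d).smul_mem c hz, (Lp.coeFn_smul _ _).trans (hzu.const_smul c),
    (Lp.coeFn_smul _ _).trans (hzg.const_smul c)⟩

theorem sub (h : InHDot u g) (h' : InHDot v k) : InHDot (u - v) (g - k) := by
  simpa [sub_eq_add_neg] using h.add (h'.const_smul (-1))

theorem eLpNorm_le (h : InHDot u g) :
    eLpNorm u (sobExp d) volume ≤ sobConst d * eLpNorm g 2 volume := by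
  have hle := norm_fst_le_of_mem_hdotGraph h.toLp_mem
  simp only [Lp.norm_toLp] at hle
  rwa [← ENNReal.toReal_le_toReal h.memLp.eLpNorm_ne_top
    (ENNReal.mul_ne_top ENNReal.coe_ne_top h.memLp_grad.eLpNorm_ne_top), ENNReal.toReal_mul,
    ENNReal.coe_toReal]

theorem exists_isTestFun_tendsto (h : InHDot u g) :
    ∃ η : ℕ → RSpace d → ℂ, (∀ n, IsTestFun (η n)) ∧
      Tendsto (fun n => eLpNorm (η n - u) (sobExp d) volume) atTop (𝓝 0) ∧
      Tendsto (fun n => eLpNorm (classicalGrad (η n) - g) 2 volume) atTop (𝓝 0) ∧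
      ∀ᵐ x, Tendsto (fun n => η n x) atTop (𝓝 (u x)) := by
  obtain ⟨z, hz, hlim⟩ := mem_closure_iff_seq_limit.1
    (show (h.memLp.toLp u, h.memLp_grad.toLp g) ∈
      closure (testGraph d : Set (CritSpace d × GradSpace d)) from h.toLp_mem)
  choose η hη hη₁ hη₂ using hz
  have eq₁ n : (z n).1 = ((hη n).memLp _).toLp (η n) :=
    Lp.ext ((hη₁ n).trans (MemLp.coeFn_toLp _).symm)
  have eq₂ n : (z n).2 = ((hη n).memLp_grad 2).toLp (classicalGrad (η n)) :=
    Lp.ext ((hη₂ n).trans (MemLp.coeFn_toLp _).symm)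
  have lim₁ := (continuous_fst.tendsto _).comp hlim
  have lim₂ := (continuous_snd.tendsto _).comp hlim
  simp only [Function.comp_def, eq₁] at lim₁
  simp only [Function.comp_def, eq₂] at lim₂
  rw [Lp.tendsto_Lp_iff_tendsto_eLpNorm''] at lim₁ lim₂
  obtain ⟨ns, hns, hae⟩ := (tendstoInMeasure_of_tendsto_eLpNorm sobExp_ne_zero
    (fun n => ((hη n).memLp (sobExp d)).1) h.memLp.1 lim₁).exists_seq_tendsto_ae
  exact ⟨fun n => η (ns n), fun n => hη _, lim₁.comp hns.tendsto_atTop,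
    lim₂.comp hns.tendsto_atTop, hae⟩

theorem exists_of_tendsto (hg : MemLp g 2) {v : ℕ → RSpace d → ℂ}
    {k : ℕ → RSpace d → EuclideanSpace ℂ (Fin d)} (h : ∀ n, InHDot (v n) (k n))
    (hlim : Tendsto (fun n => eLpNorm (k n - g) 2 volume) atTop (𝓝 0)) :
    ∃ u, InHDot u g ∧ Tendsto (fun n => eLpNorm (v n - u) (sobExp d) volume) atTop (𝓝 0) := by
  have hmem : hg.toLp g ∈ hdotSpace d := isClosed_hdotSpace.mem_of_tendsto
    ((Lp.tendsto_Lp_iff_tendsto_eLpNorm'' _ (fun n => (h n).memLp_grad) _ hg).2 hlim)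
    (Eventually.of_forall fun n => ⟨⟨_, (h n).toLp_mem⟩, rfl⟩)
  have hu : InHDot (hdotFun d ⟨_, hmem⟩) g :=
    (inHDot_hdotFun ⟨_, hmem⟩).congr EventuallyEq.rfl hg.coeFn_toLp
  refine ⟨_, hu, ?_⟩
  have hbound := ENNReal.Tendsto.const_mul hlim (Or.inr (ENNReal.coe_ne_top (r := sobConst d)))
  rw [mul_zero] at hbound
  exact tendsto_of_tendsto_of_tendsto_of_le_of_le tendsto_const_nhds hbound (fun _ => zero_le)
    fun n => ((h n).sub hu).eLpNorm_le

theorem of_tendsto_ae (hg : MemLp g 2) {v : ℕ → RSpace d → ℂ}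
    {k : ℕ → RSpace d → EuclideanSpace ℂ (Fin d)} (h : ∀ n, InHDot (v n) (k n))
    (hv : ∀ᵐ x, Tendsto (fun n => v n x) atTop (𝓝 (u x)))
    (hlim : Tendsto (fun n => eLpNorm (k n - g) 2 volume) atTop (𝓝 0)) : InHDot u g := by
  obtain ⟨w, hw, hlimw⟩ := exists_of_tendsto hg h hlim
  obtain ⟨ns, hns, hae⟩ := (tendstoInMeasure_of_tendsto_eLpNorm sobExp_ne_zero
    (fun n => (h n).memLp.1) hw.memLp.1 hlimw).exists_seq_tendsto_ae
  refine hw.congr ?_ EventuallyEq.rfl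
  filter_upwards [hv, hae] with x hx hx'
  exact tendsto_nhds_unique hx' (hx.comp hns.tendsto_atTop)

theorem hasWeakGrad (h : InHDot u g) : HasWeakGrad u g := by
  obtain ⟨η, hη, hηu, hηg, -⟩ := h.exists_isTestFun_tendsto
  have hp : 1 ≤ sobExp d := Fact.out
  refine ⟨h.memLp.locallyIntegrable hp, h.memLp_grad.locallyIntegrable one_le_two,
    fun ζ hζ hc i => ?_⟩
  have : (sobExp d).HolderConjugate (sobExp d).conjExponent := .conjExponent hp
  have : (sobExp d).conjExponent.HolderTriple (sobExp d) 1 := ENNReal.HolderTriple.symm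
  have lhs := tendsto_integral_smul_of_tendsto_eLpNorm (q := (sobExp d).conjExponent)
    (fun n => (hη n).memLp _) h.memLp hηu (ζ := fun x => fderiv ℝ ζ x (coordVec i))
    (((hζ.continuous_fderiv (by simp)).clm_apply continuous_const).memLp_of_hasCompactSupport
      (hc.fderiv_apply (𝕜 := ℝ) (coordVec i)))
  have hηgi : Tendsto (fun n => eLpNorm ((fun x => classicalGrad (η n) x i) - fun x => g x i) 2
      volume) atTop (𝓝 0) :=
    tendsto_of_tendsto_of_tendsto_of_le_of_le tendsto_const_nhds hηg (fun _ => zero_le)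
      fun n => eLpNorm_coord_le (classicalGrad (η n) - g) i 2
  have rhs := tendsto_integral_smul_of_tendsto_eLpNorm (q := 2)
    (fun n => memLp_coord ((hη n).memLp_grad 2) i) (memLp_coord h.memLp_grad i) hηgi
    (hζ.continuous.memLp_of_hasCompactSupport hc)
  refine tendsto_nhds_unique lhs (rhs.neg.congr fun n => ?_)
  exact ((HasWeakGrad.of_contDiff (hη n).1).2.2 ζ hζ hc i).symm

theorem memHDot1 (h : InHDot u g) : MemHDot1 u g := by
  obtain ⟨η, hη, hηu, hηg, -⟩ := h.exists_isTestFun_tendsto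
  exact ⟨h.hasWeakGrad, h.memLp_grad, η, hη, hηg, fun R =>
    tendsto_setIntegral_norm_of_tendsto_eLpNorm Fact.out
      (fun n => ((hη n).memLp (sobExp d)).1.sub h.memLp.1) hηu
      (isCompact_closedBall 0 R).measure_ne_top⟩

end InHDot

end HomogeneousSobolev

section Density

theorem tendsto_eLpNorm_zero_of_dominated {α F : Type*} [MeasurableSpace α] {μ : Measure α}
    [NormedAddCommGroup F] {p : ℝ≥0∞} (hp : p ≠ ⊤) {f : ℕ → α → F} {g : α → ℝ}
    (hf : ∀ n, AEStronglyMeasurable (f n) μ) (hg : MemLp g p μ) (hfg : ∀ n, ∀ᵐ x ∂μ, ‖f n x‖ ≤ g x)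
    (hlim : ∀ᵐ x ∂μ, Tendsto (fun n => f n x) atTop (𝓝 0)) :
    Tendsto (fun n => eLpNorm (f n) p μ) atTop (𝓝 0) := by
  rcases eq_or_ne p 0 with rfl | hp0
  · simp
  have hq : 0 < p.toReal := ENNReal.toReal_pos hp0 hp
  have hint : Tendsto (fun n => ∫⁻ x, ‖f n x‖ₑ ^ p.toReal ∂μ) atTop (𝓝 (∫⁻ _, 0 ∂μ)) := by
    refine tendsto_lintegral_of_dominated_convergence' (fun x => ‖g x‖ₑ ^ p.toReal)
      (fun n => (hf n).enorm.pow_const _) (fun n => ?_) ?_ ?_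
    · filter_upwards [hfg n] with x hx
      gcongr
      exact enorm_le_iff_norm_le.2 (hx.trans (le_abs_self _))
    · exact (lintegral_rpow_enorm_lt_top_of_eLpNorm_lt_top hp0 hp hg.2).ne
    · filter_upwards [hlim] with x hx
      simpa [ENNReal.zero_rpow_of_pos hq] using hx.enorm.ennrpow_const p.toReal
  have := hint.ennrpow_const (1 / p.toReal)
  rw [lintegral_zero, ENNReal.zero_rpow_of_pos (by positivity)] at this
  exact this.congr fun n => (eLpNorm_eq_lintegral_rpow_enorm_toReal hp0 hp).symm

theorem memLp_mollify {E F : Type*} [NormedAddCommGroup E] [NormedSpace ℝ E]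
    [FiniteDimensional ℝ E] [MeasurableSpace E] [BorelSpace E] {μ : Measure E} [μ.IsAddHaarMeasure]
    [NormedAddCommGroup F] [NormedSpace ℝ F] [CompleteSpace F] (φ : ContDiffBump (0 : E))
    {p : ℝ≥0∞} (hp : 1 ≤ p) (hp' : p ≠ ⊤) {f : E → F} (hf : MemLp f p μ) :
    MemLp (mollify μ φ f) p μ := by
  have hloc := hf.locallyIntegrable hp
  have hm : AEStronglyMeasurable (mollify μ φ f) μ :=
    (φ.hasCompactSupport_normed.continuous_convolution_left _ φ.continuous_normed
      hloc).aestronglyMeasurable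
  have hdiff : MemLp (fun x => mollify μ φ f x - f x) p μ := by
    refine ⟨hm.sub hf.1, (eLpNorm_mollify_sub_le (M := eLpNorm f p μ + eLpNorm f p μ) φ hloc hp hp'
      fun y _ => ?_).trans_lt (ENNReal.add_lt_top.2 ⟨hf.2, hf.2⟩)⟩
    have hmp := measurePreserving_sub_right μ y
    refine (eLpNorm_sub_le (hf.1.comp_measurePreserving hmp) hf.1 hp).trans ?_
    rw [eLpNorm_comp_measurePreserving hf.1 hmp]
  exact (hdiff.add hf).ae_eq (Eventually.of_forall fun x => sub_add_cancel _ _)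

variable {d : ℕ}

theorem fderiv_mollify_apply {F : Type*} [NormedAddCommGroup F] [NormedSpace ℝ F]
    (φ : ContDiffBump (0 : RSpace d)) {u : RSpace d → F} (hu : LocallyIntegrable u)
    (x v : RSpace d) :
    fderiv ℝ (mollify volume φ u) x v = ∫ y, fderiv ℝ (φ.normed volume) (x - y) v • u y := by
  have hφ : ContDiff ℝ 1 (φ.normed volume) := φ.contDiff_normed
  have hderiv := φ.hasCompactSupport_normed.hasFDerivAt_convolution_left
    (ContinuousLinearMap.lsmul ℝ ℝ) hφ hu x
  have hint := (φ.hasCompactSupport_normed.fderiv (𝕜 := ℝ)).convolutionExists_left (μ := volume)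
    (ContinuousLinearMap.precompL (RSpace d) (ContinuousLinearMap.lsmul ℝ ℝ : ℝ →L[ℝ] F →L[ℝ] F))
    (hφ.continuous_fderiv one_ne_zero) hu x
  rw [hderiv.fderiv, convolution, ContinuousLinearMap.integral_apply hint,
    ← integral_sub_left_eq_self _ volume x]
  simp

theorem HasWeakGrad.classicalGrad_mollify {u : RSpace d → ℂ}
    {g : RSpace d → EuclideanSpace ℂ (Fin d)} (h : HasWeakGrad u g)
    (φ : ContDiffBump (0 : RSpace d)) :
    classicalGrad (mollify volume φ u) = mollify volume φ g := by
  ext x i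
  have hφ : ContDiff ℝ ∞ (φ.normed volume) := φ.contDiff_normed
  have hη : ContDiff ℝ ∞ fun y => φ.normed volume (x - y) :=
    hφ.comp (contDiff_const.sub contDiff_id)
  have hηc : HasCompactSupport fun y => φ.normed volume (x - y) :=
    φ.hasCompactSupport_normed.comp_homeomorph (Homeomorph.subLeft x)
  have hη' (y : RSpace d) : fderiv ℝ (fun y => φ.normed volume (x - y)) y (coordVec i) =
      -fderiv ℝ (φ.normed volume) (x - y) (coordVec i) := by
    have hd : HasFDerivAt (φ.normed volume) (fderiv ℝ (φ.normed volume) (x - y)) (x - y) :=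
      (hφ.differentiable (by simp) _).hasFDerivAt
    rw [(hd.comp y ((hasFDerivAt_id y).const_sub x)).fderiv (f := fun y => φ.normed volume (x - y))]
    simp
  have hint : Integrable fun y => φ.normed volume (x - y) • g y :=
    h.2.1.integrable_smul_left_of_hasCompactSupport hη.continuous hηc
  calc fderiv ℝ (mollify volume φ u) x (coordVec i)
      = -∫ y, fderiv ℝ (fun y => φ.normed volume (x - y)) y (coordVec i) • u y := by
        simp only [fderiv_mollify_apply φ h.1, hη', neg_smul, integral_neg, neg_neg]
    _ = ∫ y, φ.normed volume (x - y) • g y i := by rw [h.2.2 _ hη hηc i, neg_neg]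
    _ = mollify volume φ g x i := by
        rw [mollify_apply_swap]
        exact (EuclideanSpace.proj (𝕜 := ℂ) i).integral_comp_comm hint

theorem classicalGrad_mul {a b : RSpace d → ℂ} {x : RSpace d} (ha : DifferentiableAt ℝ a x)
    (hb : DifferentiableAt ℝ b x) :
    classicalGrad (fun x => a x * b x) x = a x • classicalGrad b x + b x • classicalGrad a x := by
  ext i
  simp [classicalGrad, fderiv_fun_mul ha hb]

theorem classicalGrad_comp_smul (a : RSpace d → ℂ) (c : ℝ) (x : RSpace d) :
    classicalGrad (fun x => a (c • x)) x = (c : ℂ) • classicalGrad a (c • x) := by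
  ext i
  simp [classicalGrad, fderiv_comp_smul]

/-- A smooth cutoff function, equal to one on the ball of radius `n + 1`: a dilation of a fixed
bump function, so that its gradient is `O(1/n)`. -/
noncomputable def cutoff (n : ℕ) (x : RSpace d) : ℂ :=
  ((⟨1, 2, one_pos, one_lt_two⟩ : ContDiffBump (0 : RSpace d)) (((n : ℝ) + 1)⁻¹ • x) : ℝ)

theorem isTestFun_cutoff (n : ℕ) : IsTestFun (cutoff n : RSpace d → ℂ) := by
  let b : ContDiffBump (0 : RSpace d) := ⟨1, 2, one_pos, one_lt_two⟩
  have hn : ((n : ℝ) + 1)⁻¹ ≠ 0 := by positivity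
  have hb : HasCompactSupport fun x => (b x : ℂ) :=
    b.hasCompactSupport.comp_left (g := fun t : ℝ => (t : ℂ)) Complex.ofReal_zero
  exact ⟨Complex.ofRealCLM.contDiff.comp (b.contDiff.comp (contDiff_id.const_smul _)),
    hb.comp_homeomorph (Homeomorph.smulOfNeZero _ hn)⟩

theorem norm_cutoff_le_one (n : ℕ) (x : RSpace d) : ‖cutoff n x‖ ≤ 1 := by
  rw [cutoff, Complex.norm_real, Real.norm_of_nonneg (ContDiffBump.nonneg _)]
  exact ContDiffBump.le_one _

theorem cutoff_eq_one {n : ℕ} {x : RSpace d} (hx : ‖x‖ ≤ n + 1) : cutoff n x = 1 := by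
  have hn : (0 : ℝ) < n + 1 := by positivity
  rw [cutoff, ContDiffBump.one_of_mem_closedBall _ ?_, Complex.ofReal_one]
  rwa [mem_closedBall_zero_iff, norm_smul, norm_inv, Real.norm_of_nonneg hn.le,
    inv_mul_le_iff₀ hn, mul_one]

theorem tendsto_cutoff (x : RSpace d) : Tendsto (fun n => cutoff n x) atTop (𝓝 1) := by
  refine tendsto_const_nhds.congr' ?_
  filter_upwards [eventually_ge_atTop ⌈‖x‖⌉₊] with n hn
  exact (cutoff_eq_one ((Nat.le_of_ceil_le hn).trans (by linarith))).symm

theorem exists_norm_classicalGrad_cutoff_le (d : ℕ) :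
    ∃ C : ℝ, ∀ (n : ℕ) (x : RSpace d), ‖classicalGrad (cutoff n) x‖ ≤ C / (n + 1) := by
  have hχ := isTestFun_cutoff (d := d) 0
  obtain ⟨C, hC⟩ := (continuous_classicalGrad hχ.contDiff_one).bounded_above_of_compact_support
    (hasCompactSupport_classicalGrad hχ.2)
  refine ⟨C, fun n x => ?_⟩
  have hn : (0 : ℝ) < n + 1 := by positivity
  have scaled : (cutoff n : RSpace d → ℂ) = fun x => cutoff 0 (((n : ℝ) + 1)⁻¹ • x) := by
    ext x
    simp [cutoff]
  rw [scaled, classicalGrad_comp_smul, norm_smul, Complex.norm_real, norm_inv,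
    Real.norm_of_nonneg hn.le, div_eq_inv_mul]
  gcongr
  exact hC _

theorem tendsto_eLpNorm_cutoff_smul_sub {F : Type*} [NormedAddCommGroup F] [NormedSpace ℂ F]
    {p : ℝ≥0∞} (hp : p ≠ ⊤) {f : RSpace d → F} (hf : MemLp f p) :
    Tendsto (fun n => eLpNorm (fun x => cutoff n x • f x - f x) p volume) atTop (𝓝 0) := by
  refine tendsto_eLpNorm_zero_of_dominated hp
    (fun n => ((isTestFun_cutoff n).1.continuous.aestronglyMeasurable.smul hf.1).sub hf.1)
    (hf.norm.const_mul 2) (fun n => Eventually.of_forall fun x => ?_)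
    (Eventually.of_forall fun x => ?_)
  · calc ‖cutoff n x • f x - f x‖ ≤ ‖cutoff n x‖ * ‖f x‖ + ‖f x‖ :=
        (norm_sub_le _ _).trans_eq (by rw [norm_smul])
      _ ≤ 1 * ‖f x‖ + ‖f x‖ := by gcongr; exact norm_cutoff_le_one n x
      _ = 2 * ‖f x‖ := by ring
  · simpa using ((tendsto_cutoff x).smul_const (f x)).sub_const (f x)

theorem tendsto_eLpNorm_smul_classicalGrad_cutoff {w : RSpace d → ℂ} {p : ℝ≥0∞} (hw : MemLp w p) :
    Tendsto (fun n => eLpNorm (fun x => w x • classicalGrad (cutoff n) x) p volume) atTop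
      (𝓝 0) := by
  obtain ⟨C, hC⟩ := exists_norm_classicalGrad_cutoff_le d
  have hbound : Tendsto (fun n : ℕ => ENNReal.ofReal (C / ((n : ℝ) + 1)) * eLpNorm w p volume) atTop
      (𝓝 0) := by
    have : Tendsto (fun n : ℕ => C / ((n : ℝ) + 1)) atTop (𝓝 0) :=
      tendsto_const_nhds.div_atTop (tendsto_natCast_atTop_atTop.atTop_add tendsto_const_nhds)
    simpa using ENNReal.Tendsto.mul_const (ENNReal.tendsto_ofReal this) (Or.inr hw.eLpNorm_ne_top)
  refine tendsto_of_tendsto_of_tendsto_of_le_of_le tendsto_const_nhds hbound (fun _ => zero_le)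
    fun n => eLpNorm_le_mul_eLpNorm_of_ae_le_mul (Eventually.of_forall fun x => ?_) p
  rw [norm_smul, mul_comm]
  gcongr
  exact hC n x

variable [Fact (3 ≤ d)]

theorem InHDot.of_contDiff {w : RSpace d → ℂ} (hw : ContDiff ℝ ∞ w) (hw2 : MemLp w 2)
    (hg : MemLp (classicalGrad w) 2) : InHDot w (classicalGrad w) := by
  have hw1 : ContDiff ℝ 1 w := hw.of_le (by simp)
  have htest (n : ℕ) : IsTestFun fun x => cutoff n x * w x :=
    ⟨(isTestFun_cutoff n).1.mul hw, (isTestFun_cutoff n).2.mul_right⟩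
  refine InHDot.of_tendsto_ae hg (fun n => (htest n).inHDot)
    (Eventually.of_forall fun x => by simpa using (tendsto_cutoff x).mul_const (w x)) ?_
  have hsum := (tendsto_eLpNorm_cutoff_smul_sub (by simp) hg).add
    (tendsto_eLpNorm_smul_classicalGrad_cutoff hw2)
  rw [add_zero] at hsum
  refine tendsto_of_tendsto_of_tendsto_of_le_of_le tendsto_const_nhds hsum (fun _ => zero_le)
    fun n => ?_
  have hχ := isTestFun_cutoff (d := d) n
  have hgrad : classicalGrad (fun x => cutoff n x * w x) - classicalGrad w =
      (fun x => cutoff n x • classicalGrad w x - classicalGrad w x) +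
        fun x => w x • classicalGrad (cutoff n) x := by
    ext1 x
    rw [Pi.sub_apply, classicalGrad_mul hχ.differentiable.differentiableAt
      (hw1.differentiable one_ne_zero).differentiableAt, Pi.add_apply]
    abel
  have hcg := continuous_classicalGrad hw1
  rw [hgrad]
  exact eLpNorm_add_le ((hχ.1.continuous.smul hcg).sub hcg).aestronglyMeasurable
    (hw.continuous.smul (continuous_classicalGrad hχ.contDiff_one)).aestronglyMeasurable one_le_two

theorem MemH1.inHDot {u : RSpace d → ℂ} {g : RSpace d → EuclideanSpace ℂ (Fin d)}
    (h : MemH1 u g) : InHDot u g := by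
  let φ (n : ℕ) : ContDiffBump (0 : RSpace d) :=
    ⟨1 / (n + 2), 1 / (n + 1), by positivity, by gcongr; norm_num⟩
  have hφ : Tendsto (fun n => (φ n).rOut) atTop (𝓝 0) := tendsto_one_div_add_atTop_nhds_zero_nat
  have hin (n : ℕ) : InHDot (mollify volume (φ n) u) (mollify volume (φ n) g) := by
    have hgrad := h.2.1.classicalGrad_mollify (φ n)
    rw [← hgrad]
    refine InHDot.of_contDiff ((φ n).hasCompactSupport_normed.contDiff_convolution_left _
      (φ n).contDiff_normed h.2.1.1) (memLp_mollify (φ n) one_le_two (by simp) h.1) ?_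
    rw [hgrad]
    exact memLp_mollify (φ n) one_le_two (by simp) h.2.2
  obtain ⟨ns, hns, hae⟩ := (tendstoInMeasure_of_tendsto_eLpNorm two_ne_zero
    (fun n => (memLp_mollify (φ n) one_le_two (by simp) h.1).1) h.1.1
    (tendsto_eLpNorm_mollify_sub hφ (by simp) h.1)).exists_seq_tendsto_ae
  exact InHDot.of_tendsto_ae h.2.2 (fun n => hin (ns n)) hae
    ((tendsto_eLpNorm_mollify_sub hφ (by simp) h.2.2).comp hns.tendsto_atTop)

end Density

section PotentialForm

variable {d : ℕ} {V : RSpace d → ℝ} {u v : RSpace d → ℂ} {g k : RSpace d → EuclideanSpace ℂ (Fin d)}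

theorem ShortRange.memLp (hV : ShortRange V) : MemLp V ((d : ℝ≥0∞) / 2) := by
  rcases hV with ⟨rfl, h⟩ | ⟨rfl, h, -⟩ | ⟨-, h⟩
  · exact_mod_cast h
  · have : ((4 : ℕ) : ℝ≥0∞) / 2 = 2 := by
      rw [ENNReal.div_eq_inv_mul, show ((4 : ℕ) : ℝ≥0∞) = 2 * 2 by norm_num, ← mul_assoc,
        ENNReal.inv_mul_cancel two_ne_zero ENNReal.ofNat_ne_top, one_mul]
    rwa [this]
  · exact h

theorem integral_potential_self (V : RSpace d → ℝ) (u : RSpace d → ℂ) :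
    ∫ x, (V x : ℂ) * (conj (u x) * u x) = ((∫ x, V x * ‖u x‖ ^ 2 : ℝ) : ℂ) := by
  simp [← integral_complex_ofReal, Complex.conj_mul']

/-- Half of the critical Sobolev exponent: the integrability of a product of two functions in
`L^{2d/(d-2)}`, dual to that of the potential. -/
noncomputable def halfSobExp (d : ℕ) : ℝ≥0∞ := ENNReal.ofReal (d / (d - 2))

variable [hd : Fact (3 ≤ d)]

instance sobExp_holderTriple : (sobExp d).HolderTriple (sobExp d) (halfSobExp d) := ⟨by
  have hd3 := three_le_cast (d := d)
  have hsob : (0 : ℝ) < 2 * d / (d - 2) := div_pos (by linarith) (by linarith)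
  have hhalfSob : (0 : ℝ) < d / (d - 2) := div_pos (by linarith) (by linarith)
  have : (d : ℝ) - 2 ≠ 0 := by linarith
  rw [sobExp, halfSobExp, ← ENNReal.ofReal_inv_of_pos hsob, ← ENNReal.ofReal_inv_of_pos hhalfSob,
    ← ENNReal.ofReal_add (by positivity) (by positivity)]
  congr 1
  field_simp
  norm_num⟩

instance potExp_holderTriple : ((d : ℝ≥0∞) / 2).HolderTriple (halfSobExp d) 1 := ⟨by
  have hd3 := three_le_cast (d := d)
  have hhalfSob : (0 : ℝ) < d / (d - 2) := div_pos (by linarith) (by linarith)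
  have : (d : ℝ) - 2 ≠ 0 := by linarith
  have hpot : (0 : ℝ) < d / 2 := by linarith
  have hcast : (d : ℝ≥0∞) / 2 = ENNReal.ofReal (d / 2) := by
    rw [ENNReal.ofReal_div_of_pos two_pos, ENNReal.ofReal_natCast, ENNReal.ofReal_ofNat]
  rw [hcast, halfSobExp, ← ENNReal.ofReal_inv_of_pos hpot, ← ENNReal.ofReal_inv_of_pos hhalfSob,
    ← ENNReal.ofReal_add (by positivity) (by positivity), inv_one, ← ENNReal.ofReal_one]
  congr 1
  field_simp
  norm_num⟩

theorem one_le_potExp : 1 ≤ (d : ℝ≥0∞) / 2 := by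
  rw [ENNReal.le_div_iff_mul_le (by simp) (by simp), one_mul]
  exact_mod_cast (by norm_num : 2 ≤ 3).trans hd.out

theorem lintegral_potential_le (hV : AEStronglyMeasurable V) (hu : AEStronglyMeasurable u)
    (hv : AEStronglyMeasurable v) :
    ∫⁻ x, ‖V x‖ₑ * (‖v x‖ₑ * ‖u x‖ₑ) ≤
      eLpNorm V ((d : ℝ≥0∞) / 2) volume *
        (eLpNorm v (sobExp d) volume * eLpNorm u (sobExp d) volume) :=
  calc ∫⁻ x, ‖V x‖ₑ * (‖v x‖ₑ * ‖u x‖ₑ) = eLpNorm (V • v • u) 1 volume := by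
        simp only [eLpNorm_one_eq_lintegral_enorm, Pi.smul_apply', enorm_smul]
    _ ≤ eLpNorm V ((d : ℝ≥0∞) / 2) volume * eLpNorm (v • u) (halfSobExp d) volume :=
        eLpNorm_smul_le_mul_eLpNorm (hv.smul hu) hV
    _ ≤ _ := by gcongr; exact eLpNorm_smul_le_mul_eLpNorm hu hv

theorem integrable_potential (hV : MemLp V ((d : ℝ≥0∞) / 2)) (hu : MemLp u (sobExp d))
    (hv : MemLp v (sobExp d)) : Integrable fun x => (V x : ℂ) * (conj (v x) * u x) := by
  refine ⟨(Complex.continuous_ofReal.comp_aestronglyMeasurable hV.1).mul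
    ((Complex.continuous_conj.comp_aestronglyMeasurable hv.1).mul hu.1),
    (lintegral_congr fun x => ?_).trans_lt ((lintegral_potential_le hV.1 hu.1 hv.1).trans_lt
      (ENNReal.mul_lt_top hV.2 (ENNReal.mul_lt_top hv.2 hu.2)))⟩
  simp [enorm_eq_nnnorm]

theorem norm_integral_potential_le (hV : MemLp V ((d : ℝ≥0∞) / 2)) (hu : MemLp u (sobExp d))
    (hv : MemLp v (sobExp d)) :
    ‖∫ x, (V x : ℂ) * (conj (v x) * u x)‖ ≤ (eLpNorm V ((d : ℝ≥0∞) / 2) volume).toReal *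
      ((eLpNorm v (sobExp d) volume).toReal * (eLpNorm u (sobExp d) volume).toReal) := by
  rw [← ENNReal.toReal_mul, ← ENNReal.toReal_mul, ← toReal_enorm]
  refine ENNReal.toReal_mono (ENNReal.mul_ne_top hV.2.ne (ENNReal.mul_ne_top hv.2.ne hu.2.ne))
    ((enorm_integral_le_lintegral_enorm _).trans ?_)
  refine (lintegral_congr fun x => ?_).trans_le (lintegral_potential_le hV.1 hu.1 hv.1)
  simp [enorm_eq_nnnorm]

theorem integrable_potential_sq (hV : MemLp V ((d : ℝ≥0∞) / 2)) (hu : MemLp u (sobExp d)) :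
    Integrable fun x => V x * ‖u x‖ ^ 2 := by
  refine (integrable_potential hV hu hu).re.congr (Eventually.of_forall fun x => ?_)
  simp [Complex.conj_mul', ← Complex.ofReal_pow]

/-- The sesquilinear form `⟨v, Vu⟩` on `L^{2d/(d-2)}`. -/
noncomputable def potPairing (hV : MemLp V ((d : ℝ≥0∞) / 2)) :
    CritSpace d →L⋆[ℂ] CritSpace d →L[ℂ] ℂ :=
  LinearMap.mkContinuous₂ (LinearMap.mk₂'ₛₗ (starRingEnd ℂ) (RingHom.id ℂ)
    (fun v u => ∫ x, (V x : ℂ) * (conj (v x) * u x))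
    (fun v w u => by
      rw [← integral_add (integrable_potential hV (Lp.memLp _) (Lp.memLp _))
        (integrable_potential hV (Lp.memLp _) (Lp.memLp _))]
      refine integral_congr_ae ?_
      filter_upwards [Lp.coeFn_add v w] with x hx
      rw [hx, Pi.add_apply, map_add]
      ring)
    (fun c v u => by
      rw [smul_eq_mul, ← integral_const_mul]
      refine integral_congr_ae ?_
      filter_upwards [Lp.coeFn_smul c v] with x hx
      rw [hx, Pi.smul_apply, smul_eq_mul, map_mul]
      ring)
    (fun v u w => by
      rw [← integral_add (integrable_potential hV (Lp.memLp _) (Lp.memLp _))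
        (integrable_potential hV (Lp.memLp _) (Lp.memLp _))]
      refine integral_congr_ae ?_
      filter_upwards [Lp.coeFn_add u w] with x hx
      rw [hx, Pi.add_apply]
      ring)
    (fun c v u => by
      rw [RingHom.id_apply, smul_eq_mul, ← integral_const_mul]
      refine integral_congr_ae ?_
      filter_upwards [Lp.coeFn_smul c u] with x hx
      rw [hx, Pi.smul_apply, smul_eq_mul]
      ring))
    (eLpNorm V ((d : ℝ≥0∞) / 2) volume).toReal
    fun v u => by
      rw [mul_assoc, Lp.norm_def, Lp.norm_def]
      exact norm_integral_potential_le hV (Lp.memLp u) (Lp.memLp v)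

/-- The sesquilinear form `⟨v, Vu⟩` on `Ḣ¹`, in terms of the gradients of `v` and `u`. -/
noncomputable def potForm (hV : MemLp V ((d : ℝ≥0∞) / 2)) :
    hdotSpace d →L⋆[ℂ] hdotSpace d →L[ℂ] ℂ :=
  (potPairing hV).bilinearComp (hdotFun d) (hdotFun d)

theorem potForm_apply (hV : MemLp V ((d : ℝ≥0∞) / 2)) (k g : hdotSpace d) :
    potForm hV k g = ∫ x, (V x : ℂ) * (conj (hdotFun d k x) * hdotFun d g x) := rfl

theorem potForm_conj (hV : MemLp V ((d : ℝ≥0∞) / 2)) (k g : hdotSpace d) :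
    conj (potForm hV k g) = potForm hV g k := by
  rw [potForm_apply, potForm_apply, ← integral_conj]
  refine integral_congr_ae (Eventually.of_forall fun x => ?_)
  simp only [map_mul, Complex.conj_conj, Complex.conj_ofReal]
  ring

theorem continuous_potForm_self (hV : MemLp V ((d : ℝ≥0∞) / 2)) :
    Continuous fun g => (potForm hV g g).re :=
  Complex.continuous_re.comp ((potForm hV).continuous.clm_apply continuous_id)

namespace InHDot

/-- The element of `hdotSpace` given by a function and its gradient. -/
noncomputable def elem (h : InHDot u g) : hdotSpace d :=
  hdotEquiv d ⟨_, h.toLp_mem⟩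

theorem coeFn_elem (h : InHDot u g) : ((h.elem : GradSpace d) : RSpace d → _) =ᵐ[volume] g :=
  h.memLp_grad.coeFn_toLp

theorem elem_eq {g : hdotSpace d} (h : InHDot u (g : GradSpace d)) : h.elem = g :=
  Subtype.ext (Lp.toLp_coeFn (g : GradSpace d) (Lp.memLp _))

theorem hdotFun_elem (h : InHDot u g) : hdotFun d h.elem =ᵐ[volume] u := by
  rw [elem, hdotFun_hdotEquiv]
  exact h.memLp.coeFn_toLp

theorem potForm_elem (hV : MemLp V ((d : ℝ≥0∞) / 2)) (hu : InHDot u g) (hv : InHDot v k) :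
    potForm hV hv.elem hu.elem = ∫ x, (V x : ℂ) * (conj (v x) * u x) := by
  rw [potForm_apply]
  refine integral_congr_ae ?_
  filter_upwards [hu.hdotFun_elem, hv.hdotFun_elem] with x h1 h2
  rw [h1, h2]

theorem potForm_self (hV : MemLp V ((d : ℝ≥0∞) / 2)) (h : InHDot u g) :
    (potForm hV h.elem h.elem).re = ∫ x, V x * ‖u x‖ ^ 2 := by
  rw [h.potForm_elem hV h, integral_potential_self, Complex.ofReal_re]

theorem inner_elem (hu : InHDot u g) (hv : InHDot v k) :
    inner ℂ hv.elem hu.elem = ∫ x, inner ℂ (k x) (g x) := by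
  rw [Submodule.coe_inner, L2.inner_def]
  refine integral_congr_ae ?_
  filter_upwards [hu.coeFn_elem, hv.coeFn_elem] with x h1 h2
  rw [h1, h2]

theorem norm_elem_sq (h : InHDot u g) : ‖h.elem‖ ^ 2 = ∫ x, ‖g x‖ ^ 2 := by
  have inner_self (x : RSpace d) : inner ℂ (g x) (g x) = ((‖g x‖ ^ 2 : ℝ) : ℂ) := by simp
  have inner_self_elem : inner ℂ h.elem h.elem = ((‖h.elem‖ ^ 2 : ℝ) : ℂ) := by simp
  have hinner := h.inner_elem h
  simp only [inner_self, inner_self_elem, integral_complex_ofReal] at hinner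
  exact_mod_cast hinner

end InHDot

theorem exists_isTestFun_tendsto_elem (g : hdotSpace d) : ∃ η : ℕ → RSpace d → ℂ,
    ∃ h : ∀ n, IsTestFun (η n), Tendsto (fun n => (h n).inHDot.elem) atTop (𝓝 g) := by
  obtain ⟨η, h1, -, h3, -⟩ := (inHDot_hdotFun g).exists_isTestFun_tendsto
  refine ⟨η, h1, ?_⟩
  rw [tendsto_subtype_rng]
  have := (Lp.tendsto_Lp_iff_tendsto_eLpNorm'' _ (fun n => (h1 n).memLp_grad 2) _
    (Lp.memLp (g : GradSpace d))).2 h3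
  rwa [Lp.toLp_coeFn] at this

theorem SchrodingerNonneg.nonneg (hV : MemLp V ((d : ℝ≥0∞) / 2)) (h : SchrodingerNonneg V)
    (g : hdotSpace d) : 0 ≤ ‖g‖ ^ 2 + (potForm hV g g).re := by
  obtain ⟨η, hη, hlim⟩ := exists_isTestFun_tendsto_elem g
  have hc : Continuous fun g => ‖g‖ ^ 2 + (potForm hV g g).re :=
    (continuous_norm.pow 2).add (continuous_potForm_self hV)
  refine ge_of_tendsto ((hc.tendsto g).comp hlim) (Eventually.of_forall fun n => ?_)
  rw [Function.comp_apply, (hη n).inHDot.norm_elem_sq, (hη n).inHDot.potForm_self]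
  exact h _ _ (MemFormDomain.of_contDiff (hV.locallyIntegrable one_le_potExp) (hη n).1 (hη n).2)

theorem MemH1.memFormDomain (hV : MemLp V ((d : ℝ≥0∞) / 2)) (h : MemH1 u g) :
    MemFormDomain V u g :=
  ⟨h, integrable_potential_sq hV h.inHDot.memLp⟩

end PotentialForm

section LaxMilgram

theorem exists_forall_form_eq_inner {𝕜 W L E : Type*} [RCLike 𝕜]
    [NormedAddCommGroup W] [InnerProductSpace 𝕜 W] [CompleteSpace W]
    [NormedAddCommGroup L] [InnerProductSpace 𝕜 L] [CompleteSpace L]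
    [NormedAddCommGroup E] [InnerProductSpace 𝕜 E] [CompleteSpace E]
    (P : W →L[𝕜] L) (T : W →L[𝕜] E) (A : E →L[𝕜] E) {κ τ : ℝ} (hκ : 0 < κ) (hτ : 0 < τ)
    (hnorm : ∀ w, ‖w‖ ^ 2 = ‖P w‖ ^ 2 + ‖T w‖ ^ 2)
    (hA : ∀ e, κ * ‖e‖ ^ 2 ≤ RCLike.re (inner 𝕜 e (A e))) (f : L) :
    ∃ w, ∀ v, inner 𝕜 (T v) (A (T w)) + (τ : 𝕜) * inner 𝕜 (P v) (P w) = inner 𝕜 (P v) f := by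
  let S : W →L[𝕜] W := T.adjoint ∘L A ∘L T + (τ : 𝕜) • (P.adjoint ∘L P)
  have inner_S (v w) : inner 𝕜 v (S w) =
      inner 𝕜 (T v) (A (T w)) + (τ : 𝕜) * inner 𝕜 (P v) (P w) := by
    simp [S, ContinuousLinearMap.adjoint_inner_right, inner_add_right, inner_smul_right]
  have coercive (w) : ‖w‖ ^ 2 * min κ τ ≤ RCLike.re (inner 𝕜 w (S w)) := by
    rw [inner_S, map_add, RCLike.re_ofReal_mul, inner_self_eq_norm_sq, hnorm]
    nlinarith [hA (T w), mul_le_mul_of_nonneg_right (min_le_left κ τ) (sq_nonneg ‖T w‖),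
      mul_le_mul_of_nonneg_right (min_le_right κ τ) (sq_nonneg ‖P w‖)]
  have hm : 0 < min κ τ := lt_min hκ hτ
  obtain ⟨U, hU⟩ := ContinuousLinearMap.isUnit_of_forall_le_norm_inner_map S
    (c := ⟨min κ τ, hm.le⟩) hm fun w => by
      rw [norm_inner_symm]
      exact (coercive w).trans (RCLike.re_le_norm _)
  refine ⟨(↑U⁻¹ : W →L[𝕜] W) (P.adjoint f), fun v => ?_⟩
  rw [← inner_S, ← hU, ← mul_apply_eq_comp, Units.mul_inv, one_apply_eq_self,
    ContinuousLinearMap.adjoint_inner_right]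

end LaxMilgram

section Resolvent

variable {d : ℕ} [Fact (3 ≤ d)]

/-- The Sobolev space `H¹` as a Hilbert space of pairs `(u, ∇u)`. -/
noncomputable def h1Space (d : ℕ) [Fact (3 ≤ d)] :
    Submodule ℂ (WithLp 2 (L2Space d × GradSpace d)) where
  carrier := {w | InHDot w.fst w.snd}
  zero_mem' := by
    have hgrad : classicalGrad (0 : RSpace d → ℂ) = 0 :=
      funext fun x => classicalGrad_eq_zero_of_fderiv (by simp)
    have h0 := (isTestFun_zero (d := d)).inHDot
    rw [hgrad] at h0
    exact h0.congr (Lp.coeFn_zero _ _ _).symm (Lp.coeFn_zero _ _ _).symm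
  add_mem' := fun ha hb => (InHDot.add ha hb).congr (Lp.coeFn_add _ _).symm
    (Lp.coeFn_add _ _).symm
  smul_mem' := fun c _ ha => (InHDot.const_smul ha c).congr (Lp.coeFn_smul _ _).symm
    (Lp.coeFn_smul _ _).symm

theorem isClosed_h1Space : IsClosed (h1Space d : Set (WithLp 2 (L2Space d × GradSpace d))) := by
  refine IsSeqClosed.isClosed fun w w₀ (hw : ∀ n, InHDot (w n).fst (w n).snd) hlim => ?_
  have lim₁ := ((WithLp.fstL 2 ℂ (L2Space d) (GradSpace d)).continuous.tendsto _).comp hlim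
  have lim₂ := ((WithLp.sndL 2 ℂ (L2Space d) (GradSpace d)).continuous.tendsto _).comp hlim
  rw [Lp.tendsto_Lp_iff_tendsto_eLpNorm'] at lim₁ lim₂
  obtain ⟨u, hu, limu⟩ := InHDot.exists_of_tendsto (Lp.memLp _) hw lim₂
  refine hu.congr ?_ EventuallyEq.rfl
  exact tendstoInMeasure_ae_unique
    (tendstoInMeasure_of_tendsto_eLpNorm sobExp_ne_zero (fun n => (hw n).memLp.1)
      hu.memLp.1 limu)
    (tendstoInMeasure_of_tendsto_eLpNorm two_ne_zero (fun n => (hw n).memLp.1)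
      (Lp.memLp _).1 lim₁)

instance h1Space_complete : CompleteSpace (h1Space d) := isClosed_h1Space.completeSpace_coe

/-- The inclusion of `H¹` in `L²`. -/
noncomputable def h1Fun (d : ℕ) [Fact (3 ≤ d)] : h1Space d →L[ℂ] L2Space d :=
  (WithLp.fstL 2 ℂ _ _).comp (h1Space d).subtypeL

theorem h1Space_snd_mem (w : h1Space d) : w.1.snd ∈ hdotSpace d := by
  have hw : InHDot w.1.fst w.1.snd := w.2
  rw [← Lp.toLp_coeFn w.1.snd (Lp.memLp _)]
  exact hw.elem.2

/-- The gradient on `H¹`. -/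
noncomputable def h1Grad (d : ℕ) [Fact (3 ≤ d)] : h1Space d →L[ℂ] hdotSpace d :=
  ((WithLp.sndL 2 ℂ _ _).comp (h1Space d).subtypeL).codRestrict _ h1Space_snd_mem

theorem h1Space_norm_sq (w : h1Space d) : ‖w‖ ^ 2 = ‖h1Fun d w‖ ^ 2 + ‖h1Grad d w‖ ^ 2 := by
  rw [Submodule.coe_norm, Submodule.coe_norm]
  exact WithLp.prod_norm_sq_eq_of_L2 w.1

theorem memH1_of_h1Space (w : h1Space d) : MemH1 (h1Fun d w) w.1.snd :=
  ⟨Lp.memLp _, InHDot.hasWeakGrad w.2, Lp.memLp _⟩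

theorem MemH1.exists_h1Space {v : L2Space d} {k : RSpace d → EuclideanSpace ℂ (Fin d)}
    (h : MemH1 v k) : ∃ w : h1Space d, h1Fun d w = v ∧ h1Grad d w = h.inHDot.elem :=
  ⟨⟨WithLp.toLp 2 (v, h.2.2.toLp k), h.inHDot.congr EventuallyEq.rfl h.2.2.coeFn_toLp.symm⟩,
    rfl, rfl⟩

variable {V : RSpace d → ℝ}

/-- The bounded operator on `Ḣ¹` that represents the form `c‖∇u‖² + ∫ V|u|²`. -/
noncomputable def formOp (c : ℝ) (hV : MemLp V ((d : ℝ≥0∞) / 2)) : hdotSpace d →L[ℂ] hdotSpace d :=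
  (c : ℂ) • ContinuousLinearMap.id ℂ _ + InnerProductSpace.continuousLinearMapOfBilin (potForm hV)

theorem inner_formOp (c : ℝ) (hV : MemLp V ((d : ℝ≥0∞) / 2)) (k g : hdotSpace d) :
    inner ℂ k (formOp c hV g) = c * inner ℂ k g + potForm hV k g := by
  rw [formOp, add_apply, inner_add_right, smul_apply, inner_smul_right,
    ← inner_conj_symm (𝕜 := ℂ) k (InnerProductSpace.continuousLinearMapOfBilin _ g),
    InnerProductSpace.continuousLinearMapOfBilin_apply, potForm_conj]
  rfl

theorem re_inner_formOp_self (c : ℝ) (hV : MemLp V ((d : ℝ≥0∞) / 2)) (g : hdotSpace d) :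
    (inner ℂ g (formOp c hV g)).re = c * ‖g‖ ^ 2 + (potForm hV g g).re := by
  rw [inner_formOp, Complex.add_re, Complex.re_ofReal_mul, ← inner_self_eq_norm_sq (𝕜 := ℂ) g]
  rfl

theorem exists_mem_schrodingerGraph (hV : MemLp V ((d : ℝ≥0∞) / 2)) {c κ t : ℝ} (hκ : 0 < κ)
    (ht : t < 0) (hco : ∀ g : hdotSpace d, κ * ‖g‖ ^ 2 ≤ c * ‖g‖ ^ 2 + (potForm hV g g).re)
    (f : L2Space d) : ∃ u : L2Space d, (u, f + (t : ℂ) • u) ∈ schrodingerGraph c V := by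
  obtain ⟨w, hw⟩ := exists_forall_form_eq_inner (h1Fun d) (h1Grad d) (formOp c hV) hκ
    (neg_pos.2 ht) h1Space_norm_sq
    (fun e => (hco e).trans_eq (re_inner_formOp_self c hV e).symm) f
  have hin : InHDot (h1Fun d w) (h1Grad d w : GradSpace d) := w.2
  refine ⟨h1Fun d w, w.1.snd, (memH1_of_h1Space w).memFormDomain hV, fun v k hv => ?_⟩
  obtain ⟨w', hw'v, hw'k⟩ := hv.1.exists_h1Space
  have hform := hw w'
  rw [inner_formOp, hw'v, hw'k, ← hin.elem_eq, hin.inner_elem hv.1.inHDot,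
    hin.potForm_elem hV hv.1.inHDot] at hform
  rw [inner_add_right, inner_smul_right, ← hform, RCLike.ofReal_neg, neg_mul]
  exact (neg_add_cancel_right _ _).symm

theorem mul_norm_le_of_mem_schrodingerGraph (hV : MemLp V ((d : ℝ≥0∞) / 2)) {c : ℝ}
    (hnn : ∀ g : hdotSpace d, 0 ≤ c * ‖g‖ ^ 2 + (potForm hV g g).re) (t : ℝ)
    {u f : L2Space d} (h : (u, f) ∈ schrodingerGraph c V) :
    -t * ‖u‖ ≤ ‖f - (t : ℂ) • u‖ := by
  obtain ⟨g, hg, hform⟩ := h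
  have hin := hg.1.inHDot
  have hre : (inner ℂ u (f - (t : ℂ) • u)).re =
      c * ‖hin.elem‖ ^ 2 + (potForm hV hin.elem hin.elem).re - t * ‖u‖ ^ 2 := by
    rw [inner_sub_right, inner_smul_right, ← hform u g hg, ← hin.inner_elem hin,
      ← hin.potForm_elem hV hin, ← inner_formOp, Complex.sub_re, re_inner_formOp_self,
      Complex.re_ofReal_mul, ← inner_self_eq_norm_sq (𝕜 := ℂ) u]
    rfl
  have hcs := (Complex.re_le_norm _).trans (norm_inner_le_norm (𝕜 := ℂ) u (f - (t : ℂ) • u))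
  rcases (norm_nonneg u).eq_or_lt with h0 | h0
  · simp [← h0]
  · exact le_of_mul_le_mul_left (by linarith [hnn hin.elem]) h0

theorem schrodingerOp_graph (c : ℝ) (hV : MemLp V ((d : ℝ≥0∞) / 2)) :
    (schrodingerOp c V).graph = schrodingerGraph c V :=
  Submodule.toLinearPMap_graph_eq _
    (schrodingerGraph_eq_zero c (hV.locallyIntegrable one_le_potExp))

theorem mem_opResolventSet_of_neg (hV : MemLp V ((d : ℝ≥0∞) / 2)) {c κ t : ℝ} (hκ : 0 < κ)
    (ht : t < 0) (hco : ∀ g : hdotSpace d, κ * ‖g‖ ^ 2 ≤ c * ‖g‖ ^ 2 + (potForm hV g g).re) :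
    (t : ℂ) ∈ opResolventSet (schrodingerOp c V) := by
  have hgr := schrodingerOp_graph c hV
  have hbound (u : (schrodingerOp c V).domain) :
      -t * ‖u‖ ≤ ‖shiftedOp (schrodingerOp c V) t u‖ := by
    refine mul_norm_le_of_mem_schrodingerGraph hV
      (fun g => le_trans (by positivity) (hco g)) t ?_
    rw [← hgr]
    exact (schrodingerOp c V).mem_graph u
  refine ⟨⟨(injective_iff_map_eq_zero _).2 fun u hu => ?_, fun f => ?_⟩, (-t)⁻¹, fun u => ?_⟩
  · have h0 := hbound u
    rw [hu, norm_zero] at h0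
    exact norm_le_zero_iff.1 (nonpos_of_mul_nonpos_right h0 (neg_pos.2 ht))
  · obtain ⟨u, hu⟩ := exists_mem_schrodingerGraph hV hκ ht hco f
    rw [← hgr, LinearPMap.mem_graph_iff] at hu
    obtain ⟨y, rfl, hy⟩ := hu
    refine ⟨y, ?_⟩
    change schrodingerOp c V y - (t : ℂ) • (y : L2Space d) = f
    rw [hy, add_sub_cancel_right]
  · rw [← div_eq_inv_mul, le_div_iff₀ (neg_pos.2 ht), mul_comm]
    exact hbound u

theorem exists_form_lt_of_extInf_neg (hV : MemLp V ((d : ℝ≥0∞) / 2)) {c κ : ℝ} (hκ : 0 < κ)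
    (h : extInf (opSpectrum (schrodingerOp c V)) < 0) :
    ∃ g : hdotSpace d, c * ‖g‖ ^ 2 + (potForm hV g g).re < κ * ‖g‖ ^ 2 := by
  by_contra! hco
  refine absurd h (not_lt.2 (le_iInf₂ fun t ht => ?_))
  by_contra! hlt
  exact ht (mem_opResolventSet_of_neg hV hκ (by exact_mod_cast hlt) hco)

end Resolvent

section Compactness

theorem tendsto_zero_of_forall_le_add_mul {ι : Type*} {l : Filter ι} {f : ι → ℝ} {C : ℝ}
    (hf : ∀ i, 0 ≤ f i)
    (h : ∀ ν > 0, ∃ a : ι → ℝ, Tendsto a l (𝓝 0) ∧ ∀ i, f i ≤ a i + ν * C) :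
    Tendsto f l (𝓝 0) := by
  refine tendsto_order.2 ⟨fun b hb => Eventually.of_forall fun i => hb.trans_le (hf i),
    fun ε hε => ?_⟩
  obtain ⟨a, ha, hle⟩ := h (ε / 2 / (|C| + 1)) (by positivity)
  have hC : ε / 2 / (|C| + 1) * C ≤ ε / 2 := by
    rw [div_mul_eq_mul_div, div_le_iff₀ (by positivity)]
    gcongr
    exact (le_abs_self C).trans (by linarith)
  filter_upwards [ha.eventually_lt_const (half_pos hε)] with i hi
  linarith [hle i]

section Lebesgue

variable {α F : Type*} [MeasurableSpace α] [NormedAddCommGroup F] {μ : Measure α}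

theorem toReal_eLpNorm_two_sq {f : α → F} (hf : MemLp f 2 μ) :
    (eLpNorm f 2 μ).toReal ^ 2 = ∫ x, ‖f x‖ ^ 2 ∂μ := by
  have hnn : 0 ≤ ∫ x, ‖f x‖ ^ 2 ∂μ := integral_nonneg fun x => by positivity
  have hint := hf.eLpNorm_eq_integral_rpow_norm two_ne_zero ENNReal.ofNat_ne_top
  simp only [ENNReal.toReal_ofNat, Real.rpow_ofNat, ← one_div, ← Real.sqrt_eq_rpow] at hint
  rw [hint, ENNReal.toReal_ofReal (Real.sqrt_nonneg _), Real.sq_sqrt hnn]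

theorem tendsto_eLpNorm_of_tendsto_eLpNorm_sub {ι : Type*} {l : Filter ι} {p : ℝ≥0∞}
    [Fact (1 ≤ p)] {f : ι → α → F} {f₀ : α → F} (hf : ∀ i, MemLp (f i) p μ) (hf₀ : MemLp f₀ p μ)
    (h : Tendsto (fun i => eLpNorm (f i - f₀) p μ) l (𝓝 0)) :
    Tendsto (fun i => eLpNorm (f i) p μ) l (𝓝 (eLpNorm f₀ p μ)) := by
  have := ((Lp.tendsto_Lp_iff_tendsto_eLpNorm'' _ hf _ hf₀).2 h).enorm
  simpa only [Lp.enorm_toLp] using this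

theorem exists_norm_integral_mul_functional_le (μ : Measure α) {p q : ℝ≥0∞} [Fact (1 ≤ p)]
    (hpq : p.HolderConjugate q) : ∃ C, ∀ ψ : α → ℂ, MemLp ψ q μ → ∃ ℓ : Lp ℂ p μ →L[ℂ] ℂ,
      ‖ℓ‖ ≤ C * (eLpNorm ψ q μ).toReal ∧ ∀ f, ℓ f = ∫ x, ψ x * f x ∂μ := by
  have hqp : q.HolderConjugate p := hpq.symm
  have hq : Fact (1 ≤ q) := ⟨hqp.one_le⟩
  let P := (ContinuousLinearMap.mul ℂ ℂ).lpPairing μ q p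
  refine ⟨‖P‖, fun ψ hψ => ⟨P (hψ.toLp ψ), ?_, fun f => ?_⟩⟩
  · rw [← Lp.norm_toLp ψ hψ]
    exact P.le_opNorm _
  · rw [ContinuousLinearMap.lpPairing_eq_integral]
    refine integral_congr_ae ?_
    filter_upwards [hψ.coeFn_toLp] with x hx
    rw [hx, ContinuousLinearMap.mul_apply']

end Lebesgue

theorem exists_abs_integral_potential_le_of_hasCompactSupport {d : ℕ}
    {V : RSpace d → ℝ} (hV : Continuous V)
    (hc : HasCompactSupport V) : ∃ A R : ℝ, 0 ≤ A ∧ ∀ u : RSpace d → ℂ,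
      MemLp u 2 (volume.restrict (Metric.closedBall 0 R)) →
        |∫ x, V x * ‖u x‖ ^ 2| ≤ A * ∫ x in Metric.closedBall 0 R, ‖u x‖ ^ 2 := by
  obtain ⟨A, hA⟩ := hV.bounded_above_of_compact_support hc
  obtain ⟨R, hR⟩ := hc.isCompact.isBounded.subset_closedBall (0 : RSpace d)
  refine ⟨A, R, (norm_nonneg _).trans (hA 0), fun u hu => ?_⟩
  have hset : ∫ x in Metric.closedBall 0 R, V x * ‖u x‖ ^ 2 = ∫ x, V x * ‖u x‖ ^ 2 :=
    setIntegral_eq_integral_of_forall_compl_eq_zero fun x hx => by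
      rw [image_eq_zero_of_notMem_tsupport fun h => hx (hR h), zero_mul]
  rw [← hset, ← Real.norm_eq_abs, ← integral_const_mul]
  refine norm_integral_le_of_norm_le ((hu.integrable_norm_pow two_ne_zero).const_mul A)
    (Eventually.of_forall fun x => ?_)
  rw [norm_mul, norm_pow, norm_norm]
  gcongr
  exact hA x

variable {d : ℕ} [Fact (3 ≤ d)]

namespace InHDot

variable {u : RSpace d → ℂ} {g : RSpace d → EuclideanSpace ℂ (Fin d)}

theorem memLp_closedBall (h : InHDot u g) (R : ℝ) :
    MemLp u 2 (volume.restrict (Metric.closedBall 0 R)) := by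
  have : IsFiniteMeasure (volume.restrict (Metric.closedBall (0 : RSpace d) R)) :=
    ⟨by rw [Measure.restrict_apply_univ]; exact (isCompact_closedBall 0 R).measure_lt_top⟩
  exact (h.memLp.restrict _).mono_exponent two_le_sobExp

theorem eLpNorm_sub_translate_le (h : InHDot u g) (y : RSpace d) :
    eLpNorm (fun x => u (x - y) - u x) 2 volume ≤ ‖y‖ₑ * eLpNorm g 2 volume := by
  obtain ⟨η, hη, -, hgrad, hae⟩ := h.exists_isTestFun_tendsto
  have hae_translate : ∀ᵐ x, Tendsto (fun n => η n (x - y)) atTop (𝓝 (u (x - y))) :=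
    (measurePreserving_sub_right volume y).quasiMeasurePreserving.ae hae
  have hlim : ∀ᵐ x, Tendsto (fun n => η n (x - y) - η n x) atTop (𝓝 (u (x - y) - u x)) := by
    filter_upwards [hae, hae_translate] with x hx hxy
    exact hxy.sub hx
  have hbound n : eLpNorm (fun x => η n (x - y) - η n x) 2 volume ≤
      ‖y‖ₑ * eLpNorm (classicalGrad (η n)) 2 volume := by
    refine (_root_.eLpNorm_sub_translate_le (hη n).contDiff_one one_le_two ENNReal.ofNat_ne_top
      y).trans ?_
    gcongr
    exact eLpNorm_mono (norm_fderiv_le_norm_classicalGrad (η n))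
  have hlim_bound := ENNReal.Tendsto.const_mul (tendsto_eLpNorm_of_tendsto_eLpNorm_sub
    (fun n => (hη n).memLp_grad 2) h.memLp_grad hgrad) (Or.inr (enorm_ne_top (x := y)))
  refine (Lp.eLpNorm_lim_le_liminf_eLpNorm (fun n => ?_) _ hlim).trans
    ((liminf_le_liminf (Eventually.of_forall hbound)).trans_eq hlim_bound.liminf_eq)
  have hc := (hη n).1.continuous
  exact ((hc.comp (by fun_prop)).sub hc).aestronglyMeasurable

theorem eLpNorm_mollify_sub_le (h : InHDot u g) (φ : ContDiffBump (0 : RSpace d)) :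
    eLpNorm (fun x => mollify volume φ u x - u x) 2 volume ≤
      ENNReal.ofReal φ.rOut * eLpNorm g 2 volume := by
  refine _root_.eLpNorm_mollify_sub_le φ (h.memLp.locallyIntegrable Fact.out) one_le_two
    ENNReal.ofNat_ne_top fun y hy => (h.eLpNorm_sub_translate_le y).trans ?_
  rw [← ofReal_norm]
  gcongr

end InHDot

theorem exists_norm_mollify_functional_le (φ : ContDiffBump (0 : RSpace d)) :
    ∃ C, ∀ x, ∃ ℓ : hdotSpace d →L[ℂ] ℂ, ‖ℓ‖ ≤ C ∧
      ∀ g, ℓ g = mollify volume φ (hdotFun d g) x := by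
  have hpq : (sobExp d).HolderConjugate (sobExp d).conjExponent :=
    ENNReal.HolderConjugate.conjExponent Fact.out
  obtain ⟨C, hC⟩ := exists_norm_integral_mul_functional_le (volume : Measure (RSpace d)) hpq
  let ψ : RSpace d → ℂ := fun y => φ.normed volume y
  have hψ : MemLp ψ (sobExp d).conjExponent := (Complex.continuous_ofReal.comp
    φ.continuous_normed).memLp_of_hasCompactSupport
      (φ.hasCompactSupport_normed.comp_left Complex.ofReal_zero)
  have reflect x := Measure.measurePreserving_sub_left (volume : Measure (RSpace d)) x
  refine ⟨C * (eLpNorm ψ (sobExp d).conjExponent volume).toReal * ‖hdotFun d‖, fun x => ?_⟩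
  obtain ⟨ℓ, hℓC, hℓ⟩ := hC _ (hψ.comp_measurePreserving (reflect x))
  rw [eLpNorm_comp_measurePreserving hψ.1 (reflect x)] at hℓC
  refine ⟨ℓ ∘L hdotFun d, (ContinuousLinearMap.opNorm_comp_le _ _).trans (by gcongr), fun g => ?_⟩
  simp [hℓ, ψ, mollify_apply_swap]

theorem tendsto_eLpNorm_mollify_of_weak {h : ℕ → hdotSpace d} {M : ℝ} (hM : ∀ n, ‖h n‖ ≤ M)
    (hw : ∀ ℓ : hdotSpace d →L[ℂ] ℂ, Tendsto (fun n => ℓ (h n)) atTop (𝓝 0))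
    (φ : ContDiffBump (0 : RSpace d)) (μ : Measure (RSpace d)) [IsFiniteMeasure μ] :
    Tendsto (fun n => eLpNorm (mollify volume φ (hdotFun d (h n))) 2 μ) atTop (𝓝 0) := by
  obtain ⟨C, hC⟩ := exists_norm_mollify_functional_le φ
  choose ℓ hℓC hℓ using hC
  refine tendsto_eLpNorm_zero_of_dominated ENNReal.ofNat_ne_top (fun n => ?_)
    (memLp_const (C * M)) (fun n => Eventually.of_forall fun x => ?_)
    (Eventually.of_forall fun x => (hw (ℓ x)).congr fun n => hℓ x (h n))
  · exact (φ.hasCompactSupport_normed.continuous_convolution_left _ φ.continuous_normed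
      ((Lp.memLp (hdotFun d (h n))).locallyIntegrable Fact.out)).aestronglyMeasurable
  · rw [← hℓ]
    exact (ℓ x).le_of_opNorm_le_of_le (hℓC x) (hM n)

-- Rellich's theorem: the mollifications converge pointwise, and they approximate uniformly in `n`.
theorem tendsto_setIntegral_closedBall_of_weak {h : ℕ → hdotSpace d} {M : ℝ}
    (hM : ∀ n, ‖h n‖ ≤ M)
    (hw : ∀ ℓ : hdotSpace d →L[ℂ] ℂ, Tendsto (fun n => ℓ (h n)) atTop (𝓝 0)) (R : ℝ) :
    Tendsto (fun n => ∫ x in Metric.closedBall 0 R, ‖hdotFun d (h n) x‖ ^ 2) atTop (𝓝 0) := by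
  let μ : Measure (RSpace d) := volume.restrict (Metric.closedBall 0 R)
  have : IsFiniteMeasure μ :=
    ⟨by rw [Measure.restrict_apply_univ]; exact (isCompact_closedBall 0 R).measure_lt_top⟩
  have hmem n := (inHDot_hdotFun (h n)).memLp_closedBall R
  suffices Tendsto (fun n => (eLpNorm (hdotFun d (h n)) 2 μ).toReal) atTop (𝓝 0) by
    have hsq := this.pow 2
    simp only [μ, toReal_eLpNorm_two_sq (hmem _)] at hsq
    simpa using hsq
  refine tendsto_zero_of_forall_le_add_mul (C := M) (fun n => ENNReal.toReal_nonneg)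
    fun ν hν => ?_
  let φ : ContDiffBump (0 : RSpace d) := ⟨ν / 2, ν, half_pos hν, half_lt_self hν⟩
  let w n := mollify volume φ (hdotFun d (h n))
  have hw0 := tendsto_eLpNorm_mollify_of_weak hM hw φ μ
  have hrate n : eLpNorm (fun x => w n x - hdotFun d (h n) x) 2 μ ≤
      ENNReal.ofReal (ν * ‖h n‖) := by
    refine (eLpNorm_restrict_le _ _ _ _).trans
      (((inHDot_hdotFun (h n)).eLpNorm_mollify_sub_le φ).trans_eq ?_)
    rw [ENNReal.ofReal_mul hν.le, Submodule.coe_norm, ofReal_norm, Lp.enorm_def]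
  have hwmem n : MemLp (w n) 2 μ := ((memLp_mollify φ Fact.out sobExp_ne_top
    (Lp.memLp (hdotFun d (h n)))).restrict _).mono_exponent two_le_sobExp
  have hdiff n : MemLp (fun x => w n x - hdotFun d (h n) x) 2 μ := (hwmem n).sub (hmem n)
  refine ⟨fun n => (eLpNorm (w n) 2 μ).toReal,
    (ENNReal.tendsto_toReal ENNReal.zero_ne_top).comp hw0, fun n => ?_⟩
  have htri : eLpNorm (hdotFun d (h n)) 2 μ ≤
      eLpNorm (w n) 2 μ + eLpNorm (fun x => w n x - hdotFun d (h n) x) 2 μ := by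
    refine le_of_eq_of_le ?_ (eLpNorm_sub_le (hwmem n).1 (hdiff n).1 one_le_two)
    exact congrArg (eLpNorm · 2 μ) (funext fun x => (sub_sub_cancel _ _).symm)
  have htri_real := ENNReal.toReal_mono (ENNReal.add_ne_top.2 ⟨(hwmem n).2.ne, (hdiff n).2.ne⟩) htri
  rw [ENNReal.toReal_add (hwmem n).2.ne (hdiff n).2.ne] at htri_real
  have hrate_real := ENNReal.toReal_mono ENNReal.ofReal_ne_top (hrate n)
  rw [ENNReal.toReal_ofReal (by positivity)] at hrate_real
  have := mul_le_mul_of_nonneg_left (hM n) hν.le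
  linarith

section Potential

variable {V : RSpace d → ℝ}

theorem InHDot.abs_integral_potential_le {u : RSpace d → ℂ}
    {g : RSpace d → EuclideanSpace ℂ (Fin d)} (hV : MemLp V ((d : ℝ≥0∞) / 2)) (h : InHDot u g) :
    |∫ x, V x * ‖u x‖ ^ 2| ≤
      (eLpNorm V ((d : ℝ≥0∞) / 2) volume).toReal * (sobConst d ^ 2 * ∫ x, ‖g x‖ ^ 2) := by
  have hHolder := norm_integral_potential_le hV h.memLp h.memLp
  rw [integral_potential_self, Complex.norm_real, Real.norm_eq_abs, ← sq] at hHolder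
  have hSobolev := ENNReal.toReal_mono (ENNReal.mul_ne_top ENNReal.coe_ne_top
    h.memLp_grad.eLpNorm_ne_top) h.eLpNorm_le
  rw [ENNReal.toReal_mul, ENNReal.coe_toReal] at hSobolev
  rw [← toReal_eLpNorm_two_sq h.memLp_grad, ← mul_pow]
  exact hHolder.trans (by gcongr)

theorem exists_abs_integral_potential_le (hV : MemLp V ((d : ℝ≥0∞) / 2)) {ν : ℝ} (hν : 0 < ν) :
    ∃ A R : ℝ, 0 ≤ A ∧ ∀ (u : RSpace d → ℂ) (g : RSpace d → EuclideanSpace ℂ (Fin d)),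
      InHDot u g → |∫ x, V x * ‖u x‖ ^ 2| ≤
        A * (∫ x in Metric.closedBall 0 R, ‖u x‖ ^ 2) + ν * ∫ x, ‖g x‖ ^ 2 := by
  let δ : ℝ := ν / ((sobConst d : ℝ) ^ 2 + 1)
  have hδ : 0 < δ := by positivity
  have hδν : δ * (sobConst d : ℝ) ^ 2 ≤ ν := by
    rw [div_mul_eq_mul_div, div_le_iff₀ (by positivity)]
    nlinarith
  obtain ⟨V₁, hc, hle, hcont, hmem⟩ := hV.exists_hasCompactSupport_eLpNorm_sub_le
    (ENNReal.div_ne_top (ENNReal.natCast_ne_top d) two_ne_zero) (ENNReal.ofReal_pos.2 hδ).ne'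
  obtain ⟨A, R, hA, hbound⟩ := exists_abs_integral_potential_le_of_hasCompactSupport hcont hc
  refine ⟨A, R, hA, fun u g h => ?_⟩
  have hsplit : ∫ x, V x * ‖u x‖ ^ 2 =
      (∫ x, V₁ x * ‖u x‖ ^ 2) + ∫ x, (V - V₁) x * ‖u x‖ ^ 2 := by
    rw [← integral_add (integrable_potential_sq hmem h.memLp)
      (integrable_potential_sq (hV.sub hmem) h.memLp)]
    exact integral_congr_ae (Eventually.of_forall fun x => by simp [sub_mul])
  have hsmall : (eLpNorm (V - V₁) ((d : ℝ≥0∞) / 2) volume).toReal ≤ δ := by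
    rw [← ENNReal.toReal_ofReal hδ.le]
    exact ENNReal.toReal_mono ENNReal.ofReal_ne_top hle
  have : 0 ≤ ∫ x, ‖g x‖ ^ 2 := integral_nonneg fun x => by positivity
  rw [hsplit]
  refine (abs_add_le _ _).trans (add_le_add (hbound u (h.memLp_closedBall R)) ?_)
  calc |∫ x, (V - V₁) x * ‖u x‖ ^ 2|
      ≤ (eLpNorm (V - V₁) ((d : ℝ≥0∞) / 2) volume).toReal * (sobConst d ^ 2 * ∫ x, ‖g x‖ ^ 2) :=
        h.abs_integral_potential_le (hV.sub hmem)
    _ ≤ δ * (sobConst d ^ 2 * ∫ x, ‖g x‖ ^ 2) := by gcongr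
    _ = δ * sobConst d ^ 2 * ∫ x, ‖g x‖ ^ 2 := (mul_assoc _ _ _).symm
    _ ≤ ν * ∫ x, ‖g x‖ ^ 2 := by gcongr

theorem tendsto_re_potForm_of_weak (hV : MemLp V ((d : ℝ≥0∞) / 2)) {h : ℕ → hdotSpace d} {M : ℝ}
    (hM : ∀ n, ‖h n‖ ≤ M)
    (hw : ∀ ℓ : hdotSpace d →L[ℂ] ℂ, Tendsto (fun n => ℓ (h n)) atTop (𝓝 0)) :
    Tendsto (fun n => (potForm hV (h n) (h n)).re) atTop (𝓝 0) := by
  rw [tendsto_zero_iff_abs_tendsto_zero]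
  refine tendsto_zero_of_forall_le_add_mul (C := M ^ 2) (fun n => abs_nonneg _) fun ν hν => ?_
  obtain ⟨A, R, -, hbound⟩ := exists_abs_integral_potential_le hV hν
  refine ⟨_, by simpa using (tendsto_setIntegral_closedBall_of_weak hM hw R).const_mul A,
    fun n => ?_⟩
  have hn := inHDot_hdotFun (h n)
  have hform := hbound _ _ hn
  rw [← hn.potForm_self hV, ← hn.norm_elem_sq, hn.elem_eq] at hform
  refine hform.trans ?_
  gcongr
  exact hM n

end Potential

end Compactness

section Minimizer

theorem exists_weak_limit {𝕜 H : Type*} [RCLike 𝕜] [NormedAddCommGroup H] [InnerProductSpace 𝕜 H]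
    [CompleteSpace H] [TopologicalSpace.SeparableSpace H] {x : ℕ → H} {M : ℝ}
    (hM : ∀ n, ‖x n‖ ≤ M) : ∃ (x₀ : H) (ns : ℕ → ℕ), StrictMono ns ∧
      ∀ ℓ : H →L[𝕜] 𝕜, Tendsto (fun n => ℓ (x (ns n))) atTop (𝓝 (ℓ x₀)) := by
  let J := InnerProductSpace.toDual 𝕜 H
  have hJ n : StrongDual.toWeakDual (J (x n)) ∈
      WeakDual.toStrongDual ⁻¹' Metric.closedBall (0 : StrongDual 𝕜 H) M := by
    rw [Set.mem_preimage, mem_closedBall_zero_iff]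
    exact (J.norm_map (x n)).trans_le (hM n)
  obtain ⟨y, -, ns, hns, hlim⟩ := WeakDual.isSeqCompact_closedBall 𝕜 H 0 M hJ
  refine ⟨J.symm (WeakDual.toStrongDual y), ns, hns, fun ℓ => ?_⟩
  have apply_eq_conj (z : H) : ℓ z = conj (J z (J.symm ℓ)) := by
    rw [InnerProductSpace.toDual_apply_apply, inner_conj_symm, InnerProductSpace.toDual_symm_apply]
  simp only [apply_eq_conj, LinearIsometryEquiv.apply_symm_apply]
  exact (RCLike.continuous_conj.tendsto _).comp
    (((WeakDual.eval_continuous (J.symm ℓ)).tendsto y).comp hlim)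

theorem norm_le_of_forall_tendsto_functional {𝕜 H : Type*} [RCLike 𝕜] [NormedAddCommGroup H]
    [NormedSpace 𝕜 H] {ι : Type*} {l : Filter ι} [l.NeBot] {x : ι → H} {x₀ : H} {M : ℝ}
    (hM : ∀ i, ‖x i‖ ≤ M) (hw : ∀ ℓ : H →L[𝕜] 𝕜, Tendsto (fun i => ℓ (x i)) l (𝓝 (ℓ x₀))) :
    ‖x₀‖ ≤ M := by
  obtain ⟨i⟩ : Nonempty ι := l.nonempty_of_neBot
  refine NormedSpace.norm_le_dual_bound 𝕜 x₀ ((norm_nonneg _).trans (hM i)) fun ℓ =>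
    le_of_tendsto' (hw ℓ).norm fun i => ?_
  rw [mul_comm]
  exact ℓ.le_opNorm_of_le (hM i)

theorem eq_zero_of_forall_quadratic_nonneg {a b : ℝ} (h : ∀ s : ℝ, 0 ≤ 2 * s * a + s ^ 2 * b) :
    a = 0 := by
  have hdiscrim := discrim_le_zero (a := b) (b := 2 * a) (c := 0) fun s => by linarith [h s]
  rw [discrim] at hdiscrim
  nlinarith

variable {d : ℕ} [Fact (3 ≤ d)] {V : RSpace d → ℝ}

instance gradSpace_secondCountable {d : ℕ} : SecondCountableTopology (GradSpace d) := by
  have : Fact ((2 : ℝ≥0∞) ≠ ⊤) := ⟨by norm_num⟩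
  infer_instance

theorem potForm_add_self (hV : MemLp V ((d : ℝ≥0∞) / 2)) (g h : hdotSpace d) :
    (potForm hV (g + h) (g + h)).re =
      (potForm hV g g).re + 2 * (potForm hV h g).re + (potForm hV h h).re := by
  have : (potForm hV g h).re = (potForm hV h g).re := by
    rw [← potForm_conj hV h g, Complex.conj_re]
  simp only [map_add, add_apply, Complex.add_re]
  linarith

theorem potForm_smul_self (hV : MemLp V ((d : ℝ≥0∞) / 2)) (s : ℝ) (g : hdotSpace d) :
    (potForm hV ((s : ℂ) • g) ((s : ℂ) • g)).re = s ^ 2 * (potForm hV g g).re := by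
  simp only [map_smulₛₗ, RingHom.id_apply, smul_apply, Complex.conj_ofReal, smul_eq_mul,
    Complex.re_ofReal_mul]
  ring

/-- The pair `(u, g)` is a zero-energy weak solution in `Ḣ¹`: `u` has gradient `g` and satisfies
`-Δu + Vu = 0`, tested against all of `Ḣ¹`. -/
def IsWeakSolution (V : RSpace d → ℝ) (u : RSpace d → ℂ)
    (g : RSpace d → EuclideanSpace ℂ (Fin d)) : Prop :=
  InHDot u g ∧ ∀ v k, InHDot v k →
    (∫ x, inner ℂ (k x) (g x)) + ∫ x, (V x : ℂ) * (conj (v x) * u x) = 0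

theorem inner_add_potForm_eq_zero (hV : MemLp V ((d : ℝ≥0∞) / 2))
    (hnn : ∀ g : hdotSpace d, 0 ≤ ‖g‖ ^ 2 + (potForm hV g g).re) {g : hdotSpace d}
    (hg : ‖g‖ ^ 2 + (potForm hV g g).re = 0) (k : hdotSpace d) :
    inner ℂ k g + potForm hV k g = 0 := by
  have re_eq_zero (k : hdotSpace d) : (inner ℂ k g + potForm hV k g).re = 0 := by
    refine eq_zero_of_forall_quadratic_nonneg (b := ‖k‖ ^ 2 + (potForm hV k k).re) fun s => ?_
    have h := hnn ((s : ℂ) • k + g)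
    rw [norm_add_sq (𝕜 := ℂ), add_comm _ g, potForm_add_self, potForm_smul_self, norm_smul,
      inner_smul_left (𝕜 := ℂ) k g, map_smulₛₗ, smul_apply, smul_eq_mul, Complex.conj_ofReal,
      RCLike.re_to_complex, Complex.re_ofReal_mul, Complex.re_ofReal_mul, Complex.norm_real,
      mul_pow, Real.norm_eq_abs, sq_abs] at h
    rw [Complex.add_re]
    linarith
  refine Complex.ext (re_eq_zero k) ?_
  have h := re_eq_zero (Complex.I • k)
  rw [inner_smul_left (𝕜 := ℂ) k g, map_smulₛₗ, smul_apply, Complex.conj_I, smul_eq_mul,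
    ← mul_add] at h
  simpa using h

theorem isWeakSolution_of_form_eq_zero (hV : MemLp V ((d : ℝ≥0∞) / 2)) (hnn : SchrodingerNonneg V)
    {g : hdotSpace d} (hg : ‖g‖ ^ 2 + (potForm hV g g).re = 0) :
    IsWeakSolution V (hdotFun d g) (g : GradSpace d) := by
  have hin := inHDot_hdotFun g
  refine ⟨hin, fun v k hv => ?_⟩
  rw [← hin.inner_elem hv, ← hin.potForm_elem hV hv, hin.elem_eq]
  exact inner_add_potForm_eq_zero hV (hnn.nonneg hV) hg _

theorem exists_norm_eq_one_form_le (hV : MemLp V ((d : ℝ≥0∞) / 2)) {ε : ℝ} (hε : 0 < ε)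
    (hneg : extInf (opSpectrum (schrodingerOp (1 - ε) V)) < 0) :
    ∃ g : hdotSpace d, ‖g‖ = 1 ∧ (potForm hV g g).re ≤ 2 * ε - 1 := by
  obtain ⟨g, hg⟩ := exists_form_lt_of_extInf_neg hV hε hneg
  have hg0 : g ≠ 0 := by
    rintro rfl
    simp at hg
  have hnorm : 0 < ‖g‖ := norm_pos_iff.2 hg0
  refine ⟨((‖g‖⁻¹ : ℝ) : ℂ) • g, ?_, ?_⟩
  · rw [norm_smul, Complex.norm_real, norm_inv, norm_norm, inv_mul_cancel₀ hnorm.ne']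
  · rw [potForm_smul_self, inv_pow, ← div_eq_inv_mul, div_le_iff₀ (by positivity)]
    linarith

theorem exists_minimizing_seq (hV : MemLp V ((d : ℝ≥0∞) / 2))
    (hneg : ∃ᶠ ε in 𝓝[>] (0 : ℝ), extInf (opSpectrum (schrodingerOp (1 - ε) V)) < 0) :
    ∃ (x : ℕ → hdotSpace d) (c : ℕ → ℝ), (∀ n, ‖x n‖ = 1) ∧ Tendsto c atTop (𝓝 (-1)) ∧
      ∀ n, (potForm hV (x n) (x n)).re ≤ c n := by
  obtain ⟨ε, hε, hεneg⟩ := exists_seq_forall_of_frequently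
    (hneg.and_eventually self_mem_nhdsWithin)
  choose x hx hform using fun n => exists_norm_eq_one_form_le hV (hεneg n).2 (hεneg n).1
  exact ⟨x, _, hx, by simpa using ((hε.mono_right nhdsWithin_le_nhds).const_mul 2).sub_const 1,
    hform⟩

theorem tendsto_re_potForm (hV : MemLp V ((d : ℝ≥0∞) / 2)) {x : ℕ → hdotSpace d}
    {g : hdotSpace d} {M : ℝ} (hM : ∀ n, ‖x n‖ ≤ M)
    (hw : ∀ ℓ : hdotSpace d →L[ℂ] ℂ, Tendsto (fun n => ℓ (x n)) atTop (𝓝 (ℓ g))) :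
    Tendsto (fun n => (potForm hV (x n) (x n)).re) atTop (𝓝 (potForm hV g g).re) := by
  have hdiff (ℓ : hdotSpace d →L[ℂ] ℂ) : Tendsto (fun n => ℓ (x n - g)) atTop (𝓝 0) := by
    simpa using (hw ℓ).sub_const (ℓ g)
  have hself := tendsto_re_potForm_of_weak hV
    (fun n => (norm_sub_le (x n) g).trans (add_le_add_left (hM n) _)) hdiff
  have hcross : Tendsto (fun n => (potForm hV (x n - g) g).re) atTop (𝓝 0) := by
    refine ((Complex.continuous_re.tendsto _).comp (hdiff (potForm hV g))).congr fun n => ?_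
    rw [Function.comp_apply, ← potForm_conj, Complex.conj_re]
  have hsum := ((hcross.const_mul 2).const_add (potForm hV g g).re).add hself
  simp only [mul_zero, add_zero] at hsum
  refine hsum.congr fun n => ?_
  rw [← potForm_add_self hV g, add_sub_cancel]

theorem exists_form_eq_zero (hV : MemLp V ((d : ℝ≥0∞) / 2)) (hnn : SchrodingerNonneg V)
    (hneg : ∃ᶠ ε in 𝓝[>] (0 : ℝ), extInf (opSpectrum (schrodingerOp (1 - ε) V)) < 0) :
    ∃ g : hdotSpace d, g ≠ 0 ∧ ‖g‖ ^ 2 + (potForm hV g g).re = 0 := by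
  obtain ⟨x, c, hx, hc, hform⟩ := exists_minimizing_seq hV hneg
  obtain ⟨g, ns, hns, hw⟩ := exists_weak_limit (𝕜 := ℂ) fun n => (hx n).le
  have hpot : (potForm hV g g).re ≤ -1 :=
    le_of_tendsto_of_tendsto' (tendsto_re_potForm hV (fun n => (hx (ns n)).le) hw)
      (hc.comp hns.tendsto_atTop) fun n => hform (ns n)
  have hnorm : ‖g‖ ≤ 1 := norm_le_of_forall_tendsto_functional (fun n => (hx (ns n)).le) hw
  refine ⟨g, ?_, ?_⟩
  · rintro rfl
    norm_num at hpot
  · nlinarith [norm_nonneg g, hnn.nonneg hV g]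

theorem exists_isWeakSolution (hV : MemLp V ((d : ℝ≥0∞) / 2)) (hnn : SchrodingerNonneg V)
    (hneg : ∃ᶠ ε in 𝓝[>] (0 : ℝ), extInf (opSpectrum (schrodingerOp (1 - ε) V)) < 0) :
    ∃ u g, IsWeakSolution V u g ∧ ¬ u =ᵐ[volume] 0 := by
  obtain ⟨g, hg, hform⟩ := exists_form_eq_zero hV hnn hneg
  refine ⟨_, _, isWeakSolution_of_form_eq_zero hV hnn hform, fun hu => hg ?_⟩
  exact Subtype.ext (Lp.ext
    (((inHDot_hdotFun g).hasWeakGrad.eq_zero hu).trans (Lp.coeFn_zero _ _ _).symm))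

end Minimizer

section Hardy

variable {d : ℕ}

theorem integral_fderiv_apply_self {f : RSpace d → ℝ} (hf : ContDiff ℝ 1 f)
    (hc : HasCompactSupport f) : ∫ x, fderiv ℝ f x x = -(d * ∫ x, f x) := by
  have hcoord (i : Fin d) : Continuous fun x : RSpace d => x i := by fun_prop
  have hfi : Integrable f := hf.continuous.integrable_of_hasCompactSupport hc
  have hint i : Integrable fun x => x i * fderiv ℝ f x (coordVec i) :=
    ((hcoord i).mul ((hf.continuous_fderiv one_ne_zero).clm_apply
      continuous_const)).integrable_of_hasCompactSupport (hc.fderiv_apply ℝ _).mul_left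
  have hproj (i : Fin d) (x : RSpace d) :
      fderiv ℝ (fun y : RSpace d => y i) x (coordVec i) = 1 := by
    have h : HasFDerivAt (fun y : RSpace d => y i) (EuclideanSpace.proj (𝕜 := ℝ) i) x :=
      (EuclideanSpace.proj (𝕜 := ℝ) i).hasFDerivAt
    rw [h.fderiv]
    simp [coordVec]
  have hparts i : ∫ x, x i * fderiv ℝ f x (coordVec i) = -∫ x, f x := by
    rw [integral_mul_fderiv_eq_neg_fderiv_mul_of_integrable (by simpa [hproj] using hfi) (hint i)
      (((hcoord i).mul hf.continuous).integrable_of_hasCompactSupport hc.mul_left)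
      (fun x _ => by fun_prop) fun x _ => hf.differentiable one_ne_zero x]
    simp only [hproj, one_mul]
  calc ∫ x, fderiv ℝ f x x = ∫ x, ∑ i, x i * fderiv ℝ f x (coordVec i) := by
        simp only [fun x => map_eq_sum_smul_coordVec (fderiv ℝ f x) x, smul_eq_mul]
    _ = ∑ i, ∫ x, x i * fderiv ℝ f x (coordVec i) := integral_finsetSum _ fun i _ => hint i
    _ = -(d * ∫ x, f x) := by simp [hparts]

theorem hasFDerivAt_norm_sq_add_const (δ : ℝ) (x : RSpace d) :
    HasFDerivAt (fun y : RSpace d => ‖y‖ ^ 2 + δ) (2 • innerSL ℝ x) x :=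
  (hasStrictFDerivAt_norm_sq x).hasFDerivAt.add_const δ

theorem contDiff_norm_sq_add_const (δ : ℝ) : ContDiff ℝ ∞ fun y : RSpace d => ‖y‖ ^ 2 + δ :=
  (contDiff_norm_sq ℝ).add contDiff_const

theorem fderiv_inv_norm_sq_mul_apply_self {η : RSpace d → ℂ} (hη : Differentiable ℝ η) {δ : ℝ}
    (hδ : 0 < δ) (x : RSpace d) :
    fderiv ℝ (fun y => (‖y‖ ^ 2 + δ)⁻¹ * ‖η y‖ ^ 2) x x =
      (‖x‖ ^ 2 + δ)⁻¹ * (2 * inner ℝ (η x) (fderiv ℝ η x x)) -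
        2 * ‖x‖ ^ 2 * ((‖x‖ ^ 2 + δ)⁻¹) ^ 2 * ‖η x‖ ^ 2 := by
  have hpos : 0 < ‖x‖ ^ 2 + δ := by positivity
  have hweight := (hasDerivAt_inv hpos.ne').comp_hasFDerivAt x (hasFDerivAt_norm_sq_add_const δ x)
  have h : HasFDerivAt (fun y => (‖y‖ ^ 2 + δ)⁻¹ * ‖η y‖ ^ 2) _ x :=
    hweight.mul (hη x).hasFDerivAt.norm_sq
  rw [h.fderiv]
  simp
  ring

-- AM-GM, calibrated so that its first term absorbs half of the surplus `d - 2`.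
theorem neg_fderiv_inv_norm_sq_mul_le {η : RSpace d → ℂ} (hη : Differentiable ℝ η) {c δ : ℝ}
    (hc : 0 < c) (hδ : 0 < δ) (x : RSpace d) :
    -fderiv ℝ (fun y => (‖y‖ ^ 2 + δ)⁻¹ * ‖η y‖ ^ 2) x x ≤
      (2 + c / 2) * ((‖x‖ ^ 2 + δ)⁻¹ * ‖η x‖ ^ 2) + 2 / c * ‖classicalGrad η x‖ ^ 2 := by
  have hpos : 0 < ‖x‖ ^ 2 + δ := by positivity
  have hinner : |inner ℝ (η x) (fderiv ℝ η x x)| ≤ ‖η x‖ * (‖classicalGrad η x‖ * ‖x‖) :=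
    (abs_real_inner_le_norm _ _).trans (by
      gcongr
      exact (fderiv ℝ η x).le_of_opNorm_le (norm_fderiv_le_norm_classicalGrad η x) x)
  have hWx : (‖x‖ ^ 2 + δ)⁻¹ * ‖x‖ ^ 2 ≤ 1 := (inv_mul_le_iff₀ hpos).2 (by linarith)
  have hW : 0 ≤ (‖x‖ ^ 2 + δ)⁻¹ := (inv_pos.2 hpos).le
  rw [fderiv_inv_norm_sq_mul_apply_self hη hδ]
  set W := (‖x‖ ^ 2 + δ)⁻¹
  set s := ‖η x‖
  set t := ‖classicalGrad η x‖
  have hweight : 2 * ‖x‖ ^ 2 * W ^ 2 * s ^ 2 ≤ 2 * (W * s ^ 2) :=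
    calc 2 * ‖x‖ ^ 2 * W ^ 2 * s ^ 2 = 2 * (W * s ^ 2) * (W * ‖x‖ ^ 2) := by ring
      _ ≤ 2 * (W * s ^ 2) * 1 := by gcongr
      _ = 2 * (W * s ^ 2) := mul_one _
  have hsquare : (W * s * ‖x‖) ^ 2 ≤ W * s ^ 2 :=
    calc (W * s * ‖x‖) ^ 2 = W * s ^ 2 * (W * ‖x‖ ^ 2) := by ring
      _ ≤ W * s ^ 2 * 1 := by gcongr
      _ = W * s ^ 2 := mul_one _
  have hcross : -(W * (2 * inner ℝ (η x) (fderiv ℝ η x x))) ≤ c / 2 * (W * s ^ 2) + 2 / c * t ^ 2 :=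
    calc -(W * (2 * inner ℝ (η x) (fderiv ℝ η x x)))
        = 2 * W * -inner ℝ (η x) (fderiv ℝ η x x) := by ring
      _ ≤ 2 * W * (s * (t * ‖x‖)) := by
        gcongr
        exact (neg_le_abs _).trans hinner
      _ = c / 2 * (W * s * ‖x‖) ^ 2 + 2 / c * t ^ 2 -
          c / 2 * (W * s * ‖x‖ - 2 / c * t) ^ 2 := by
        field_simp
        ring
      _ ≤ c / 2 * (W * s * ‖x‖) ^ 2 + 2 / c * t ^ 2 := sub_le_self _ (by positivity)
      _ ≤ c / 2 * (W * s ^ 2) + 2 / c * t ^ 2 := by gcongr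
  linarith

theorem IsTestFun.integral_inv_norm_sq_mul_le {η : RSpace d → ℂ} (hη : IsTestFun η)
    (hd : (2 : ℝ) < d) {δ : ℝ} (hδ : 0 < δ) :
    ∫ x, (‖x‖ ^ 2 + δ)⁻¹ * ‖η x‖ ^ 2 ≤
      (2 / ((d : ℝ) - 2)) ^ 2 * ∫ x, ‖classicalGrad η x‖ ^ 2 := by
  have hc : (0 : ℝ) < d - 2 := sub_pos.2 hd
  set f : RSpace d → ℝ := fun x => (‖x‖ ^ 2 + δ)⁻¹ * ‖η x‖ ^ 2
  have hf : ContDiff ℝ 1 f := (((contDiff_norm_sq_add_const δ).inv fun x => by positivity).mul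
    (hη.1.norm_sq ℝ)).of_le (by simp)
  have hfc : HasCompactSupport f :=
    (hη.2.comp_left (g := fun z : ℂ => ‖z‖ ^ 2) (by simp)).mul_left
  have hfi : Integrable f := hf.continuous.integrable_of_hasCompactSupport hfc
  have hgrad : Integrable fun x => ‖classicalGrad η x‖ ^ 2 :=
    (hη.memLp_grad 2).integrable_norm_pow two_ne_zero
  have hderiv : Integrable fun x => fderiv ℝ f x x := by
    refine ((hf.continuous_fderiv one_ne_zero).clm_apply
      continuous_id).integrable_of_hasCompactSupport ((hfc.fderiv (𝕜 := ℝ)).mono fun x hx h0 => ?_)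
    simp [h0] at hx
  have hmono := integral_mono (hderiv.neg) ((hfi.const_mul _).add (hgrad.const_mul _))
    fun x => neg_fderiv_inv_norm_sq_mul_le hη.differentiable hc hδ x
  simp only [Pi.neg_apply, Pi.add_apply] at hmono
  rw [integral_neg, integral_fderiv_apply_self hf hfc, integral_add (hfi.const_mul _)
    (hgrad.const_mul _), integral_const_mul, integral_const_mul] at hmono
  have habsorb : (d - 2) / 2 * ∫ x, f x ≤ 2 / (d - 2) * ∫ x, ‖classicalGrad η x‖ ^ 2 := by
    linarith
  calc ∫ x, f x = 2 / (d - 2) * ((d - 2) / 2 * ∫ x, f x) := by field_simp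
    _ ≤ 2 / (d - 2) * (2 / (d - 2) * ∫ x, ‖classicalGrad η x‖ ^ 2) := by gcongr
    _ = (2 / ((d : ℝ) - 2)) ^ 2 * ∫ x, ‖classicalGrad η x‖ ^ 2 := by ring

theorem IsTestFun.eLpNorm_inv_sqrt_smul_le {η : RSpace d → ℂ} (hη : IsTestFun η)
    (hd : (2 : ℝ) < d) {δ : ℝ} (hδ : 0 < δ) :
    eLpNorm (fun x => (√(‖x‖ ^ 2 + δ))⁻¹ • η x) 2 volume ≤
      ENNReal.ofReal (2 / ((d : ℝ) - 2)) * eLpNorm (classicalGrad η) 2 volume := by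
  have : (0 : ℝ) < d - 2 := sub_pos.2 hd
  have hpos (x : RSpace d) : 0 < ‖x‖ ^ 2 + δ := by positivity
  have hweight : Continuous fun x : RSpace d => (√(‖x‖ ^ 2 + δ))⁻¹ :=
    (contDiff_norm_sq_add_const δ).continuous.sqrt.inv₀ fun x => (Real.sqrt_pos.2 (hpos x)).ne'
  have hmem : MemLp (fun x => (√(‖x‖ ^ 2 + δ))⁻¹ • η x) 2 :=
    (hweight.smul hη.1.continuous).memLp_of_hasCompactSupport hη.2.smul_left
  have hgrad := hη.memLp_grad 2
  rw [← ENNReal.toReal_le_toReal hmem.2.ne (ENNReal.mul_ne_top ENNReal.ofReal_ne_top hgrad.2.ne),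
    ENNReal.toReal_mul, ENNReal.toReal_ofReal (by positivity)]
  refine le_of_sq_le_sq ?_ (by positivity)
  rw [mul_pow, toReal_eLpNorm_two_sq hmem, toReal_eLpNorm_two_sq hgrad]
  refine le_of_eq_of_le (integral_congr_ae (Eventually.of_forall fun x => ?_))
    (hη.integral_inv_norm_sq_mul_le hd hδ)
  simp only [norm_smul, mul_pow, norm_inv, inv_pow, Real.norm_eq_abs, sq_abs,
    Real.sq_sqrt (hpos x).le]

variable [hd : Fact (3 ≤ d)]

theorem ae_norm_pos : ∀ᵐ x : RSpace d, 0 < ‖x‖ := by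
  have : Nonempty (Fin d) := ⟨⟨0, by have := hd.out; omega⟩⟩
  filter_upwards [Measure.ae_ne volume (0 : RSpace d)] with x hx
  exact norm_pos_iff.2 hx

namespace InHDot

variable {u : RSpace d → ℂ} {g : RSpace d → EuclideanSpace ℂ (Fin d)}

theorem hardy (h : InHDot u g) : eLpNorm (fun x => ‖x‖⁻¹ • u x) 2 volume ≤
    ENNReal.ofReal (2 / ((d : ℝ) - 2)) * eLpNorm g 2 volume := by
  obtain ⟨η, hη, -, hgrad, hae⟩ := h.exists_isTestFun_tendsto
  let δ (n : ℕ) : ℝ := 1 / (n + 1)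
  have hδ n : 0 < δ n := by positivity
  have hlim : ∀ᵐ x, Tendsto (fun n => (√(‖x‖ ^ 2 + δ n))⁻¹ • η n x) atTop (𝓝 (‖x‖⁻¹ • u x)) := by
    filter_upwards [hae, ae_norm_pos] with x hx hx0
    have hroot := (tendsto_one_div_add_atTop_nhds_zero_nat.const_add (‖x‖ ^ 2)).sqrt
    rw [add_zero, Real.sqrt_sq hx0.le] at hroot
    exact (hroot.inv₀ hx0.ne').smul hx
  have hmeas n : AEStronglyMeasurable (fun x => (√(‖x‖ ^ 2 + δ n))⁻¹ • η n x) volume :=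
    (show Measurable fun x : RSpace d => (√(‖x‖ ^ 2 + δ n))⁻¹ by
      fun_prop).aestronglyMeasurable.smul ((hη n).memLp 2).1
  have hbound := ENNReal.Tendsto.const_mul (tendsto_eLpNorm_of_tendsto_eLpNorm_sub
    (fun n => (hη n).memLp_grad 2) h.memLp_grad hgrad)
    (Or.inr (ENNReal.ofReal_ne_top (r := 2 / ((d : ℝ) - 2))))
  have hd2 : (2 : ℝ) < d := by linarith [three_le_cast (d := d)]
  exact (Lp.eLpNorm_lim_le_liminf_eLpNorm hmeas _ hlim).trans ((liminf_le_liminf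
    (Eventually.of_forall fun n => (hη n).eLpNorm_inv_sqrt_smul_le hd2 (hδ n))).trans_eq
      hbound.liminf_eq)

theorem memLp_inv_norm_smul (h : InHDot u g) : MemLp (fun x => ‖x‖⁻¹ • u x) 2 :=
  ⟨(show Measurable fun x : RSpace d => ‖x‖⁻¹ by fun_prop).aestronglyMeasurable.smul h.memLp.1,
    h.hardy.trans_lt (ENNReal.mul_lt_top ENNReal.ofReal_lt_top h.memLp_grad.2)⟩

end InHDot

end Hardy

section Multiplier

variable {d : ℕ}

/-- The gradient of `m * u`, where `m` is smooth and `u` has weak gradient `g`. -/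
noncomputable def mulGrad (m u : RSpace d → ℂ) (g : RSpace d → EuclideanSpace ℂ (Fin d)) :
    RSpace d → EuclideanSpace ℂ (Fin d) :=
  fun x => m x • g x + u x • classicalGrad m x

/-- `m` is smooth and bounded by `A`, and its gradient is bounded by `A / |x|`. By Hardy's
inequality such functions act on the homogeneous Sobolev space by multiplication. -/
structure IsMultiplier (m : RSpace d → ℂ) (A : ℝ) : Prop where
  contDiff : ContDiff ℝ ∞ m
  norm_le : ∀ x, ‖m x‖ ≤ A
  norm_grad_le : ∀ x, ‖x‖ * ‖classicalGrad m x‖ ≤ A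

namespace IsMultiplier

variable {m : RSpace d → ℂ} {A : ℝ}

theorem differentiable (hm : IsMultiplier m A) : Differentiable ℝ m :=
  hm.contDiff.differentiable (by simp)

theorem continuous_grad (hm : IsMultiplier m A) : Continuous (classicalGrad m) :=
  continuous_classicalGrad (hm.contDiff.of_le (by simp))

theorem eLpNorm_smul_le {F : Type*} [NormedAddCommGroup F] [NormedSpace ℂ F]
    (hm : IsMultiplier m A) (f : RSpace d → F) (p : ℝ≥0∞) :
    eLpNorm (fun x => m x • f x) p volume ≤ ENNReal.ofReal A * eLpNorm f p volume :=
  eLpNorm_le_mul_eLpNorm_of_ae_le_mul (Eventually.of_forall fun x => by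
    rw [norm_smul]
    gcongr
    exact hm.norm_le x) p

theorem memLp_smul {F : Type*} [NormedAddCommGroup F] [NormedSpace ℂ F] {f : RSpace d → F}
    {p : ℝ≥0∞} (hm : IsMultiplier m A) (hf : MemLp f p) : MemLp (fun x => m x • f x) p :=
  ⟨hm.contDiff.continuous.aestronglyMeasurable.smul hf.1,
    (hm.eLpNorm_smul_le f p).trans_lt (ENNReal.mul_lt_top ENNReal.ofReal_lt_top hf.2)⟩

variable [Fact (3 ≤ d)] {u : RSpace d → ℂ} {g : RSpace d → EuclideanSpace ℂ (Fin d)}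

theorem eLpNorm_smul_grad_le (hm : IsMultiplier m A) (h : InHDot u g) :
    eLpNorm (fun x => u x • classicalGrad m x) 2 volume ≤
      ENNReal.ofReal A * (ENNReal.ofReal (2 / ((d : ℝ) - 2)) * eLpNorm g 2 volume) := by
  refine (eLpNorm_le_mul_eLpNorm_of_ae_le_mul (g := fun x => ‖x‖⁻¹ • u x) (c := A) ?_ 2).trans
    (by gcongr; exact h.hardy)
  filter_upwards [ae_norm_pos] with x hx
  calc ‖u x • classicalGrad m x‖ = ‖x‖ * ‖classicalGrad m x‖ * (‖x‖⁻¹ * ‖u x‖) := by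
        rw [norm_smul]
        field_simp
    _ ≤ A * (‖x‖⁻¹ * ‖u x‖) := by gcongr; exact hm.norm_grad_le x
    _ = A * ‖‖x‖⁻¹ • u x‖ := by rw [norm_smul, norm_inv, norm_norm]

theorem memLp_smul_grad (hm : IsMultiplier m A) (h : InHDot u g) :
    MemLp (fun x => u x • classicalGrad m x) 2 :=
  ⟨h.memLp.1.smul hm.continuous_grad.aestronglyMeasurable,
    (hm.eLpNorm_smul_grad_le h).trans_lt (ENNReal.mul_lt_top ENNReal.ofReal_lt_top
      (ENNReal.mul_lt_top ENNReal.ofReal_lt_top h.memLp_grad.2))⟩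

theorem memLp_mulGrad (hm : IsMultiplier m A) (h : InHDot u g) : MemLp (mulGrad m u g) 2 :=
  (hm.memLp_smul h.memLp_grad).add (hm.memLp_smul_grad h)

theorem exists_eLpNorm_mulGrad_le (hm : IsMultiplier m A) : ∃ C ≠ (⊤ : ℝ≥0∞), ∀ u g,
    InHDot u g → eLpNorm (mulGrad m u g) 2 volume ≤ C * eLpNorm g 2 volume := by
  refine ⟨ENNReal.ofReal A + ENNReal.ofReal A * ENNReal.ofReal (2 / ((d : ℝ) - 2)), by finiteness,
    fun u g h => (eLpNorm_add_le (hm.memLp_smul h.memLp_grad).1 (hm.memLp_smul_grad h).1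
      one_le_two).trans ?_⟩
  rw [add_mul, mul_assoc]
  exact add_le_add (hm.eLpNorm_smul_le g 2) (hm.eLpNorm_smul_grad_le h)

theorem inHDot (hm : IsMultiplier m A) (h : InHDot u g) :
    InHDot (fun x => m x * u x) (mulGrad m u g) := by
  obtain ⟨η, hη, -, hgrad, hae⟩ := h.exists_isTestFun_tendsto
  have htest n : IsTestFun fun x => m x * η n x :=
    ⟨hm.contDiff.mul (hη n).1, (hη n).2.mul_left⟩
  refine InHDot.of_tendsto_ae (hm.memLp_mulGrad h) (fun n => (htest n).inHDot)
    (hae.mono fun x hx => hx.const_mul (m x)) ?_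
  obtain ⟨C, hC, hbound⟩ := hm.exists_eLpNorm_mulGrad_le
  have hlim := ENNReal.Tendsto.const_mul hgrad (Or.inr hC)
  rw [mul_zero] at hlim
  refine tendsto_of_tendsto_of_tendsto_of_le_of_le tendsto_const_nhds hlim (fun _ => zero_le)
    fun n => ?_
  have hlinear : classicalGrad (fun x => m x * η n x) - mulGrad m u g =
      mulGrad m (η n - u) (classicalGrad (η n) - g) := by
    ext1 x
    rw [Pi.sub_apply, classicalGrad_mul (hm.differentiable x) ((hη n).differentiable x)]
    simp only [mulGrad, Pi.sub_apply, smul_sub, sub_smul]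
    abel
  rw [hlinear]
  exact hbound _ _ ((hη n).inHDot.sub h)

end IsMultiplier

end Multiplier

section Weights

variable {d : ℕ}

/-- A real vector regarded as a complex one. Gradients of complex functions on `RSpace d` take
values in `EuclideanSpace ℂ (Fin d)`, so the gradient of a radial function is a multiple of it. -/
noncomputable def complexify (x : RSpace d) : EuclideanSpace ℂ (Fin d) :=
  WithLp.toLp 2 fun i => (x i : ℂ)

theorem norm_complexify (x : RSpace d) : ‖complexify x‖ = ‖x‖ := by
  simp [complexify, EuclideanSpace.norm_eq]

theorem classicalGrad_radial {φ : ℝ → ℝ} {φ' δ : ℝ} {x : RSpace d}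
    (h : HasDerivAt φ φ' (‖x‖ ^ 2 + δ)) :
    classicalGrad (fun y => ((φ (‖y‖ ^ 2 + δ) : ℝ) : ℂ)) x =
      ((2 * φ' : ℝ) : ℂ) • complexify x := by
  have hcomp : HasFDerivAt (fun y : RSpace d => ((φ (‖y‖ ^ 2 + δ) : ℝ) : ℂ)) _ x :=
    Complex.ofRealCLM.hasFDerivAt.comp x
      (h.comp_hasFDerivAt x (hasFDerivAt_norm_sq_add_const δ x))
  ext i
  simp only [classicalGrad, complexify, PiLp.smul_apply]
  rw [hcomp.fderiv]
  simp [coordVec, EuclideanSpace.inner_single_right]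
  ring

/-- `t ^ (α / 2)` truncated at height `s⁻¹ ^ (α / 2)`; with `t = 1 + |x|²` it is the bounded weight
approximating `(1 + |x|²) ^ (α / 2)` as `s → 0`. -/
noncomputable def truncPow (s α : ℝ) (t : ℝ) : ℝ := (t / (1 + s * t)) ^ (α / 2)

theorem hasDerivAt_truncPow {s α t : ℝ} (hs : 0 < s) (ht : 0 < t) :
    HasDerivAt (truncPow s α) (α / 2 * truncPow s α t / (t * (1 + s * t))) t := by
  have hden : 0 < 1 + s * t := by positivity
  have hbase : 0 < t / (1 + s * t) := by positivity
  have hquot := (hasDerivAt_id t).div (((hasDerivAt_id t).const_mul s).const_add 1) hden.ne'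
  refine (hquot.rpow_const (p := α / 2) (Or.inl hbase.ne')).congr_deriv ?_
  simp only [id, Pi.div_apply]
  rw [Real.rpow_sub_one hbase.ne', truncPow]
  field_simp
  ring

theorem truncPow_pos {s α t : ℝ} (hs : 0 < s) (ht : 0 < t) : 0 < truncPow s α t :=
  Real.rpow_pos_of_pos (by positivity) _

theorem truncPow_le_rpow {s α t : ℝ} (hs : 0 < s) (ht : 0 < t) (hα : 0 ≤ α) :
    truncPow s α t ≤ t ^ (α / 2) :=
  Real.rpow_le_rpow (by positivity) (div_le_self ht.le (by nlinarith [mul_pos hs ht]))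
    (by positivity)

theorem truncPow_le_inv_rpow {s α t : ℝ} (hs : 0 < s) (ht : 0 < t) (hα : 0 ≤ α) :
    truncPow s α t ≤ s⁻¹ ^ (α / 2) := by
  refine Real.rpow_le_rpow (by positivity) ?_ (by positivity)
  rw [div_le_iff₀ (by positivity), mul_add, inv_mul_cancel_left₀ hs.ne', mul_one]
  exact le_add_of_nonneg_left (inv_pos.2 hs).le

theorem tendsto_truncPow {α t : ℝ} (ht : 0 < t) :
    Tendsto (fun n : ℕ => truncPow (1 / ((n : ℝ) + 1)) α t) atTop (𝓝 (t ^ (α / 2))) := by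
  have hden := ((tendsto_one_div_add_atTop_nhds_zero_nat (𝕜 := ℝ)).mul_const t).const_add 1
  rw [zero_mul, add_zero] at hden
  have hbase := (tendsto_const_nhds (x := t)).div hden one_ne_zero
  rw [div_one] at hbase
  exact hbase.rpow_const (Or.inl ht.ne')

/-- The bounded radial weight `truncPow s α (1 + |x|²)` with which the equation is tested; it takes
complex values because it multiplies complex functions. -/
noncomputable def weight (s α : ℝ) (x : RSpace d) : ℂ := (truncPow s α (‖x‖ ^ 2 + 1) : ℝ)

theorem norm_weight {s : ℝ} (hs : 0 < s) (α : ℝ) (x : RSpace d) :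
    ‖weight s α x‖ = truncPow s α (‖x‖ ^ 2 + 1) := by
  rw [weight, Complex.norm_real, Real.norm_of_nonneg (truncPow_pos hs (by positivity)).le]

theorem tendsto_weight (α : ℝ) (x : RSpace d) :
    Tendsto (fun n : ℕ => weight (1 / ((n : ℝ) + 1)) α x) atTop
      (𝓝 (((‖x‖ ^ 2 + 1) ^ (α / 2) : ℝ) : ℂ)) :=
  (Complex.continuous_ofReal.tendsto _).comp (tendsto_truncPow (by positivity))

theorem norm_mul_norm_classicalGrad_weight_le {s α : ℝ} (hs : 0 < s) (hα : 0 ≤ α) (x : RSpace d) :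
    ‖x‖ * ‖classicalGrad (weight s α) x‖ ≤ α * ‖weight s α x‖ := by
  have ht : 0 < ‖x‖ ^ 2 + 1 := by positivity
  have hT := truncPow_pos (α := α) hs ht
  have hgrad : classicalGrad (weight s α) x = _ := classicalGrad_radial (hasDerivAt_truncPow hs ht)
  rw [hgrad, norm_smul, norm_complexify, Complex.norm_real, norm_weight hs,
    Real.norm_of_nonneg (by positivity)]
  have hratio : ‖x‖ ^ 2 / ((‖x‖ ^ 2 + 1) * (1 + s * (‖x‖ ^ 2 + 1))) ≤ 1 :=
    div_le_one_of_le₀ (by nlinarith [mul_pos hs ht]) (by positivity)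
  calc ‖x‖ * (2 * (α / 2 * truncPow s α (‖x‖ ^ 2 + 1) /
          ((‖x‖ ^ 2 + 1) * (1 + s * (‖x‖ ^ 2 + 1)))) * ‖x‖)
      = α * truncPow s α (‖x‖ ^ 2 + 1) *
          (‖x‖ ^ 2 / ((‖x‖ ^ 2 + 1) * (1 + s * (‖x‖ ^ 2 + 1)))) := by ring
    _ ≤ α * truncPow s α (‖x‖ ^ 2 + 1) := mul_le_of_le_one_right (by positivity) hratio

theorem contDiff_weight {s : ℝ} (hs : 0 < s) (α : ℝ) :
    ContDiff ℝ ∞ (weight s α : RSpace d → ℂ) := by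
  have h : ContDiff ℝ ∞ fun x : RSpace d => (‖x‖ ^ 2 + 1) / (1 + s * (‖x‖ ^ 2 + 1)) :=
    (contDiff_norm_sq_add_const 1).div
      (contDiff_const.add (contDiff_const.mul (contDiff_norm_sq_add_const 1)))
      fun x => by positivity
  exact Complex.ofRealCLM.contDiff.comp (h.rpow_const_of_ne fun x => by positivity)

theorem isMultiplier_weight {s α : ℝ} (hs : 0 < s) (hα : 0 ≤ α) :
    IsMultiplier (weight s α : RSpace d → ℂ) ((1 + α) * s⁻¹ ^ (α / 2)) := by
  have hbound (x : RSpace d) : ‖weight s α x‖ ≤ s⁻¹ ^ (α / 2) :=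
    (norm_weight hs α x).trans_le (truncPow_le_inv_rpow hs (by positivity) hα)
  have hnonneg : 0 ≤ s⁻¹ ^ (α / 2) := by positivity
  refine ⟨contDiff_weight hs α, fun x => (hbound x).trans (by nlinarith), fun x =>
    (norm_mul_norm_classicalGrad_weight_le hs hα x).trans ?_⟩
  gcongr
  · linarith
  · exact hbound x

end Weights

section Decay

theorem memLp_of_tendsto_ae_of_eLpNorm_le {X E : Type*} [MeasurableSpace X] {μ : Measure X}
    [NormedAddCommGroup E] {p C : ℝ≥0∞} {f : ℕ → X → E} {f₀ : X → E}
    (hf : ∀ n, AEStronglyMeasurable (f n) μ) (hC : C ≠ ⊤) (hbound : ∀ n, eLpNorm (f n) p μ ≤ C)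
    (hlim : ∀ᵐ x ∂μ, Tendsto (fun n => f n x) atTop (𝓝 (f₀ x))) : MemLp f₀ p μ := by
  refine ⟨aestronglyMeasurable_of_tendsto_ae atTop hf hlim, ?_⟩
  refine ((Lp.eLpNorm_lim_le_liminf_eLpNorm hf f₀ hlim).trans
    ((liminf_le_liminf (Eventually.of_forall hbound)).trans_eq ?_)).trans_lt hC.lt_top
  exact liminf_const C

theorem integrable_inner_of_memLp_two {X E : Type*} [MeasurableSpace X] {μ : Measure X}
    [NormedAddCommGroup E] [InnerProductSpace ℂ E] {f g : X → E} (hf : MemLp f 2 μ)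
    (hg : MemLp g 2 μ) : Integrable (fun x => inner ℂ (f x) (g x)) μ :=
  (L2.integrable_inner (𝕜 := ℂ) (hf.toLp f) (hg.toLp g)).congr
    (EventuallyEq.comp₂ hf.coeFn_toLp (inner ℂ) hg.coeFn_toLp)

theorem re_inner_mulGrad {E : Type*} [NormedAddCommGroup E] [InnerProductSpace ℂ E] (r : ℝ) (u : ℂ)
    (g D : E) :
    (inner ℂ ((r : ℂ) • ((r : ℂ) • g + u • D) + ((r : ℂ) * u) • D) g).re =
      ‖(r : ℂ) • g + u • D‖ ^ 2 - ‖u • D‖ ^ 2 := by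
  have hexpand : ‖(r : ℂ) • g + u • D‖ ^ 2 =
      ‖(r : ℂ) • g‖ ^ 2 + 2 * (inner ℂ ((r : ℂ) • g) (u • D)).re + ‖u • D‖ ^ 2 :=
    norm_add_sq (𝕜 := ℂ) _ _
  have hdiag : ‖(r : ℂ) • g‖ ^ 2 = r ^ 2 * (inner ℂ g g).re := by
    rw [norm_smul, mul_pow, Complex.norm_real, Real.norm_eq_abs, sq_abs]
    simp [← Complex.ofReal_pow]
  have hcross : (inner ℂ ((r : ℂ) • g) (u • D)).re = r * (inner ℂ (u • D) g).re := by
    rw [inner_smul_left, Complex.conj_ofReal, Complex.re_ofReal_mul, ← inner_conj_symm,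
      Complex.conj_re]
  rw [hexpand, hdiag, hcross, mul_smul, ← smul_add, inner_smul_left, Complex.conj_ofReal,
    Complex.re_ofReal_mul, inner_add_left, inner_add_left, inner_smul_left, Complex.conj_ofReal,
    Complex.add_re, Complex.add_re, Complex.re_ofReal_mul]
  ring

variable {d : ℕ} [Fact (3 ≤ d)] {V : RSpace d → ℝ} {u : RSpace d → ℂ}
  {g : RSpace d → EuclideanSpace ℂ (Fin d)}

theorem IsWeakSolution.energy_eq_zero (h : IsWeakSolution V u g) :
    (∫ x, ‖g x‖ ^ 2) + ∫ x, V x * ‖u x‖ ^ 2 = 0 := by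
  have htest := h.2 u g h.1
  rw [integral_potential_self] at htest
  simp only [inner_self_eq_norm_sq_to_K, Complex.coe_algebraMap, ← Complex.ofReal_pow] at htest
  rw [integral_complex_ofReal] at htest
  exact_mod_cast htest

-- The equation is tested with `w² u`.
theorem IsWeakSolution.energy_identity (h : IsWeakSolution V u g) {w : RSpace d → ℝ} {A : ℝ}
    (hw : IsMultiplier (fun x => (w x : ℂ)) A) :
    (∫ x, ‖mulGrad (fun x => (w x : ℂ)) u g x‖ ^ 2) -
      (∫ x, ‖u x • classicalGrad (fun x => (w x : ℂ)) x‖ ^ 2) +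
      ∫ x, V x * ‖(w x : ℂ) * u x‖ ^ 2 = 0 := by
  set m : RSpace d → ℂ := fun x => (w x : ℂ)
  have hmu := hw.inHDot h.1
  have hmmu := hw.inHDot hmu
  have hint :
      Integrable fun x => inner ℂ (mulGrad m (fun x => m x * u x) (mulGrad m u g) x) (g x) :=
    integrable_inner_of_memLp_two hmmu.memLp_grad h.1.memLp_grad
  have hgrad : (∫ x, inner ℂ (mulGrad m (fun x => m x * u x) (mulGrad m u g) x) (g x)).re =
      (∫ x, ‖mulGrad m u g x‖ ^ 2) - ∫ x, ‖u x • classicalGrad m x‖ ^ 2 := by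
    rw [← integral_sub (hmu.memLp_grad.integrable_norm_pow two_ne_zero)
      ((hw.memLp_smul_grad h.1).integrable_norm_pow two_ne_zero)]
    exact (integral_re hint).symm.trans (integral_congr_ae (Eventually.of_forall fun x =>
      re_inner_mulGrad (w x) (u x) (g x) (classicalGrad m x)))
  have hpot : ∫ x, (V x : ℂ) * (conj (m x * (m x * u x)) * u x) =
      ((∫ x, V x * ‖m x * u x‖ ^ 2 : ℝ) : ℂ) := by
    rw [← integral_potential_self]
    refine integral_congr_ae (Eventually.of_forall fun x => ?_)
    simp only [m, map_mul, Complex.conj_ofReal]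
    ring
  have htest := congrArg Complex.re (h.2 _ _ hmmu)
  rwa [Complex.add_re, Complex.zero_re, hgrad, hpot, Complex.ofReal_re] at htest

theorem InHDot.eLpNorm_smul_grad_weight_le (h : InHDot u g) {s α : ℝ} (hs : 0 < s) (hα : 0 ≤ α) :
    eLpNorm (fun x => u x • classicalGrad (weight s α) x) 2 volume ≤
      ENNReal.ofReal (α * (2 / ((d : ℝ) - 2))) * eLpNorm (mulGrad (weight s α) u g) 2 volume := by
  have hpointwise : ∀ᵐ x, ‖u x • classicalGrad (weight s α) x‖ ≤
      α * ‖‖x‖⁻¹ • (weight s α x * u x)‖ := by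
    filter_upwards [ae_norm_pos] with x hx
    calc ‖u x • classicalGrad (weight s α) x‖
        = ‖u x‖ * ‖x‖⁻¹ * (‖x‖ * ‖classicalGrad (weight s α) x‖) := by
          rw [norm_smul]
          field_simp
      _ ≤ ‖u x‖ * ‖x‖⁻¹ * (α * ‖weight s α x‖) := by
          gcongr ?_ * ?_
          exact norm_mul_norm_classicalGrad_weight_le hs hα x
      _ = α * ‖‖x‖⁻¹ • (weight s α x * u x)‖ := by
          rw [norm_smul, norm_inv, norm_norm, norm_mul]
          ring
  rw [ENNReal.ofReal_mul hα, mul_assoc]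
  refine (eLpNorm_le_mul_eLpNorm_of_ae_le_mul hpointwise 2).trans ?_
  gcongr
  exact ((isMultiplier_weight hs hα).inHDot h).hardy

theorem InHDot.setIntegral_norm_weight_mul_sq_le (h : InHDot u g) {s α : ℝ} (hs : 0 < s)
    (hα : 0 ≤ α) (R : ℝ) :
    ∫ x in Metric.closedBall 0 R, ‖weight s α x * u x‖ ^ 2 ≤
      (R ^ 2 + 1) ^ α * ∫ x in Metric.closedBall 0 R, ‖u x‖ ^ 2 := by
  rw [← integral_const_mul]
  refine setIntegral_mono_on ((((isMultiplier_weight hs hα).inHDot h).memLp_closedBall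
    R).integrable_norm_pow two_ne_zero)
    (((h.memLp_closedBall R).integrable_norm_pow two_ne_zero).const_mul _)
    measurableSet_closedBall fun x hx => ?_
  have hxR : ‖x‖ ≤ R := mem_closedBall_zero_iff.1 hx
  have ht : 0 < ‖x‖ ^ 2 + 1 := by positivity
  rw [norm_mul, mul_pow, norm_weight hs]
  gcongr
  calc truncPow s α (‖x‖ ^ 2 + 1) ^ 2 ≤ ((‖x‖ ^ 2 + 1) ^ (α / 2)) ^ 2 :=
        pow_le_pow_left₀ (truncPow_pos hs ht).le (truncPow_le_rpow hs ht hα) 2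
    _ = (‖x‖ ^ 2 + 1) ^ α := by
        rw [← Real.rpow_mul_natCast ht.le]
        norm_num
    _ ≤ (R ^ 2 + 1) ^ α := by gcongr

-- With `θ = 2 α / (d - 2) < 1`, Hardy's inequality absorbs `θ²` of the weighted Dirichlet energy
-- and the form bound on `V` absorbs half of the rest.
theorem IsWeakSolution.exists_eLpNorm_mulGrad_weight_le (h : IsWeakSolution V u g)
    (hV : MemLp V ((d : ℝ≥0∞) / 2)) {α : ℝ} (hα : 0 ≤ α) (hα' : α < ((d : ℝ) - 2) / 2) :
    ∃ C : ℝ, ∀ s : ℝ, 0 < s →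
      eLpNorm (mulGrad (weight s α) u g) 2 volume ≤ ENNReal.ofReal C := by
  have hd2 : (0 : ℝ) < d - 2 := by linarith
  obtain ⟨θ, hθ⟩ : ∃ θ, θ = α * (2 / ((d : ℝ) - 2)) := ⟨_, rfl⟩
  have hθ0 : 0 ≤ θ := by rw [hθ]; positivity
  have hθ1 : θ < 1 := by
    rw [hθ, ← mul_div_assoc, div_lt_one hd2]
    linarith
  have hν : 0 < (1 - θ ^ 2) / 2 := by nlinarith
  obtain ⟨A, R, hA, hpot⟩ := exists_abs_integral_potential_le hV hν
  set B : ℝ := A * ((R ^ 2 + 1) ^ α * ∫ x in Metric.closedBall 0 R, ‖u x‖ ^ 2)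
  refine ⟨√(B / ((1 - θ ^ 2) / 2)), fun s hs => ?_⟩
  have hw : IsMultiplier (weight s α : RSpace d → ℂ) _ := isMultiplier_weight hs hα
  have hwu := hw.inHDot h.1
  have henergy : (∫ x, ‖mulGrad (weight s α) u g x‖ ^ 2) -
      (∫ x, ‖u x • classicalGrad (weight s α) x‖ ^ 2) +
      ∫ x, V x * ‖weight s α x * u x‖ ^ 2 = 0 :=
    h.energy_identity (w := fun x => truncPow s α (‖x‖ ^ 2 + 1)) hw
  have hhardy : ∫ x, ‖u x • classicalGrad (weight s α) x‖ ^ 2 ≤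
      θ ^ 2 * ∫ x, ‖mulGrad (weight s α) u g x‖ ^ 2 := by
    rw [← toReal_eLpNorm_two_sq (hw.memLp_smul_grad h.1), ← toReal_eLpNorm_two_sq hwu.memLp_grad,
      ← mul_pow]
    refine pow_le_pow_left₀ ENNReal.toReal_nonneg ?_ 2
    have := ENNReal.toReal_mono (ENNReal.mul_ne_top ENNReal.ofReal_ne_top
      hwu.memLp_grad.eLpNorm_ne_top) (h.1.eLpNorm_smul_grad_weight_le hs hα)
    rwa [ENNReal.toReal_mul, ← hθ, ENNReal.toReal_ofReal hθ0] at this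
  have hlocal := mul_le_mul_of_nonneg_left (h.1.setIntegral_norm_weight_mul_sq_le hs hα R) hA
  have hpotential := (neg_le_abs _).trans (hpot _ _ hwu)
  rw [← ENNReal.ofReal_toReal hwu.memLp_grad.eLpNorm_ne_top]
  refine ENNReal.ofReal_le_ofReal (Real.le_sqrt_of_sq_le ?_)
  rw [toReal_eLpNorm_two_sq hwu.memLp_grad, le_div_iff₀ hν]
  linarith

theorem IsWeakSolution.memLp_inv_norm_mul_rpow_smul (h : IsWeakSolution V u g)
    (hV : MemLp V ((d : ℝ≥0∞) / 2)) {α : ℝ} (hα : 0 ≤ α) (hα' : α < ((d : ℝ) - 2) / 2) :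
    MemLp (fun x => (‖x‖⁻¹ * (‖x‖ ^ 2 + 1) ^ (α / 2)) • u x) 2 := by
  obtain ⟨C, hC⟩ := h.exists_eLpNorm_mulGrad_weight_le hV hα hα'
  have hs (n : ℕ) : (0 : ℝ) < 1 / ((n : ℝ) + 1) := by positivity
  have hwu n := (isMultiplier_weight (hs n) hα).inHDot h.1
  refine memLp_of_tendsto_ae_of_eLpNorm_le (fun n => (hwu n).memLp_inv_norm_smul.1)
    (C := ENNReal.ofReal (2 / ((d : ℝ) - 2)) * ENNReal.ofReal C) (by finiteness)
    (fun n => (hwu n).hardy.trans (by gcongr; exact hC _ (hs n)))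
    (Eventually.of_forall fun x => ?_)
  have hlim := ((tendsto_weight α x).mul_const (u x)).const_smul ‖x‖⁻¹
  rwa [← Complex.real_smul, smul_smul] at hlim

theorem IsWeakSolution.memLp_rpow_smul_grad (h : IsWeakSolution V u g)
    (hV : MemLp V ((d : ℝ≥0∞) / 2)) {α : ℝ} (hα : 0 ≤ α) (hα' : α < ((d : ℝ) - 2) / 2) :
    MemLp (fun x => ((‖x‖ ^ 2 + 1) ^ (α / 2)) • g x) 2 := by
  obtain ⟨C, hC⟩ := h.exists_eLpNorm_mulGrad_weight_le hV hα hα'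
  have hs (n : ℕ) : (0 : ℝ) < 1 / ((n : ℝ) + 1) := by positivity
  have hw n := isMultiplier_weight (d := d) (hs n) hα
  refine memLp_of_tendsto_ae_of_eLpNorm_le (fun n => ((hw n).memLp_smul h.1.memLp_grad).1)
    (C := ENNReal.ofReal C + ENNReal.ofReal (α * (2 / ((d : ℝ) - 2))) * ENNReal.ofReal C)
    (by finiteness) (fun n => ?_) (Eventually.of_forall fun x => ?_)
  · have hsplit : (fun x => weight (1 / ((n : ℝ) + 1)) α x • g x) =
        mulGrad (weight (1 / ((n : ℝ) + 1)) α) u g -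
          fun x => u x • classicalGrad (weight (1 / ((n : ℝ) + 1)) α) x := by
      ext1 x
      simp [mulGrad]
    rw [hsplit]
    refine (eLpNorm_sub_le ((hw n).memLp_mulGrad h.1).1 ((hw n).memLp_smul_grad h.1).1
      one_le_two).trans (add_le_add (hC _ (hs n))
        ((h.1.eLpNorm_smul_grad_weight_le (hs n) hα).trans ?_))
    gcongr
    exact hC _ (hs n)
  · have hlim := (tendsto_weight α x).smul_const (g x)
    rwa [Complex.coe_smul] at hlim

end Decay

section WeakGradLimit

variable {X E : Type*} [TopologicalSpace X] [MeasurableSpace X] {μ : Measure X}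
  [NormedAddCommGroup E] {f : ℕ → X → E} {f₀ : X → E} {b : X → ℝ}

theorem locallyIntegrable_of_dominated_convergence (hb : LocallyIntegrable b μ)
    (hf : ∀ n, AEStronglyMeasurable (f n) μ) (hbound : ∀ n, ∀ᵐ x ∂μ, ‖f n x‖ ≤ b x)
    (hlim : ∀ᵐ x ∂μ, Tendsto (fun n => f n x) atTop (𝓝 (f₀ x))) : LocallyIntegrable f₀ μ := by
  refine hb.mono (aestronglyMeasurable_of_tendsto_ae atTop hf hlim) ?_
  filter_upwards [ae_all_iff.2 hbound, hlim] with x hx hx₀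
  exact (le_of_tendsto' hx₀.norm hx).trans (le_abs_self _)

theorem locallyIntegrable_norm {f : X → E} (hf : LocallyIntegrable f μ) :
    LocallyIntegrable (fun x => ‖f x‖) μ :=
  locallyIntegrableOn_univ.1 (locallyIntegrableOn_univ.2 hf).norm

theorem tendsto_integral_smul_of_dominated_convergence [OpensMeasurableSpace X] [T2Space X]
    [NormedSpace ℝ E] {ψ : X → ℝ} (hψ : Continuous ψ) (hψc : HasCompactSupport ψ)
    (hf : ∀ n, LocallyIntegrable (f n) μ) (hb : LocallyIntegrable b μ)
    (hbound : ∀ n, ∀ᵐ x ∂μ, ‖f n x‖ ≤ b x)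
    (hlim : ∀ᵐ x ∂μ, Tendsto (fun n => f n x) atTop (𝓝 (f₀ x))) :
    Tendsto (fun n => ∫ x, ψ x • f n x ∂μ) atTop (𝓝 (∫ x, ψ x • f₀ x ∂μ)) := by
  refine tendsto_integral_of_dominated_convergence (fun x => ‖ψ x • b x‖)
    (fun n => ((hf n).integrable_smul_left_of_hasCompactSupport hψ hψc).1)
    (hb.integrable_smul_left_of_hasCompactSupport hψ hψc).norm (fun n => ?_)
    (hlim.mono fun x hx => hx.const_smul (ψ x))
  filter_upwards [hbound n] with x hx
  rw [norm_smul, norm_smul]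
  gcongr
  exact hx.trans (le_abs_self _)

variable {d : ℕ}

theorem locallyIntegrable_coord {g : RSpace d → EuclideanSpace ℂ (Fin d)}
    (hg : LocallyIntegrable g) (i : Fin d) : LocallyIntegrable fun x => g x i := fun x =>
  let ⟨s, hs, h⟩ := hg x
  ⟨s, hs, (EuclideanSpace.proj (𝕜 := ℂ) i).integrable_comp h⟩

theorem continuous_fderiv_coordVec {η : RSpace d → ℝ} (hη : ContDiff ℝ ∞ η) (i : Fin d) :
    Continuous fun x => fderiv ℝ η x (coordVec i) :=
  (hη.continuous_fderiv (by simp)).clm_apply continuous_const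

theorem HasWeakGrad.of_dominated_convergence {v : ℕ → RSpace d → ℂ}
    {k : ℕ → RSpace d → EuclideanSpace ℂ (Fin d)} {u : RSpace d → ℂ}
    {g : RSpace d → EuclideanSpace ℂ (Fin d)} {b c : RSpace d → ℝ}
    (h : ∀ n, HasWeakGrad (v n) (k n)) (hb : LocallyIntegrable b) (hc : LocallyIntegrable c)
    (hvb : ∀ n, ∀ᵐ x, ‖v n x‖ ≤ b x) (hkc : ∀ n, ∀ᵐ x, ‖k n x‖ ≤ c x)
    (hv : ∀ᵐ x, Tendsto (fun n => v n x) atTop (𝓝 (u x)))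
    (hk : ∀ᵐ x, Tendsto (fun n => k n x) atTop (𝓝 (g x))) : HasWeakGrad u g := by
  refine ⟨locallyIntegrable_of_dominated_convergence hb (fun n => (h n).1.aestronglyMeasurable)
    hvb hv, locallyIntegrable_of_dominated_convergence hc
    (fun n => (h n).2.1.aestronglyMeasurable) hkc hk, fun η hη hηc i => ?_⟩
  have hleft := tendsto_integral_smul_of_dominated_convergence (continuous_fderiv_coordVec hη i)
    (hηc.fderiv_apply ℝ (coordVec i)) (fun n => (h n).1) hb hvb hv
  have hright := tendsto_integral_smul_of_dominated_convergence hη.continuous hηc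
    (fun n => locallyIntegrable_coord (h n).2.1 i) hc
    (fun n => (hkc n).mono fun x hx => (PiLp.norm_apply_le (k n x) i).trans hx)
    (hk.mono fun x hx => ((EuclideanSpace.proj (𝕜 := ℂ) i).continuous.tendsto _).comp hx)
  exact tendsto_nhds_unique hleft (hright.neg.congr fun n => ((h n).2.2 η hη hηc i).symm)

end WeakGradLimit

section ProductRule

variable {d : ℕ}

theorem classicalGrad_ofReal_apply {W : RSpace d → ℝ} {x : RSpace d}
    (hW : DifferentiableAt ℝ W x) (i : Fin d) :
    classicalGrad (fun y => (W y : ℂ)) x i = (fderiv ℝ W x (coordVec i) : ℝ) := by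
  have h : HasFDerivAt (fun y => (W y : ℂ)) _ x :=
    Complex.ofRealCLM.hasFDerivAt.comp x hW.hasFDerivAt
  simp only [classicalGrad]
  rw [h.fderiv]
  rfl

theorem HasWeakGrad.mul_contDiff {u : RSpace d → ℂ} {g : RSpace d → EuclideanSpace ℂ (Fin d)}
    (h : HasWeakGrad u g) {W : RSpace d → ℝ} (hW : ContDiff ℝ ∞ W) :
    HasWeakGrad (fun x => (W x : ℂ) * u x) (mulGrad (fun x => (W x : ℂ)) u g) := by
  have hWc : ContDiff ℝ ∞ fun x => (W x : ℂ) := Complex.ofRealCLM.contDiff.comp hW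
  have hWu : LocallyIntegrable fun x => (W x : ℂ) * u x := h.1.continuous_smul hWc.continuous
  have hWg : LocallyIntegrable fun x => (W x : ℂ) • g x := h.2.1.continuous_smul hWc.continuous
  have huW : LocallyIntegrable fun x => u x • classicalGrad (fun y => (W y : ℂ)) x :=
    h.1.smul_continuous (continuous_classicalGrad (hWc.of_le (by simp)))
  refine ⟨hWu, hWg.add huW, fun η hη hηc i => ?_⟩
  have hleibniz x : fderiv ℝ (fun y => η y * W y) x (coordVec i) • u x =
      fderiv ℝ η x (coordVec i) • ((W x : ℂ) * u x) +
        η x • (u x • classicalGrad (fun y => (W y : ℂ)) x) i := by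
    have hWx := hW.differentiable (by simp) x
    rw [fderiv_fun_mul (hη.differentiable (by simp) x) hWx, PiLp.smul_apply,
      classicalGrad_ofReal_apply hWx]
    simp only [add_apply, smul_apply, smul_eq_mul, Complex.real_smul, Complex.ofReal_add,
      Complex.ofReal_mul]
    ring
  have hcomponent x : η x • mulGrad (fun y => (W y : ℂ)) u g x i =
      (η x * W x) • g x i + η x • (u x • classicalGrad (fun y => (W y : ℂ)) x) i := by
    simp only [mulGrad, PiLp.add_apply, PiLp.smul_apply, smul_eq_mul, Complex.real_smul,
      Complex.ofReal_mul]
    ring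
  have hηWg : Integrable fun x => (η x * W x) • g x i :=
    (locallyIntegrable_coord h.2.1 i).integrable_smul_left_of_hasCompactSupport
      (hη.continuous.mul hW.continuous) hηc.mul_right
  have hηuW := (locallyIntegrable_coord huW i).integrable_smul_left_of_hasCompactSupport
    hη.continuous hηc
  have htest := h.2.2 (fun x => η x * W x) (hη.mul hW) hηc.mul_right i
  simp_rw [hleibniz] at htest
  rw [integral_add (hWu.integrable_smul_left_of_hasCompactSupport (continuous_fderiv_coordVec hη i)
    (hηc.fderiv_apply ℝ (coordVec i))) hηuW] at htest
  simp_rw [hcomponent]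
  rw [integral_add hηWg hηuW, eq_sub_of_add_eq htest]
  ring

end ProductRule

section PowerWeight

variable {d : ℕ}

theorem rpow_eq_sq_rpow_half {t : ℝ} (ht : 0 ≤ t) (α : ℝ) : t ^ α = (t ^ 2) ^ (α / 2) := by
  rw [← Real.rpow_natCast_mul ht]
  congr 1
  push_cast
  ring

/-- The smooth regularization `(|x|² + δ) ^ (α / 2)` of `|x| ^ α`. -/
noncomputable def regNormRpow (δ α : ℝ) (x : RSpace d) : ℝ := (‖x‖ ^ 2 + δ) ^ (α / 2)

/-- The gradient of `|x| ^ α`; at the origin its value is the junk value `0`. -/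
noncomputable def normRpowGrad (α : ℝ) (x : RSpace d) : EuclideanSpace ℂ (Fin d) :=
  ((α * (‖x‖ ^ 2) ^ (α / 2 - 1) : ℝ) : ℂ) • complexify x

theorem contDiff_regNormRpow {δ : ℝ} (hδ : 0 < δ) (α : ℝ) :
    ContDiff ℝ ∞ (regNormRpow δ α : RSpace d → ℝ) :=
  (contDiff_norm_sq_add_const δ).rpow_const_of_ne fun x => by positivity

theorem regNormRpow_nonneg {δ : ℝ} (hδ : 0 < δ) (α : ℝ) (x : RSpace d) : 0 ≤ regNormRpow δ α x :=
  Real.rpow_nonneg (by positivity) _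

theorem regNormRpow_mono {δ δ' α : ℝ} (hδ : 0 < δ) (hδ' : δ ≤ δ') (hα : 0 ≤ α) (x : RSpace d) :
    regNormRpow δ α x ≤ regNormRpow δ' α x := by
  unfold regNormRpow
  gcongr

theorem classicalGrad_regNormRpow {δ : ℝ} (hδ : 0 < δ) (α : ℝ) (x : RSpace d) :
    classicalGrad (fun y => (regNormRpow δ α y : ℂ)) x =
      ((α * (‖x‖ ^ 2 + δ) ^ (α / 2 - 1) : ℝ) : ℂ) • complexify x := by
  have hderiv : HasDerivAt (fun t : ℝ => t ^ (α / 2)) (α / 2 * (‖x‖ ^ 2 + δ) ^ (α / 2 - 1))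
      (‖x‖ ^ 2 + δ) := Real.hasDerivAt_rpow_const (Or.inl (by positivity))
  refine (classicalGrad_radial hderiv).trans ?_
  congr 2
  ring

theorem norm_classicalGrad_regNormRpow_le {δ α : ℝ} (hδ : 0 < δ) (hδ1 : δ ≤ 1) (hα : 0 ≤ α)
    (x : RSpace d) : ‖classicalGrad (fun y => (regNormRpow δ α y : ℂ)) x‖ ≤
      α * (‖x‖⁻¹ * regNormRpow 1 α x) := by
  have ht : 0 < ‖x‖ ^ 2 + δ := by positivity
  rw [classicalGrad_regNormRpow hδ, norm_smul, norm_complexify, Complex.norm_real,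
    Real.norm_of_nonneg (by positivity), Real.rpow_sub_one ht.ne', mul_assoc]
  refine mul_le_mul_of_nonneg_left ?_ hα
  have hratio : ‖x‖ / (‖x‖ ^ 2 + δ) ≤ ‖x‖⁻¹ := by
    rcases (norm_nonneg x).eq_or_lt with hx | hx
    · simp [← hx]
    · rw [div_le_iff₀ ht, le_inv_mul_iff₀ hx]
      nlinarith
  calc (‖x‖ ^ 2 + δ) ^ (α / 2) / (‖x‖ ^ 2 + δ) * ‖x‖
      = ‖x‖ / (‖x‖ ^ 2 + δ) * regNormRpow δ α x := by
        rw [regNormRpow]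
        ring
    _ ≤ ‖x‖⁻¹ * regNormRpow 1 α x := mul_le_mul hratio (regNormRpow_mono hδ hδ1 hα x)
        (regNormRpow_nonneg hδ α x) (by positivity)

theorem tendsto_norm_sq_add_one_div (x : RSpace d) :
    Tendsto (fun n : ℕ => ‖x‖ ^ 2 + 1 / ((n : ℝ) + 1)) atTop (𝓝 (‖x‖ ^ 2)) := by
  simpa only [add_zero] using
    (tendsto_one_div_add_atTop_nhds_zero_nat (𝕜 := ℝ)).const_add (‖x‖ ^ 2)

theorem tendsto_regNormRpow {α : ℝ} (hα : 0 ≤ α) (x : RSpace d) :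
    Tendsto (fun n : ℕ => regNormRpow (1 / ((n : ℝ) + 1)) α x) atTop (𝓝 (‖x‖ ^ α)) := by
  rw [rpow_eq_sq_rpow_half (norm_nonneg x)]
  exact (tendsto_norm_sq_add_one_div x).rpow_const (Or.inr (by positivity))

theorem tendsto_classicalGrad_regNormRpow (α : ℝ) (x : RSpace d) :
    Tendsto (fun n : ℕ => classicalGrad
      (fun y : RSpace d => (regNormRpow (1 / ((n : ℝ) + 1)) α y : ℂ)) x)
      atTop (𝓝 (normRpowGrad α x)) := by
  have hgrad (n : ℕ) : classicalGrad
      (fun y : RSpace d => (regNormRpow (1 / ((n : ℝ) + 1)) α y : ℂ)) x = _ :=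
    classicalGrad_regNormRpow (by positivity) α x
  simp_rw [hgrad, normRpowGrad]
  rcases eq_or_ne x 0 with rfl | hx
  · have hzero : complexify (0 : RSpace d) = 0 := by
      rw [← norm_eq_zero, norm_complexify, norm_zero]
    simp only [hzero, smul_zero, tendsto_const_nhds]
  · have hpow := (tendsto_norm_sq_add_one_div x).rpow_const (p := α / 2 - 1)
      (Or.inl (pow_ne_zero 2 (norm_ne_zero_iff.2 hx)))
    exact ((Complex.continuous_ofReal.tendsto _).comp (hpow.const_mul α)).smul_const _

theorem one_div_natCast_add_one_le_one (n : ℕ) : 1 / ((n : ℝ) + 1) ≤ 1 :=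
  div_le_one_of_le₀ (le_add_of_nonneg_left n.cast_nonneg) (by positivity)

theorem norm_normRpowGrad_le {α : ℝ} (hα : 0 ≤ α) (x : RSpace d) :
    ‖normRpowGrad α x‖ ≤ α * (‖x‖⁻¹ * regNormRpow 1 α x) :=
  le_of_tendsto' (tendsto_classicalGrad_regNormRpow α x).norm fun n =>
    norm_classicalGrad_regNormRpow_le (by positivity) (one_div_natCast_add_one_le_one n) hα x

theorem norm_rpow_le_regNormRpow {α : ℝ} (hα : 0 ≤ α) (x : RSpace d) :
    ‖x‖ ^ α ≤ regNormRpow 1 α x :=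
  le_of_tendsto' (tendsto_regNormRpow hα x) fun n =>
    regNormRpow_mono (by positivity) (one_div_natCast_add_one_le_one n) hα x

theorem one_add_norm_rpow_le {α : ℝ} (hα : 0 ≤ α) (x : RSpace d) :
    (1 + ‖x‖) ^ α ≤ 2 ^ (α / 2) * regNormRpow 1 α x := by
  rw [regNormRpow, ← Real.mul_rpow zero_le_two (by positivity),
    rpow_eq_sq_rpow_half (by positivity)]
  gcongr
  nlinarith [sq_nonneg (1 - ‖x‖)]

end PowerWeight

section WeightedSolution

variable {d : ℕ} [Fact (3 ≤ d)] {V : RSpace d → ℝ} {u : RSpace d → ℂ}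
  {g : RSpace d → EuclideanSpace ℂ (Fin d)}

theorem InHDot.hasWeakGrad_norm_rpow_mul (h : InHDot u g) {α : ℝ} (hα : 0 ≤ α) :
    HasWeakGrad (fun x => ((‖x‖ ^ α : ℝ) : ℂ) * u x)
      (fun x => ((‖x‖ ^ α : ℝ) : ℂ) • g x + u x • normRpowGrad α x) := by
  have hJ : Continuous (regNormRpow 1 α : RSpace d → ℝ) :=
    (contDiff_regNormRpow one_pos α).continuous
  have hδ (n : ℕ) : (0 : ℝ) < 1 / ((n : ℝ) + 1) := by positivity
  have hle (n : ℕ) (x : RSpace d) :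
      ‖(regNormRpow (1 / ((n : ℝ) + 1)) α x : ℂ)‖ ≤ regNormRpow 1 α x := by
    rw [Complex.norm_real, Real.norm_of_nonneg (regNormRpow_nonneg (hδ n) α x)]
    exact regNormRpow_mono (hδ n) (one_div_natCast_add_one_le_one n) hα x
  have hlim (x : RSpace d) : Tendsto (fun n : ℕ => (regNormRpow (1 / ((n : ℝ) + 1)) α x : ℂ)) atTop
      (𝓝 ((‖x‖ ^ α : ℝ) : ℂ)) :=
    (Complex.continuous_ofReal.tendsto _).comp (tendsto_regNormRpow hα x)
  have hu : LocallyIntegrable fun x => regNormRpow 1 α x * ‖u x‖ :=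
    (locallyIntegrable_norm h.hasWeakGrad.1).continuous_smul hJ
  have hg : LocallyIntegrable fun x => regNormRpow 1 α x * ‖g x‖ :=
    (locallyIntegrable_norm h.hasWeakGrad.2.1).continuous_smul hJ
  have hhardy : LocallyIntegrable fun x => (α * regNormRpow 1 α x) * ‖‖x‖⁻¹ • u x‖ :=
    (locallyIntegrable_norm (h.memLp_inv_norm_smul.locallyIntegrable one_le_two)).continuous_smul
      (continuous_const.mul hJ)
  refine .of_dominated_convergence
    (fun n => h.hasWeakGrad.mul_contDiff (contDiff_regNormRpow (hδ n) α)) hu (hg.add hhardy)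
    (fun n => .of_forall fun x => ?_) (fun n => .of_forall fun x => ?_)
    (.of_forall fun x => (hlim x).mul_const _)
    (.of_forall fun x => ((hlim x).smul_const _).add
      ((tendsto_classicalGrad_regNormRpow α x).const_smul _))
  · rw [norm_mul]
    exact mul_le_mul_of_nonneg_right (hle n x) (norm_nonneg _)
  · refine (norm_add_le _ _).trans (add_le_add ?_ ?_)
    · rw [norm_smul]
      exact mul_le_mul_of_nonneg_right (hle n x) (norm_nonneg _)
    · calc ‖u x • classicalGrad (fun y => (regNormRpow (1 / ((n : ℝ) + 1)) α y : ℂ)) x‖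
          ≤ ‖u x‖ * (α * (‖x‖⁻¹ * regNormRpow 1 α x)) := by
            rw [norm_smul]
            gcongr
            exact norm_classicalGrad_regNormRpow_le (hδ n) (one_div_natCast_add_one_le_one n) hα x
        _ = α * regNormRpow 1 α x * ‖‖x‖⁻¹ • u x‖ := by
            rw [norm_smul, norm_inv, norm_norm]
            ring

theorem IsWeakSolution.memLp_grad_norm_rpow_mul (h : IsWeakSolution V u g)
    (hV : MemLp V ((d : ℝ≥0∞) / 2)) {α : ℝ} (hα : 0 ≤ α) (hα' : α < ((d : ℝ) - 2) / 2) :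
    MemLp (fun x => ((‖x‖ ^ α : ℝ) : ℂ) • g x + u x • normRpowGrad α x) 2 := by
  refine ((h.memLp_rpow_smul_grad hV hα hα').norm.add
    ((h.memLp_inv_norm_mul_rpow_smul hV hα hα').norm.const_mul α)).mono
    (h.1.hasWeakGrad_norm_rpow_mul hα).2.1.aestronglyMeasurable (.of_forall fun x => ?_)
  have hJ := regNormRpow_nonneg one_pos α x
  calc ‖((‖x‖ ^ α : ℝ) : ℂ) • g x + u x • normRpowGrad α x‖
      ≤ ‖x‖ ^ α * ‖g x‖ + ‖u x‖ * ‖normRpowGrad α x‖ := by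
        refine (norm_add_le _ _).trans_eq ?_
        rw [norm_smul, norm_smul, Complex.norm_real, Real.norm_of_nonneg (by positivity)]
    _ ≤ regNormRpow 1 α x * ‖g x‖ + ‖u x‖ * (α * (‖x‖⁻¹ * regNormRpow 1 α x)) := by
        gcongr
        · exact norm_rpow_le_regNormRpow hα x
        · exact norm_normRpowGrad_le hα x
    _ = ‖regNormRpow 1 α x • g x‖ + α * ‖(‖x‖⁻¹ * regNormRpow 1 α x) • u x‖ := by
        rw [norm_smul, norm_smul, Real.norm_of_nonneg hJ, Real.norm_of_nonneg (by positivity)]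
        ring
    _ ≤ _ := le_abs_self _

theorem IsWeakSolution.memLp_one_add_norm_rpow_mul (h : IsWeakSolution V u g)
    (hV : MemLp V ((d : ℝ≥0∞) / 2)) {α : ℝ} (hα : 0 ≤ α) (hα' : α < ((d : ℝ) - 2) / 2) :
    MemLp (fun x => (((1 + ‖x‖) ^ (α - 1) : ℝ) : ℂ) * u x) 2 := by
  have hweight : Measurable fun x : RSpace d => (((1 + ‖x‖) ^ (α - 1) : ℝ) : ℂ) := by fun_prop
  refine ((h.memLp_inv_norm_mul_rpow_smul hV hα hα').norm.const_mul (2 ^ (α / 2))).mono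
    (hweight.aestronglyMeasurable.mul h.1.memLp.1) ?_
  filter_upwards [ae_norm_pos] with x hx
  have hJ := regNormRpow_nonneg one_pos α x
  calc ‖(((1 + ‖x‖) ^ (α - 1) : ℝ) : ℂ) * u x‖ = (1 + ‖x‖) ^ α * (1 + ‖x‖)⁻¹ * ‖u x‖ := by
        rw [norm_mul, Complex.norm_real, Real.norm_of_nonneg (by positivity),
          Real.rpow_sub_one (by positivity), div_eq_mul_inv]
    _ ≤ 2 ^ (α / 2) * regNormRpow 1 α x * ‖x‖⁻¹ * ‖u x‖ := by
        gcongr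
        · exact one_add_norm_rpow_le hα x
        · linarith
    _ = 2 ^ (α / 2) * ‖(‖x‖⁻¹ * regNormRpow 1 α x) • u x‖ := by
        rw [norm_smul, Real.norm_of_nonneg (by positivity)]
        ring
    _ ≤ _ := le_abs_self _

theorem IsWeakSolution.exists_eigenvector (h : IsWeakSolution V u g)
    (hV : MemLp V ((d : ℝ≥0∞) / 2)) (hne : ¬ u =ᵐ[volume] 0) (hu : MemLp u 2) :
    ∃ w ∈ opEigenspace (schrodingerOp 1 V) 0,
      w ≠ 0 ∧ ((w : L2Space d) : RSpace d → ℂ) =ᵐ[volume] u := by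
  have hcoe := hu.coeFn_toLp
  have hgraph : ((hu.toLp u, 0) : L2Space d × L2Space d) ∈ schrodingerGraph 1 V := by
    refine ⟨g, (MemH1.memFormDomain hV ⟨hu, h.1.hasWeakGrad, h.1.memLp_grad⟩).congr hcoe.symm,
      fun v k hv => ?_⟩
    rw [inner_zero_right, Complex.ofReal_one, one_mul, ← h.2 v k hv.1.inHDot]
    congr 1
    refine integral_congr_ae ?_
    filter_upwards [hcoe] with x hx
    rw [hx]
  rw [← schrodingerOp_graph 1 hV, LinearPMap.mem_graph_iff] at hgraph
  obtain ⟨w, hw, hzero⟩ := hgraph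
  have hwu : ((w : L2Space d) : RSpace d → ℂ) =ᵐ[volume] u := hw ▸ hcoe
  refine ⟨w, ?_, ?_, hwu⟩
  · rw [opEigenspace, LinearMap.mem_ker, shiftedOp]
    simpa using hzero
  · rintro rfl
    exact hne (hwu.symm.trans (Lp.coeFn_zero ℂ 2 volume))

end WeightedSolution

theorem mainTheorem9_general (d : ℕ) (hd : 3 ≤ d) (V : RSpace d → ℝ)
    (hV : MemLp V ((d : ℝ≥0∞) / 2)) (hnn : SchrodingerNonneg V)
    (hneg : ∃ᶠ ε in 𝓝[>] (0 : ℝ), extInf (opSpectrum (schrodingerOp (1 - ε) V)) < 0) :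
    ∃ (φ : RSpace d → ℂ) (g : RSpace d → EuclideanSpace ℂ (Fin d)),
      MemHDot1 φ g ∧ ¬ (φ =ᵐ[volume] 0) ∧
      (Integrable fun x => V x * ‖φ x‖ ^ 2) ∧
      (∫ x, ‖g x‖ ^ 2) + (∫ x, V x * ‖φ x‖ ^ 2) = 0 ∧
      (∀ α : ℝ, 0 ≤ α → α < ((d : ℝ) - 2) / 2 →
        (∃ G : RSpace d → EuclideanSpace ℂ (Fin d),
          HasWeakGrad (fun x => ((‖x‖ ^ α : ℝ) : ℂ) * φ x) G ∧ MemLp G 2) ∧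
        MemLp (fun x => (((1 + ‖x‖) ^ (α - 1) : ℝ) : ℂ) * φ x) 2) ∧
      (5 ≤ d → ∃ u ∈ opEigenspace (schrodingerOp 1 V) 0,
        u ≠ 0 ∧ ((u : L2Space d) : RSpace d → ℂ) =ᵐ[volume] φ) := by
  have : Fact (3 ≤ d) := ⟨hd⟩
  obtain ⟨φ, g, hφ, hne⟩ := exists_isWeakSolution hV hnn hneg
  refine ⟨φ, g, hφ.1.memHDot1, hne, integrable_potential_sq hV hφ.1.memLp, hφ.energy_eq_zero,
    fun α hα hα' => ⟨⟨_, hφ.1.hasWeakGrad_norm_rpow_mul hα, hφ.memLp_grad_norm_rpow_mul hV hα hα'⟩,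
      hφ.memLp_one_add_norm_rpow_mul hV hα hα'⟩, fun hd5 => ?_⟩
  have hone : (1 : ℝ) < ((d : ℝ) - 2) / 2 := by
    have : (5 : ℝ) ≤ d := mod_cast hd5
    linarith
  have hφL2 : MemLp φ 2 := by simpa using hφ.memLp_one_add_norm_rpow_mul hV zero_le_one hone
  exact hφ.exists_eigenvector hV hne hφL2

theorem mainTheorem9 (d : ℕ) (hd : 3 ≤ d) (V : RSpace d → ℝ)
    (hV : ShortRange V) (hvl : HasVirtualLevelAtZero V) :
    ∃ (φ : RSpace d → ℂ) (g : RSpace d → EuclideanSpace ℂ (Fin d)),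
      MemHDot1 φ g ∧ ¬ (φ =ᵐ[volume] 0) ∧
      (Integrable fun x => V x * ‖φ x‖ ^ 2) ∧
      (∫ x, ‖g x‖ ^ 2) + (∫ x, V x * ‖φ x‖ ^ 2) = 0 ∧
      (∀ α : ℝ, 0 ≤ α → α < ((d : ℝ) - 2) / 2 →
        (∃ G : RSpace d → EuclideanSpace ℂ (Fin d),
          HasWeakGrad (fun x => ((‖x‖ ^ α : ℝ) : ℂ) * φ x) G ∧ MemLp G 2) ∧
        MemLp (fun x => (((1 + ‖x‖) ^ (α - 1) : ℝ) : ℂ) * φ x) 2) ∧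
      (5 ≤ d → ∃ u ∈ opEigenspace (schrodingerOp 1 V) 0,
        u ≠ 0 ∧ ((u : L2Space d) : RSpace d → ℂ) =ᵐ[volume] φ) :=
  mainTheorem9_general d hd V hV.memLp hvl.1 (hvl.2.mono fun _ h => h.2).frequently
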